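/- **Setting.** Terms $M,N$ are built from variables, names and constructors $f$ (with arities). Each destructor $g$ of arity $n$ has a finite set $\mathrm{def}(g)$ of rewrite rules $g(M_1,\dots,M_n)\to M$ between terms without names, every variable of $M$ occurring in $M_1,\dots,M_n$; $g(M'_1,\dots,M'_n)\to M'$ holds when it is an instance of a rule of $\mathrm{def}(g)$. Each constructor and destructor is public or private. Some public constructors $f$ are declared to be *data constructors*: for each $i$ there is a public destructor whose only rule is $g_i(f(x_1,\dots,x_n))\to x_i$. Processes, identified up to renaming of bound names and variables, are $$P,Q ::= \overline{M}\langle N\rangle.P \mid M(x).P \mid 0 \mid P|Q \mid\ !P \mid (\nu a)P \mid \mathtt{let}\ x=g(M_1,\dots,M_n)\ \mathtt{in}\ P\ \mathtt{else}\ Q \mid \mathtt{if}\ M=N\ \mathtt{then}\ P\ \mathtt{else}\ Q \mid \mathtt{event}(M).P .$$ A configuration $E,\mathcal P$ is a finite set of names and a finite multiset of closed processes; the reductions are: $0$ disappears; $!P$ becomes $P,!P$; $P|Q$ becomes $P,Q$; $(\nu a)P$ becomes $P\{a'/a\}$ for some $a'\notin E$, which is added to $E$; $\overline{N}\langle M\rangle.Q,\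 N(x).P$ become $Q,P\{M/x\}$; the destructor application becomes $P\{M'/x\}$ for any $M'$ with $g(M_1,\dots,M_n)\to M'$, and becomes $Q$ if there is no such $M'$; the conditional becomes $P$ if $M=N$ and $Q$ if $M\ne N$; $\mathtt{event}(M).P$ becomes $P$ (executing the event). Let $\mathrm{Init}$ be a finite set of names. An *$\mathrm{Init}$-adversary* is a closed process with free names in $\mathrm{Init}$, without events, using only public constructors and destructors. Atoms are $\mathrm{attacker}(M)$, $\mathrm{message}(M,M')$, $\mathrm{event}(M)$. A trace satisfies $\mathrm{message}(M,M')$ if one of its reductions communicates $M'$ on channel $M$; $\mathrm{attacker}(M)$ if one of its reductions communicates $M$ on a channel $c\in\mathrm{Init}$; $\mathrm{event}(M)$ if one of its reductions executes $\mathtt{event}(M)$. A closed process $P_0$ *satisfies the correspondence* $\alpha\Rightarrow\bigvee_{j=1}^m(\alpha_j\rightsquigarrow\bigwedge_{k=1}^{l_j}\mathrm{event}(M_{jk}))$ *against $\mathrm{Init}$-adversaries* if for every $\mathrm{Init}$-adversary $Q$, every finite set of names $E_0$ containing $\mathrm{Init}$, the free names of $P_0$ and the names of $\alpha,\alpha_j,M_{jk}$,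 every substitution $\sigma$ and every trace $\mathcal T$ from $E_0,\{P_0,Q\}$: if $\mathcal T$ satisfies $\sigma\alpha$, then there are $\sigma'$ and $j$ such that $\sigma'\alpha_j=\sigma\alpha$ and, for all $k$, $\mathcal T$ satisfies $\mathrm{event}(\sigma'M_{jk})$. **Clauses.** Patterns are built from variables, constructors, and names $a[p_1,\dots,p_n,i_1,\dots,i_{n'}]$ where $p_1,\dots,p_n$ are patterns and $i_1,\dots,i_{n'}$ are session identifiers (constants or session variables). Facts are $\mathrm{attacker}(p)$, $\mathrm{message}(p,p')$, $\mathrm{m\text{-}event}(p)$, $\mathrm{event}(p)$; a clause $H\Rightarrow C$ has a multiset $H$ of facts as hypotheses. The instrumented process $P_0'=\mathrm{instr}(P_0)$ labels each replication with a distinct session variable and each restriction $(\nu a)$ (all of them with distinct function symbols) with $a[t,s]$, where $t$ lists the variables bound above it by inputs and by applications of non-deterministic destructors, and $s$ the session variables of the replications above it. Its translation $[\![P]\!]\rho H$, where $\rho$ maps variables and names to patterns, is: * $[\![0]\!]\rho H=\emptyset$; $[\![P|Q]\!]\rho H=[\![P]\!]\rho H\cup[\![Q]\!]\rho H$; $[\![!^iP]\!]\rho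 H=[\![P]\!](\rho[i\mapsto i])H$; $[\![(\nu a:a[t,s])P]\!]\rho H=[\![P]\!](\rho[a\mapsto a[\rho(t),\rho(s)]])H$; * $[\![M(x).P]\!]\rho H=[\![P]\!](\rho[x\mapsto x])(H\wedge\mathrm{message}(\rho(M),x))$, with $x$ fresh; $[\![\overline M\langle N\rangle.P]\!]\rho H=[\![P]\!]\rho H\cup\{H\Rightarrow\mathrm{message}(\rho(M),\rho(N))\}$; * $[\![\mathtt{let}\ x=g(M_1,\dots,M_n)\ \mathtt{in}\ P\ \mathtt{else}\ Q]\!]\rho H$ is the union of $[\![Q]\!]\rho H$ and of the sets $[\![P]\!]((\sigma\rho)[x\mapsto\sigma'p'])(\sigma H)$ for the rules $g(p'_1,\dots,p'_n)\to p'$ in $\mathrm{def}(g)$ such that there is a most general pair $(\sigma,\sigma')$ with $\sigma\rho(M_i)=\sigma'p'_i$ for all $i$; * $[\![\mathtt{if}\ M=N\ \mathtt{then}\ P\ \mathtt{else}\ Q]\!]\rho H=[\![P]\!](\sigma\rho)(\sigma H)\cup[\![Q]\!]\rho H$ with $\sigma$ the most general unifier of $\rho(M),\rho(N)$ (the first set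 is omitted if there is none); * $[\![\mathtt{event}(M).P]\!]\rho H=[\![P]\!]\rho(H\wedge\mathrm{m\text{-}event}(\rho(M)))\cup\{H\Rightarrow\mathrm{event}(\rho(M))\}$. $\mathcal R_{P'_0,\mathrm{Init}}$ consists of $[\![P'_0]\!]\{a\mapsto a[\,]\}\emptyset$ and the attacker clauses: $\mathrm{attacker}(a[\,])$ for $a\in\mathrm{Init}$; $\mathrm{attacker}(b_0[x])$ for a special symbol $b_0$; $\bigwedge_i\mathrm{attacker}(x_i)\Rightarrow\mathrm{attacker}(f(x_1,\dots,x_n))$ for each public $f$; $\bigwedge_i\mathrm{attacker}(M_i)\Rightarrow\mathrm{attacker}(M)$ for each rule $g(M_1,\dots,M_n)\to M$ of each public $g$; $\mathrm{message}(x,y)\wedge\mathrm{attacker}(x)\Rightarrow\mathrm{attacker}(y)$; $\mathrm{attacker}(x)\wedge\mathrm{attacker}(y)\Rightarrow\mathrm{message}(x,y)$. **Algorithm.** Fix a set $\mathcal F_{\mathrm{not}}$ of facts (secrecy assumptions) and a selection function $\mathrm{sel}$, mapping each clause to a set of its hypotheses, which never selects unselectable facts (those of the form $\mathrm{attacker}(x)$,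 $x$ a variable, or $\mathrm{m\text{-}event}(p)$) and such that $\mathrm{sel}(H\Rightarrow\mathrm{attacker}(x))\neq\emptyset$ when $H$ contains a selectable fact. If the conclusion of $R=H\Rightarrow C$ and a hypothesis $F_0$ of $R'=H'\Rightarrow C'$ have a most general unifier $\sigma$ (variables renamed apart), $R\circ_{F_0}R'=\sigma(H\cup(H'\setminus\{F_0\}))\Rightarrow\sigma C'$. $H_1\Rightarrow C_1$ subsumes $H_2\Rightarrow C_2$ if $\sigma C_1=C_2$ and $\sigma H_1\subseteq H_2$ (multiset inclusion) for some $\sigma$; $\mathrm{elim}$ removes subsumed clauses from a set. $\mathrm{simplify}$ does successively the following: decompose recursively $\mathrm{attacker}(f(p_1,\dots,p_n))$, $f$ a data constructor, into $\mathrm{attacker}(p_1),\dots,\mathrm{attacker}(p_n)$ in hypotheses and in the conclusion (one clause per component of the conclusion), leaving unchanged the attacker clauses of the data constructors and of their projections; remove duplicate hypotheses; remove some redundant hypotheses (as user settings prescribe; $H\wedge H'\Rightarrow C$ becomes $H'\Rightarrow C$ if some $\sigma$ maps $H$ into $H'$ and leaves the variables of $H'$ and $C$ unchanged); delete clauses that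 have an instance of a fact of $\mathcal F_{\mathrm{not}}$ as hypothesis; delete clauses whose conclusion is one of their hypotheses; remove hypotheses $\mathrm{attacker}(x)$ where the variable $x$ does not occur elsewhere in the clause. $\mathrm{simplify}'$ is the same without decomposition of conclusions and without deletion of tautologies. $\mathrm{saturate}(\mathcal R_0)$ starts from $\mathcal R=\emptyset$, does $\mathcal R\leftarrow\mathrm{elim}(\mathrm{simplify}(R)\cup\mathcal R)$ for each $R\in\mathcal R_0$, then repeats $\mathcal R\leftarrow\mathrm{elim}(\mathrm{simplify}(R\circ_{F_0}R')\cup\mathcal R)$ for $R,R'\in\mathcal R$ with $\mathrm{sel}(R)=\emptyset$ and $F_0\in\mathrm{sel}(R')$ until a fixpoint is reached, and returns $\{R\in\mathcal R\mid\mathrm{sel}(R)=\emptyset\}$. $\mathrm{deriv}(R,\mathcal R,\mathcal R_1)$ is $\emptyset$ if some clause of $\mathcal R$ subsumes $R$; otherwise $\{R\}$ if $\mathrm{sel}(R)=\emptyset$; otherwise the union of the sets $\mathrm{deriv}(R'',\{R\}\cup\mathcal R,\mathcal R_1)$ for $R''\in\mathrm{simplify}'(R'\circ_{F_0}R)$,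 $R'\in\mathcal R_1$, $F_0\in\mathrm{sel}(R)$. $\mathrm{derivable}(F,\mathcal R_1)=\mathrm{deriv}(F\Rightarrow F,\emptyset,\mathcal R_1)$. Finally $\mathrm{solve}_{P'_0,\mathrm{Init}}(F)$ computes $\mathcal R_1=\mathrm{saturate}(\mathcal R_{P'_0,\mathrm{Init}})$, fails with an error if $\mathrm{derivable}(F',\mathcal R_1)\ne\emptyset$ for some $F'\in\mathcal F_{\mathrm{not}}$, and otherwise returns $\mathrm{derivable}(F,\mathcal R_1)$. **Theorem.** Let $P_0$ be a closed process and $P'_0=\mathrm{instr}(P_0)$. Let $M_{jk}$ ($1\le j\le m$, $1\le k\le l_j$) be terms and $\alpha,\alpha_j$ ($1\le j\le m$) atoms; let $p_{jk},F,F_j$ be the patterns and facts obtained from $M_{jk},\alpha,\alpha_j$ by replacing each name $a$ with $a[\,]$. Suppose that $\mathrm{solve}_{P'_0,\mathrm{Init}}(F)$ terminates without error, and that for every clause $R\in\mathrm{solve}_{P'_0,\mathrm{Init}}(F)$ there are $j\in\{1,\dots,m\}$ and a substitution $\sigma'$ such that the conclusion of $R$ is $\sigma'F_j$ and all of $\mathrm{m\text{-}event}(\sigma'p_{j1}),\dots,\mathrm{m\text{-}event}(\sigma'p_{jl_j})$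 are among the hypotheses of $R$, that is, $R=H\wedge\mathrm{m\text{-}event}(\sigma'p_{j1})\wedge\dots\wedge\mathrm{m\text{-}event}(\sigma'p_{jl_j})\Rightarrow\sigma'F_j$ for some $H$. Then $P_0$ satisfies the correspondence $$\alpha\Rightarrow\bigvee_{j=1}^m\Big(\alpha_j\rightsquigarrow\bigwedge_{k=1}^{l_j}\mathrm{event}(M_{jk})\Big)$$ against $\mathrm{Init}$-adversaries. -/

import Mathlib

namespace ProVerif

/-! ## Terms and destructors -/

/-- The countably infinite set of free and run-time names. -/
abbrev Name : Type := ℕ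

/-- A set of constructors with their arities. -/
structure ConSig where
  Con : Type
  arity : Con → ℕ

/-- Terms built from variables in `V`, names in `N` and constructors applied to as many arguments
as their arity. -/
inductive Term (S : ConSig) (V N : Type) : Type
  | var (v : V) : Term S V N
  | name (a : N) : Term S V N
  | app (f : S.Con) (args : Fin (S.arity f) → Term S V N) : Term S V N

/-- Simultaneous replacement of variables and names by terms. -/
def Term.bind {S : ConSig} {V N V' N' : Type} (θ : V → Term S V' N') (ν : N → Term S V' N') :
    Term S V N → Term S V' N'
  | .var v => θ v
  | .name a => ν a
  | .app f args => .app f (fun i => (args i).bind θ ν)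

def Term.vars {S : ConSig} {V N : Type} : Term S V N → Set V
  | .var v => {v}
  | .name _ => ∅
  | .app _ args => ⋃ i, (args i).vars

def Term.names {S : ConSig} {V N : Type} : Term S V N → Set N
  | .var _ => ∅
  | .name a => {a}
  | .app _ args => ⋃ i, (args i).names

/-- All constructors occurring in the term satisfy `pub`. -/
def Term.OnlyCon {S : ConSig} {V N : Type} (pub : S.Con → Prop) : Term S V N → Prop
  | .var _ => True
  | .name _ => True
  | .app f args => pub f ∧ ∀ i, (args i).OnlyCon pub

/-- A rewrite rule `g(M₁, …, Mₙ) → M`; its terms contain no names (their type of names is empty),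
and the variables of `M` occur in `M₁, …, Mₙ`. -/
structure RewRule (S : ConSig) (n : ℕ) where
  k : ℕ
  lhs : Fin n → Term S (Fin k) Empty
  rhs : Term S (Fin k) Empty
  rhs_vars : rhs.vars ⊆ ⋃ i, (lhs i).vars

/-- The rule `g(f(x₁, …, xₙ)) → xᵢ` of a projection `g`, whose number `d` of arguments is one. -/
def projRule (S : ConSig) (f : S.Con) (i : Fin (S.arity f)) (d : ℕ) (hd : d = 1) : RewRule S d where
  k := S.arity f
  lhs := fun _ => .app f (fun j => .var j)
  rhs := .var i
  rhs_vars := by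
    subst hd
    intro v hv
    simp only [Term.vars, Set.mem_singleton_iff] at hv
    subst hv
    simp [Term.vars]

/-- The constructors and destructors, with the finite lists `def(g)` of rewrite rules. Each of
them is public or private. The constructors in `data` are the data constructors: these
and their associated projections are public. -/
structure Calculus extends ConSig where
  Des : Type
  darity : Des → ℕ
  rules : (g : Des) → List (RewRule toConSig (darity g))
  pubCon : Con → Prop
  pubDes : Des → Prop
  data : Set Con
  data_pub : ∀ f ∈ data, pubCon f
  data_proj : ∀ f ∈ data, ∀ i : Fin (arity f), ∃ g, pubDes g ∧
    ∃ hd : darity g = 1, rules g = [projRule toConSig f i (darity g) hd]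

/-- Terms whose variables are among `n` bound variables and whose names are either free
(`Sum.inl`) or among `m` names bound by restrictions (`Sum.inr`). -/
abbrev PTerm (𝒞 : Calculus) (n m : ℕ) : Type := Term 𝒞.toConSig (Fin n) (Name ⊕ Fin m)

/-- Closed terms. -/
abbrev CTerm (𝒞 : Calculus) : Type := PTerm 𝒞 0 0

/-- `g(M₁, …, Mₙ) → M'` on closed terms. -/
def Calculus.Reduces (𝒞 : Calculus) (g : 𝒞.Des) (args : Fin (𝒞.darity g) → CTerm 𝒞)
    (M' : CTerm 𝒞) : Prop :=
  ∃ r ∈ 𝒞.rules g, ∃ θ : Fin r.k → CTerm 𝒞,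
    (∀ i, args i = (r.lhs i).bind θ Empty.elim) ∧ M' = r.rhs.bind θ Empty.elim

/-- `g` may return several different results for the same arguments. -/
def Calculus.NonDet (𝒞 : Calculus) (g : 𝒞.Des) : Prop :=
  ∃ args M M', 𝒞.Reduces g args M ∧ 𝒞.Reduces g args M' ∧ M ≠ M'

/-! ## Processes

Bound variables and bound names are de Bruijn indices (`0` is the innermost binder), so that
processes are identified up to renaming of bound names and variables. -/

/-- Processes with at most `n` free variables and `m` names bound from outside. -/
inductive Proc (𝒞 : Calculus) : ℕ → ℕ → Type
  | nil {n m : ℕ} : Proc 𝒞 n m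
  | out {n m : ℕ} (M N : PTerm 𝒞 n m) (P : Proc 𝒞 n m) : Proc 𝒞 n m
  | inp {n m : ℕ} (M : PTerm 𝒞 n m) (P : Proc 𝒞 (n + 1) m) : Proc 𝒞 n m
  | par {n m : ℕ} (P Q : Proc 𝒞 n m) : Proc 𝒞 n m
  | repl {n m : ℕ} (P : Proc 𝒞 n m) : Proc 𝒞 n m
  | res {n m : ℕ} (P : Proc 𝒞 n (m + 1)) : Proc 𝒞 n m
  | dlet {n m : ℕ} (g : 𝒞.Des) (args : Fin (𝒞.darity g) → PTerm 𝒞 n m)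
      (P : Proc 𝒞 (n + 1) m) (Q : Proc 𝒞 n m) : Proc 𝒞 n m
  | ite {n m : ℕ} (M N : PTerm 𝒞 n m) (P Q : Proc 𝒞 n m) : Proc 𝒞 n m
  | event {n m : ℕ} (M : PTerm 𝒞 n m) (P : Proc 𝒞 n m) : Proc 𝒞 n m

/-- Closed processes. -/
abbrev CProc (𝒞 : Calculus) : Type := Proc 𝒞 0 0

/-- Replacement of bound variables by terms and of bound names by names. -/
def PTerm.subst {𝒞 : Calculus} {n m n' m' : ℕ} (θ : Fin n → PTerm 𝒞 n' m')
    (ν : Fin m → Name ⊕ Fin m') (M : PTerm 𝒞 n m) : PTerm 𝒞 n' m' :=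
  Term.bind θ (Sum.elim (fun a => .name (.inl a)) (fun b => .name (ν b))) M

/-- Extension of a substitution under a binder of a variable. -/
def liftVar {𝒞 : Calculus} {n n' m' : ℕ} (θ : Fin n → PTerm 𝒞 n' m') :
    Fin (n + 1) → PTerm 𝒞 (n' + 1) m' :=
  Fin.cons (.var 0) (fun i => (θ i).subst (fun j => .var j.succ) .inr)

/-- The terms of a substitution, seen under one more restriction. -/
def weakenName {𝒞 : Calculus} {n n' m' : ℕ} (θ : Fin n → PTerm 𝒞 n' m') :
    Fin n → PTerm 𝒞 n' (m' + 1) :=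
  fun i => (θ i).subst .var (fun b => .inr b.succ)

/-- Extension of a renaming of names under a restriction. -/
def liftName {m m' : ℕ} (ν : Fin m → Name ⊕ Fin m') : Fin (m + 1) → Name ⊕ Fin (m' + 1) :=
  Fin.cons (.inr 0) (fun b => (ν b).map id Fin.succ)

def Proc.subst {𝒞 : Calculus} : {n m n' m' : ℕ} → (Fin n → PTerm 𝒞 n' m') →
    (Fin m → Name ⊕ Fin m') → Proc 𝒞 n m → Proc 𝒞 n' m'
  | _, _, _, _, _, _, .nil => .nil
  | _, _, _, _, θ, ν, .out M N P => .out (M.subst θ ν) (N.subst θ ν) (P.subst θ ν)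
  | _, _, _, _, θ, ν, .inp M P => .inp (M.subst θ ν) (P.subst (liftVar θ) ν)
  | _, _, _, _, θ, ν, .par P Q => .par (P.subst θ ν) (Q.subst θ ν)
  | _, _, _, _, θ, ν, .repl P => .repl (P.subst θ ν)
  | _, _, _, _, θ, ν, .res P => .res (P.subst (weakenName θ) (liftName ν))
  | _, _, _, _, θ, ν, .dlet g args P Q =>
      .dlet g (fun i => (args i).subst θ ν) (P.subst (liftVar θ) ν) (Q.subst θ ν)
  | _, _, _, _, θ, ν, .ite M N P Q =>
      .ite (M.subst θ ν) (N.subst θ ν) (P.subst θ ν) (Q.subst θ ν)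
  | _, _, _, _, θ, ν, .event M P => .event (M.subst θ ν) (P.subst θ ν)

/-- `P{M/x}` for the only free variable `x` of `P`. -/
def Proc.instVar {𝒞 : Calculus} (P : Proc 𝒞 (0 + 1) 0) (M : CTerm 𝒞) : CProc 𝒞 :=
  P.subst (fun _ => M) Fin.elim0

/-- `P{a'/a}` for the restricted name `a`. -/
def Proc.instName {𝒞 : Calculus} (P : Proc 𝒞 0 (0 + 1)) (a' : Name) : CProc 𝒞 :=
  P.subst Fin.elim0 (fun _ => .inl a')

/-- Free names of a term. -/
def PTerm.fn {𝒞 : Calculus} {n m : ℕ} (M : PTerm 𝒞 n m) : Set Name := {a | .inl a ∈ Term.names M}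

/-- Free names of a process. -/
def Proc.fn {𝒞 : Calculus} : {n m : ℕ} → Proc 𝒞 n m → Set Name
  | _, _, .nil => ∅
  | _, _, .out M N P => M.fn ∪ N.fn ∪ P.fn
  | _, _, .inp M P => M.fn ∪ P.fn
  | _, _, .par P Q => P.fn ∪ Q.fn
  | _, _, .repl P => P.fn
  | _, _, .res P => P.fn
  | _, _, .dlet _ args P Q => (⋃ i, (args i).fn) ∪ P.fn ∪ Q.fn
  | _, _, .ite M N P Q => M.fn ∪ N.fn ∪ P.fn ∪ Q.fn
  | _, _, .event M P => M.fn ∪ P.fn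

/-- The process contains no event. -/
def Proc.NoEvent {𝒞 : Calculus} : {n m : ℕ} → Proc 𝒞 n m → Prop
  | _, _, .nil => True
  | _, _, .out _ _ P => P.NoEvent
  | _, _, .inp _ P => P.NoEvent
  | _, _, .par P Q => P.NoEvent ∧ Q.NoEvent
  | _, _, .repl P => P.NoEvent
  | _, _, .res P => P.NoEvent
  | _, _, .dlet _ _ P Q => P.NoEvent ∧ Q.NoEvent
  | _, _, .ite _ _ P Q => P.NoEvent ∧ Q.NoEvent
  | _, _, .event _ _ => False

/-- The process uses only public constructors and public destructors. -/
def Proc.OnlyPublic {𝒞 : Calculus} : {n m : ℕ} → Proc 𝒞 n m → Prop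
  | _, _, .nil => True
  | _, _, .out M N P => M.OnlyCon 𝒞.pubCon ∧ N.OnlyCon 𝒞.pubCon ∧ P.OnlyPublic
  | _, _, .inp M P => M.OnlyCon 𝒞.pubCon ∧ P.OnlyPublic
  | _, _, .par P Q => P.OnlyPublic ∧ Q.OnlyPublic
  | _, _, .repl P => P.OnlyPublic
  | _, _, .res P => P.OnlyPublic
  | _, _, .dlet g args P Q =>
      𝒞.pubDes g ∧ (∀ i, (args i).OnlyCon 𝒞.pubCon) ∧ P.OnlyPublic ∧ Q.OnlyPublic
  | _, _, .ite M N P Q =>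
      M.OnlyCon 𝒞.pubCon ∧ N.OnlyCon 𝒞.pubCon ∧ P.OnlyPublic ∧ Q.OnlyPublic
  | _, _, .event M P => M.OnlyCon 𝒞.pubCon ∧ P.OnlyPublic

/-- `Init`-adversaries. -/
structure IsAdversary {𝒞 : Calculus} (Init : Finset Name) (Q : CProc 𝒞) : Prop where
  fn_subset : Q.fn ⊆ (Init : Set Name)
  noEvent : Q.NoEvent
  onlyPublic : Q.OnlyPublic

/-! ## Operational semantics -/

/-- Semantic configurations `E, 𝒫`. -/
structure Config (𝒞 : Calculus) where
  env : Finset Name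
  procs : Multiset (CProc 𝒞)

inductive Step {𝒞 : Calculus} : Config 𝒞 → Config 𝒞 → Prop
  | nil (E : Finset Name) (Ps : Multiset (CProc 𝒞)) :
      Step ⟨E, Ps + {.nil}⟩ ⟨E, Ps⟩
  | repl (E : Finset Name) (Ps : Multiset (CProc 𝒞)) (P : CProc 𝒞) :
      Step ⟨E, Ps + {.repl P}⟩ ⟨E, Ps + {P, .repl P}⟩
  | par (E : Finset Name) (Ps : Multiset (CProc 𝒞)) (P Q : CProc 𝒞) :
      Step ⟨E, Ps + {.par P Q}⟩ ⟨E, Ps + {P, Q}⟩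
  | res (E : Finset Name) (Ps : Multiset (CProc 𝒞)) (P : Proc 𝒞 0 (0 + 1)) (a' : Name)
      (ha' : a' ∉ E) :
      Step ⟨E, Ps + {.res P}⟩ ⟨insert a' E, Ps + {P.instName a'}⟩
  | io (E : Finset Name) (Ps : Multiset (CProc 𝒞)) (N M : CTerm 𝒞) (Q : CProc 𝒞)
      (P : Proc 𝒞 (0 + 1) 0) :
      Step ⟨E, Ps + {.out N M Q, .inp N P}⟩ ⟨E, Ps + {Q, P.instVar M}⟩
  | destr1 (E : Finset Name) (Ps : Multiset (CProc 𝒞)) (g : 𝒞.Des)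
      (args : Fin (𝒞.darity g) → CTerm 𝒞) (P : Proc 𝒞 (0 + 1) 0) (Q : CProc 𝒞) (M' : CTerm 𝒞)
      (h : 𝒞.Reduces g args M') :
      Step ⟨E, Ps + {.dlet g args P Q}⟩ ⟨E, Ps + {P.instVar M'}⟩
  | destr2 (E : Finset Name) (Ps : Multiset (CProc 𝒞)) (g : 𝒞.Des)
      (args : Fin (𝒞.darity g) → CTerm 𝒞) (P : Proc 𝒞 (0 + 1) 0) (Q : CProc 𝒞)
      (h : ¬ ∃ M', 𝒞.Reduces g args M') :
      Step ⟨E, Ps + {.dlet g args P Q}⟩ ⟨E, Ps + {Q}⟩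
  | cond1 (E : Finset Name) (Ps : Multiset (CProc 𝒞)) (M : CTerm 𝒞) (P Q : CProc 𝒞) :
      Step ⟨E, Ps + {.ite M M P Q}⟩ ⟨E, Ps + {P}⟩
  | cond2 (E : Finset Name) (Ps : Multiset (CProc 𝒞)) (M N : CTerm 𝒞) (P Q : CProc 𝒞)
      (h : M ≠ N) :
      Step ⟨E, Ps + {.ite M N P Q}⟩ ⟨E, Ps + {Q}⟩
  | event (E : Finset Name) (Ps : Multiset (CProc 𝒞)) (M : CTerm 𝒞) (P : CProc 𝒞) :
      Step ⟨E, Ps + {.event M P}⟩ ⟨E, Ps + {P}⟩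

/-! ## Correspondences -/

/-- Atoms with variables among `n` variables; the closed atoms are those with `n = 0`. -/
inductive Atom (𝒞 : Calculus) (n : ℕ) : Type
  | attacker (M : PTerm 𝒞 n 0) : Atom 𝒞 n
  | message (M M' : PTerm 𝒞 n 0) : Atom 𝒞 n
  | event (M : PTerm 𝒞 n 0) : Atom 𝒞 n

/-- Application of a closed substitution to a term. -/
abbrev PTerm.inst {𝒞 : Calculus} {n : ℕ} (σ : Fin n → CTerm 𝒞) (M : PTerm 𝒞 n 0) : CTerm 𝒞 :=
  M.subst σ .inr

/-- Application of a closed substitution to an atom. -/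
def Atom.inst {𝒞 : Calculus} {n : ℕ} (σ : Fin n → CTerm 𝒞) : Atom 𝒞 n → Atom 𝒞 0
  | .attacker M => .attacker (M.inst σ)
  | .message M M' => .message (M.inst σ) (M'.inst σ)
  | .event M => .event (M.inst σ)

def Atom.fn {𝒞 : Calculus} {n : ℕ} : Atom 𝒞 n → Set Name
  | .attacker M => M.fn
  | .message M M' => M.fn ∪ M'.fn
  | .event M => M.fn

/-- The pair `C, C'` is a reduction by communication of `M'` on the channel `M`. -/
def IsComm {𝒞 : Calculus} (M M' : CTerm 𝒞) (C C' : Config 𝒞) : Prop :=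
  ∃ (E : Finset Name) (Ps : Multiset (CProc 𝒞)) (Q : CProc 𝒞) (P : Proc 𝒞 (0 + 1) 0),
    C = ⟨E, Ps + {.out M M' Q, .inp M P}⟩ ∧ C' = ⟨E, Ps + {Q, P.instVar M'}⟩

/-- The pair `C, C'` is a reduction that executes `event(M)`. -/
def IsEvent {𝒞 : Calculus} (M : CTerm 𝒞) (C C' : Config 𝒞) : Prop :=
  ∃ (E : Finset Name) (Ps : Multiset (CProc 𝒞)) (P : CProc 𝒞),
    C = ⟨E, Ps + {.event M P}⟩ ∧ C' = ⟨E, Ps + {P}⟩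

/-- The configurations `T 0, …, T len` form a trace. -/
def IsTrace {𝒞 : Calculus} (T : ℕ → Config 𝒞) (len : ℕ) : Prop :=
  ∀ i < len, Step (T i) (T (i + 1))

/-- The trace `T 0 → … → T len` satisfies a closed atom. -/
def TraceSat {𝒞 : Calculus} (Init : Finset Name) (T : ℕ → Config 𝒞) (len : ℕ) :
    Atom 𝒞 0 → Prop
  | .attacker M => ∃ i < len, ∃ c ∈ Init, IsComm (.name (.inl c)) M (T i) (T (i + 1))
  | .message M M' => ∃ i < len, IsComm M M' (T i) (T (i + 1))
  | .event M => ∃ i < len, IsEvent M (T i) (T (i + 1))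

/-- The data of a correspondence `α ⇒ ⋁ⱼ (αⱼ ⇝ ⋀ₖ event(Mⱼₖ))`, `1 ≤ j ≤ m`, `1 ≤ k ≤ lⱼ`, with
variables among `n` variables. -/
structure Correspondence (𝒞 : Calculus) (n : ℕ) where
  α : Atom 𝒞 n
  m : ℕ
  αs : Fin m → Atom 𝒞 n
  l : Fin m → ℕ
  M : (j : Fin m) → Fin (l j) → PTerm 𝒞 n 0

/-- Names occurring in the correspondence. -/
def Correspondence.fn {𝒞 : Calculus} {n : ℕ} (c : Correspondence 𝒞 n) : Set Name :=
  c.α.fn ∪ (⋃ j, (c.αs j).fn) ∪ ⋃ j, ⋃ k, (c.M j k).fn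

/-- The closed process `P₀` satisfies the correspondence against `Init`-adversaries. -/
def Satisfies {𝒞 : Calculus} {n : ℕ} (P₀ : CProc 𝒞) (Init : Finset Name)
    (c : Correspondence 𝒞 n) : Prop :=
  ∀ Q : CProc 𝒞, IsAdversary Init Q →
  ∀ E₀ : Finset Name, P₀.fn ∪ (Init : Set Name) ∪ c.fn ⊆ (E₀ : Set Name) →
  ∀ σ : Fin n → CTerm 𝒞,
  ∀ (T : ℕ → Config 𝒞) (len : ℕ), T 0 = ⟨E₀, {P₀, Q}⟩ → IsTrace T len →
    TraceSat Init T len (c.α.inst σ) →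
    ∃ (σ' : Fin n → CTerm 𝒞) (j : Fin c.m), (c.αs j).inst σ' = c.α.inst σ ∧
      ∀ k, TraceSat Init T len (.event ((c.M j k).inst σ'))

/-! ## Patterns, facts and clauses -/

/-- Name function symbols: one for each free name, one for each restriction of the process
(restrictions are denoted by their position in the syntax tree), and the symbol `b₀` for the names
created by the adversary. -/
inductive NameSym : Type
  | free (a : Name) : NameSym
  | bound (pos : List Bool) : NameSym
  | b0 : NameSym

/-- Session identifiers: variables in `V_s` and constants. -/
inductive SessId : Type
  | var (i : ℕ) : SessId
  | const (c : ℕ) : SessId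

/-- Patterns: ordinary variables, names `a[p₁, …, pₖ, i₁, …, iₖ']` and constructor applications. -/
inductive Pattern (S : ConSig) : Type
  | var (x : ℕ) : Pattern S
  | name (a : NameSym) (k : ℕ) (args : Fin k → Pattern S) (sess : List SessId) : Pattern S
  | app (f : S.Con) (args : Fin (S.arity f) → Pattern S) : Pattern S

/-- Substitutions map ordinary variables to patterns and session variables to session
identifiers. -/
structure Subst (S : ConSig) where
  ord : ℕ → Pattern S
  sess : ℕ → SessId

def SessId.subst {S : ConSig} (σ : Subst S) : SessId → SessId
  | .var i => σ.sess i
  | .const c => .const c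

def Pattern.subst {S : ConSig} (σ : Subst S) : Pattern S → Pattern S
  | .var x => σ.ord x
  | .name a k args sess => .name a k (fun i => (args i).subst σ) (sess.map (SessId.subst σ))
  | .app f args => .app f (fun i => (args i).subst σ)

/-- Ordinary variables of a pattern. -/
def Pattern.vars {S : ConSig} : Pattern S → Set ℕ
  | .var x => {x}
  | .name _ _ args _ => ⋃ i, (args i).vars
  | .app _ args => ⋃ i, (args i).vars

/-- Session variables of a pattern. -/
def Pattern.sessVars {S : ConSig} : Pattern S → Set ℕ
  | .var _ => ∅
  | .name _ _ args sess => (⋃ i, (args i).sessVars) ∪ {i | SessId.var i ∈ sess}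
  | .app _ args => ⋃ i, (args i).sessVars

/-- Facts; `mevent` is the must-event predicate, `event` the may-event predicate. -/
inductive HornFact (S : ConSig) : Type
  | attacker (p : Pattern S) : HornFact S
  | message (p p' : Pattern S) : HornFact S
  | mevent (p : Pattern S) : HornFact S
  | event (p : Pattern S) : HornFact S

def HornFact.subst {S : ConSig} (σ : Subst S) : HornFact S → HornFact S
  | .attacker p => .attacker (p.subst σ)
  | .message p p' => .message (p.subst σ) (p'.subst σ)
  | .mevent p => .mevent (p.subst σ)
  | .event p => .event (p.subst σ)

def HornFact.vars {S : ConSig} : HornFact S → Set ℕ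
  | .attacker p => p.vars
  | .message p p' => p.vars ∪ p'.vars
  | .mevent p => p.vars
  | .event p => p.vars

def HornFact.sessVars {S : ConSig} : HornFact S → Set ℕ
  | .attacker p => p.sessVars
  | .message p p' => p.sessVars ∪ p'.sessVars
  | .mevent p => p.sessVars
  | .event p => p.sessVars

/-- Clauses `F₁ ∧ … ∧ Fₙ ⇒ F`, with a multiset of hypotheses. -/
@[ext]
structure Clause (S : ConSig) where
  hyps : Multiset (HornFact S)
  concl : HornFact S

/-- The facts of a clause. -/
def Clause.facts {S : ConSig} (R : Clause S) : Set (HornFact S) := {F | F ∈ R.hyps ∨ F = R.concl}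

/-- The pattern of a term, given the patterns of its variables and names. -/
def Term.toPattern {S : ConSig} {V N : Type} (ρ : V → Pattern S) (ν : N → Pattern S) :
    Term S V N → Pattern S
  | .var v => ρ v
  | .name a => ν a
  | .app f args => .app f (fun i => (args i).toPattern ρ ν)

/-- The pattern `a[]` of a free name `a`. -/
def freeName {S : ConSig} (a : Name) : Pattern S := .name (.free a) 0 Fin.elim0 []

/-- The pattern obtained from a term by replacing names `a` with `a[]`. -/
def PTerm.pat {𝒞 : Calculus} {n : ℕ} (M : PTerm 𝒞 n 0) : Pattern 𝒞.toConSig :=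
  Term.toPattern (fun x : Fin n => .var x) (Sum.elim freeName Fin.elim0) M

/-- The fact obtained from an atom by replacing names `a` with `a[]`. -/
def Atom.fact {𝒞 : Calculus} {n : ℕ} : Atom 𝒞 n → HornFact 𝒞.toConSig
  | .attacker M => .attacker M.pat
  | .message M M' => .message M.pat M'.pat
  | .event M => .event M.pat

/-! ## Instrumented processes -/

/-- Instrumented processes. A replication binds a session variable (a de Bruijn index; there are
`s` of them from outside), and a restriction carries a label `a[M₁, …, Mₖ, i₁, …, iₖ']`. -/
inductive IProc (𝒞 : Calculus) : ℕ → ℕ → ℕ → Type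
  | nil {n m s : ℕ} : IProc 𝒞 n m s
  | out {n m s : ℕ} (M N : PTerm 𝒞 n m) (P : IProc 𝒞 n m s) : IProc 𝒞 n m s
  | inp {n m s : ℕ} (M : PTerm 𝒞 n m) (P : IProc 𝒞 (n + 1) m s) : IProc 𝒞 n m s
  | par {n m s : ℕ} (P Q : IProc 𝒞 n m s) : IProc 𝒞 n m s
  | repl {n m s : ℕ} (P : IProc 𝒞 n m (s + 1)) : IProc 𝒞 n m s
  | res {n m s : ℕ} (a : NameSym) (t : List (PTerm 𝒞 n m)) (is : List (Fin s))
      (P : IProc 𝒞 n (m + 1) s) : IProc 𝒞 n m s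
  | dlet {n m s : ℕ} (g : 𝒞.Des) (args : Fin (𝒞.darity g) → PTerm 𝒞 n m)
      (P : IProc 𝒞 (n + 1) m s) (Q : IProc 𝒞 n m s) : IProc 𝒞 n m s
  | ite {n m s : ℕ} (M N : PTerm 𝒞 n m) (P Q : IProc 𝒞 n m s) : IProc 𝒞 n m s
  | event {n m s : ℕ} (M : PTerm 𝒞 n m) (P : IProc 𝒞 n m s) : IProc 𝒞 n m s

open Classical in
/-- Instrumentation of a subprocess at position `pos`; `t` is the sequence of variables bound above
by inputs and by non-deterministic destructor applications, and `is` the sequence of session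
variables of the replications above, both from top to bottom. -/
noncomputable def Proc.instrAux {𝒞 : Calculus} : {n m : ℕ} → (s : ℕ) → (t : List (Fin n)) →
    (is : List (Fin s)) → (pos : List Bool) → Proc 𝒞 n m → IProc 𝒞 n m s
  | _, _, _, _, _, _, .nil => .nil
  | _, _, s, t, is, pos, .out M N P => .out M N (P.instrAux s t is (false :: pos))
  | _, _, s, t, is, pos, .inp M P =>
      .inp M (P.instrAux s (t.map Fin.succ ++ [0]) is (false :: pos))
  | _, _, s, t, is, pos, .par P Q =>
      .par (P.instrAux s t is (false :: pos)) (Q.instrAux s t is (true :: pos))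
  | _, _, s, t, is, pos, .repl P =>
      .repl (P.instrAux (s + 1) t (is.map Fin.succ ++ [0]) (false :: pos))
  | _, _, s, t, is, pos, .res P =>
      .res (.bound pos) (t.map .var) is (P.instrAux s t is (false :: pos))
  | _, _, s, t, is, pos, .dlet g args P Q =>
      .dlet g args
        (P.instrAux s (if 𝒞.NonDet g then t.map Fin.succ ++ [0] else t.map Fin.succ) is
          (false :: pos))
        (Q.instrAux s t is (true :: pos))
  | _, _, s, t, is, pos, .ite M N P Q =>
      .ite M N (P.instrAux s t is (false :: pos)) (Q.instrAux s t is (true :: pos))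
  | _, _, s, t, is, pos, .event M P => .event M (P.instrAux s t is (false :: pos))

/-- The instrumented process `instr(P₀)`. -/
noncomputable def Proc.instr {𝒞 : Calculus} (P₀ : CProc 𝒞) : IProc 𝒞 0 0 0 :=
  P₀.instrAux 0 [] [] []

/-! ## Generation of Horn clauses -/

/-- The environment `ρ`: patterns for the bound variables and bound names, session identifiers
for the bound session variables. Free names `a` are always mapped to `a[]`. -/
structure Env (𝒞 : Calculus) (n m s : ℕ) where
  var : Fin n → Pattern 𝒞.toConSig
  nam : Fin m → Pattern 𝒞.toConSig
  sess : Fin s → SessId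

def Env.subst {𝒞 : Calculus} {n m s : ℕ} (σ : Subst 𝒞.toConSig) (ρ : Env 𝒞 n m s) :
    Env 𝒞 n m s :=
  ⟨fun x => (ρ.var x).subst σ, fun a => (ρ.nam a).subst σ, fun i => (ρ.sess i).subst σ⟩

def Env.consVar {𝒞 : Calculus} {n m s : ℕ} (p : Pattern 𝒞.toConSig) (ρ : Env 𝒞 n m s) :
    Env 𝒞 (n + 1) m s :=
  ⟨Fin.cons p ρ.var, ρ.nam, ρ.sess⟩

def Env.consNam {𝒞 : Calculus} {n m s : ℕ} (p : Pattern 𝒞.toConSig) (ρ : Env 𝒞 n m s) :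
    Env 𝒞 n (m + 1) s :=
  ⟨ρ.var, Fin.cons p ρ.nam, ρ.sess⟩

def Env.consSess {𝒞 : Calculus} {n m s : ℕ} (i : SessId) (ρ : Env 𝒞 n m s) :
    Env 𝒞 n m (s + 1) :=
  ⟨ρ.var, ρ.nam, Fin.cons i ρ.sess⟩

/-- The pattern `ρ(M)`. -/
def Env.enc {𝒞 : Calculus} {n m s : ℕ} (ρ : Env 𝒞 n m s) (M : PTerm 𝒞 n m) :
    Pattern 𝒞.toConSig :=
  Term.toPattern ρ.var (Sum.elim freeName ρ.nam) M

/-- The pattern `a[ρ(M₁), …, ρ(Mₖ), ρ(i₁), …, ρ(iₖ')]` of a restriction label. -/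
def Env.encLabel {𝒞 : Calculus} {n m s : ℕ} (ρ : Env 𝒞 n m s) (a : NameSym)
    (t : List (PTerm 𝒞 n m)) (is : List (Fin s)) : Pattern 𝒞.toConSig :=
  .name a t.length (fun i => ρ.enc (t.get i)) (is.map ρ.sess)

/-- On the variables of `ρ` and `H`, the substitution `τ` is `δ` after `σ`. -/
def FactorsOn {𝒞 : Calculus} {n m s : ℕ} (ρ : Env 𝒞 n m s) (H : Multiset (HornFact 𝒞.toConSig))
    (τ σ δ : Subst 𝒞.toConSig) : Prop :=
  ρ.subst τ = (ρ.subst σ).subst δ ∧ ∀ F ∈ H, F.subst τ = (F.subst σ).subst δ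

/-- `(σ, σ')` satisfies `σρ(M₁) = σ'p₁, …, σρ(Mₙ) = σ'pₙ` for the left-hand side
`g(p₁, …, pₙ)` of the rule `r`. -/
def IsRuleUnifier {𝒞 : Calculus} {n m s d : ℕ} (ρ : Env 𝒞 n m s) (args : Fin d → PTerm 𝒞 n m)
    (r : RewRule 𝒞.toConSig d) (σ : Subst 𝒞.toConSig) (σ' : Fin r.k → Pattern 𝒞.toConSig) : Prop :=
  ∀ i, (ρ.enc (args i)).subst σ = (r.lhs i).toPattern σ' Empty.elim

/-- `(σ, σ')` is a most general such pair. -/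
def IsRuleMGU {𝒞 : Calculus} {n m s d : ℕ} (ρ : Env 𝒞 n m s) (H : Multiset (HornFact 𝒞.toConSig))
    (args : Fin d → PTerm 𝒞 n m) (r : RewRule 𝒞.toConSig d) (σ : Subst 𝒞.toConSig)
    (σ' : Fin r.k → Pattern 𝒞.toConSig) : Prop :=
  IsRuleUnifier ρ args r σ σ' ∧ ∀ τ τ', IsRuleUnifier ρ args r τ τ' →
    ∃ δ, FactorsOn ρ H τ σ δ ∧ ∀ v, τ' v = (σ' v).subst δ

/-- `σ` is a most general unifier of `p` and `p'`, with respect to the variables of `ρ` and `H`. -/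
def IsMGU {𝒞 : Calculus} {n m s : ℕ} (ρ : Env 𝒞 n m s) (H : Multiset (HornFact 𝒞.toConSig))
    (p p' : Pattern 𝒞.toConSig) (σ : Subst 𝒞.toConSig) : Prop :=
  p.subst σ = p'.subst σ ∧ ∀ τ : Subst 𝒞.toConSig, p.subst τ = p'.subst τ →
    ∃ δ, FactorsOn ρ H τ σ δ

/-- The ordinary variable `x` occurs neither in `ρ` nor in `H`. -/
def FreshVar {𝒞 : Calculus} {n m s : ℕ} (x : ℕ) (ρ : Env 𝒞 n m s)
    (H : Multiset (HornFact 𝒞.toConSig)) : Prop :=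
  (∀ y, x ∉ (ρ.var y).vars) ∧ (∀ a, x ∉ (ρ.nam a).vars) ∧ ∀ F ∈ H, x ∉ F.vars

/-- The session variable `i` occurs neither in `ρ` nor in `H`. -/
def FreshSess {𝒞 : Calculus} {n m s : ℕ} (i : ℕ) (ρ : Env 𝒞 n m s)
    (H : Multiset (HornFact 𝒞.toConSig)) : Prop :=
  (∀ y, i ∉ (ρ.var y).sessVars) ∧ (∀ a, i ∉ (ρ.nam a).sessVars) ∧ (∀ k, ρ.sess k ≠ .var i) ∧
    ∀ F ∈ H, i ∉ F.sessVars

/-- `P.Translates ρ H S`: the set of clauses `S` is `⟦P⟧ρH`, for some choice of the fresh variables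
that stand for bound variables, and of the most general unifiers (both are determined only up to
renaming). -/
def IProc.Translates {𝒞 : Calculus} : {n m s : ℕ} → IProc 𝒞 n m s → Env 𝒞 n m s →
    Multiset (HornFact 𝒞.toConSig) → Set (Clause 𝒞.toConSig) → Prop
  | _, _, _, .nil, _, _, S => S = ∅
  | _, _, _, .par P Q, ρ, H, S =>
      ∃ S₁ S₂, P.Translates ρ H S₁ ∧ Q.Translates ρ H S₂ ∧ S = S₁ ∪ S₂
  | _, _, _, .repl P, ρ, H, S =>
      ∃ i, FreshSess i ρ H ∧ P.Translates (ρ.consSess (.var i)) H S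
  | _, _, _, .res a t is P, ρ, H, S =>
      P.Translates (ρ.consNam (ρ.encLabel a t is)) H S
  | _, _, _, .inp M P, ρ, H, S =>
      ∃ x, FreshVar x ρ H ∧
        P.Translates (ρ.consVar (.var x)) (H + {.message (ρ.enc M) (.var x)}) S
  | _, _, _, .out M N P, ρ, H, S =>
      ∃ S₁, P.Translates ρ H S₁ ∧ S = S₁ ∪ {⟨H, .message (ρ.enc M) (ρ.enc N)⟩}
  | _, _, _, .dlet g args P Q, ρ, H, S =>
      ∃ (S₁ : RewRule 𝒞.toConSig (𝒞.darity g) → Set (Clause 𝒞.toConSig)) (S₂ : _),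
        (∀ r ∈ 𝒞.rules g,
          (∃ σ σ', IsRuleMGU ρ H args r σ σ' ∧
            P.Translates ((ρ.subst σ).consVar (r.rhs.toPattern σ' Empty.elim))
              (H.map (HornFact.subst σ)) (S₁ r)) ∨
          ((¬ ∃ σ σ', IsRuleUnifier ρ args r σ σ') ∧ S₁ r = ∅)) ∧
        Q.Translates ρ H S₂ ∧ S = (⋃ r ∈ 𝒞.rules g, S₁ r) ∪ S₂
  | _, _, _, .ite M N P Q, ρ, H, S =>
      ∃ S₁ S₂,
        ((∃ σ, IsMGU ρ H (ρ.enc M) (ρ.enc N) σ ∧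
            P.Translates (ρ.subst σ) (H.map (HornFact.subst σ)) S₁) ∨
          ((¬ ∃ σ, (ρ.enc M).subst σ = (ρ.enc N).subst σ) ∧ S₁ = ∅)) ∧
        Q.Translates ρ H S₂ ∧ S = S₁ ∪ S₂
  | _, _, _, .event M P, ρ, H, S =>
      ∃ S₁, P.Translates ρ (H + {.mevent (ρ.enc M)}) S₁ ∧
        S = S₁ ∪ {⟨H, .event (ρ.enc M)⟩}

/-- The clause `attacker(a[])`. -/
def clauseInit (S : ConSig) (a : Name) : Clause S := ⟨0, .attacker (freeName a)⟩

/-- The clause `attacker(b₀[x])`. -/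
def clauseRn (S : ConSig) : Clause S := ⟨0, .attacker (.name .b0 1 (fun _ => .var 0) [])⟩

/-- The clause `attacker(x₁) ∧ … ∧ attacker(xₙ) ⇒ attacker(f(x₁, …, xₙ))`. -/
def clauseRf (S : ConSig) (f : S.Con) (x : Fin (S.arity f) → ℕ) : Clause S :=
  ⟨∑ i, {.attacker (.var (x i))}, .attacker (.app f (fun i => .var (x i)))⟩

/-- The clause `attacker(M₁) ∧ … ∧ attacker(Mₙ) ⇒ attacker(M)` of a rewrite rule. -/
def clauseRg (S : ConSig) {d : ℕ} (r : RewRule S d) : Clause S :=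
  ⟨∑ i, {.attacker ((r.lhs i).toPattern (fun v : Fin r.k => .var v) Empty.elim)},
    .attacker (r.rhs.toPattern (fun v : Fin r.k => .var v) Empty.elim)⟩

/-- The clause `message(x, y) ∧ attacker(x) ⇒ attacker(y)`. -/
def clauseRl (S : ConSig) : Clause S :=
  ⟨{.message (.var 0) (.var 1), .attacker (.var 0)}, .attacker (.var 1)⟩

/-- The clause `attacker(x) ∧ attacker(y) ⇒ message(x, y)`. -/
def clauseRs (S : ConSig) : Clause S :=
  ⟨{.attacker (.var 0), .attacker (.var 1)}, .message (.var 0) (.var 1)⟩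

/-- The clauses for the attacker. -/
def attackerClauses (𝒞 : Calculus) (Init : Finset Name) : Set (Clause 𝒞.toConSig) :=
  {R | ∃ a ∈ Init, R = clauseInit _ a} ∪ {clauseRn _} ∪
  {R | ∃ f, 𝒞.pubCon f ∧ R = clauseRf _ f (fun i => i)} ∪
  {R | ∃ g, 𝒞.pubDes g ∧ ∃ r ∈ 𝒞.rules g, R = clauseRg _ r} ∪
  {clauseRl _, clauseRs _}

/-- The clauses `R₀` form the set `ℛ_{P', Init}` (up to the choices made in the translation). -/
def IsClauseSet {𝒞 : Calculus} (P' : IProc 𝒞 0 0 0) (Init : Finset Name)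
    (R₀ : Set (Clause 𝒞.toConSig)) : Prop :=
  ∃ S, P'.Translates ⟨Fin.elim0, Fin.elim0, Fin.elim0⟩ 0 S ∧ R₀ = S ∪ attackerClauses 𝒞 Init

/-! ## Resolution, subsumption and selection -/

/-- `R ∘_{F₀} R'` is defined: `F₀` is a hypothesis of `R'` that unifies with the conclusion of `R`.
The variables of the two clauses are renamed apart, that is, each clause has its own
substitution. -/
def ResolutionDefined {S : ConSig} (R : Clause S) (F₀ : HornFact S) (R' : Clause S) : Prop :=
  F₀ ∈ R'.hyps ∧ ∃ σ σ' : Subst S, R.concl.subst σ = F₀.subst σ'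

open Classical in
/-- `R''` is `R ∘_{F₀} R'`, for some choice of the most general unifier. -/
def IsResolvent {S : ConSig} (R : Clause S) (F₀ : HornFact S) (R' R'' : Clause S) : Prop :=
  F₀ ∈ R'.hyps ∧ ∃ σ σ' : Subst S, R.concl.subst σ = F₀.subst σ' ∧
    (∀ τ τ' : Subst S, R.concl.subst τ = F₀.subst τ' → ∃ δ : Subst S,
      (∀ F ∈ R.facts, F.subst τ = (F.subst σ).subst δ) ∧
      (∀ F ∈ R'.facts, F.subst τ' = (F.subst σ').subst δ)) ∧
    R'' = ⟨R.hyps.map (HornFact.subst σ) + (R'.hyps.erase F₀).map (HornFact.subst σ'),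
      R'.concl.subst σ'⟩

/-- `R₁` subsumes `R₂`. -/
def Subsumes {S : ConSig} (R₁ R₂ : Clause S) : Prop :=
  ∃ σ : Subst S, R₁.concl.subst σ = R₂.concl ∧ R₁.hyps.map (HornFact.subst σ) ≤ R₂.hyps

def HornFact.Unselectable {S : ConSig} (F : HornFact S) : Prop :=
  (∃ x, F = .attacker (.var x)) ∨ ∃ p, F = .mevent p

/-- Selection functions. -/
structure Selection (S : ConSig) where
  sel : Clause S → Set (HornFact S)
  subset_hyps : ∀ R, ∀ F ∈ sel R, F ∈ R.hyps
  selectable : ∀ R, ∀ F ∈ sel R, ¬ F.Unselectable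
  nonempty_of_attacker_var : ∀ (R : Clause S) (x : ℕ), R.concl = .attacker (.var x) →
    (∃ F ∈ R.hyps, ¬ F.Unselectable) → (sel R).Nonempty

/-! ## Simplification of clauses -/

/-- The clause is, up to renaming of variables, a clause `attacker(x₁) ∧ … ∧ attacker(xₙ) ⇒
attacker(f(x₁, …, xₙ))` or `attacker(f(x₁, …, xₙ)) ⇒ attacker(xᵢ)` for a data constructor `f`. -/
def IsDataClause (𝒞 : Calculus) (R : Clause 𝒞.toConSig) : Prop :=
  ∃ f ∈ 𝒞.data, ∃ x : Fin (𝒞.arity f) → ℕ, Function.Injective x ∧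
    (R = clauseRf _ f x ∨
      ∃ i, R = ⟨{.attacker (.app f (fun j => .var (x j)))}, .attacker (.var (x i))⟩)

open Classical in
/-- Recursive decomposition of the data constructors at the root of a pattern. -/
noncomputable def Pattern.decomp (𝒞 : Calculus) :
    Pattern 𝒞.toConSig → Multiset (Pattern 𝒞.toConSig)
  | .var x => {.var x}
  | .name a k args sess => {.name a k args sess}
  | .app f args => if f ∈ 𝒞.data then ∑ i, (args i).decomp 𝒞 else {.app f args}

noncomputable def HornFact.decomp (𝒞 : Calculus) : HornFact 𝒞.toConSig → Multiset (HornFact 𝒞.toConSig)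
  | .attacker p => (p.decomp 𝒞).map .attacker
  | .message p p' => {.message p p'}
  | .mevent p => {.mevent p}
  | .event p => {.event p}

open Classical in
noncomputable def decomphyp (𝒞 : Calculus) (R : Clause 𝒞.toConSig) : Clause 𝒞.toConSig :=
  if IsDataClause 𝒞 R then R else ⟨R.hyps.bind (HornFact.decomp 𝒞), R.concl⟩

open Classical in
noncomputable def decomp (𝒞 : Calculus) (R : Clause 𝒞.toConSig) : Set (Clause 𝒞.toConSig) :=
  if IsDataClause 𝒞 R then {R}
  else {R' | ∃ C ∈ R.concl.decomp 𝒞, R' = ⟨R.hyps.bind (HornFact.decomp 𝒞), C⟩}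

open Classical in
noncomputable def elimdup {S : ConSig} (R : Clause S) : Clause S := ⟨R.hyps.dedup, R.concl⟩

/-- One elimination of redundant hypotheses: `H ∧ H' ⇒ C` becomes `H' ⇒ C` when
some `σ` maps the elements of `H` into `H'` and does not change the variables of `H'` and `C`. -/
def RedundantStep {S : ConSig} (R R' : Clause S) : Prop :=
  ∃ (H : Multiset (HornFact S)) (σ : Subst S), R.hyps = H + R'.hyps ∧ R.concl = R'.concl ∧
    (∀ F ∈ H, F.subst σ ∈ R'.hyps) ∧ (∀ F ∈ R'.facts, F.subst σ = F)

/-- `R'` is a result of `elimredundanthyp(R)`. Depending on user settings, any number of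
eliminations of redundant hypotheses is done, possibly none. -/
def ElimRedundantHyp {S : ConSig} : Clause S → Clause S → Prop :=
  Relation.ReflTransGen RedundantStep

/-- Some hypothesis is an instance of a fact in `Fnot` (such clauses are removed by `elimnot`). -/
def HasNotHyp {S : ConSig} (Fnot : Set (HornFact S)) (R : Clause S) : Prop :=
  ∃ F ∈ R.hyps, ∃ F' ∈ Fnot, ∃ σ : Subst S, F = F'.subst σ

/-- Tautologies (such clauses are removed by `elimtaut`). -/
def IsTaut {S : ConSig} (R : Clause S) : Prop := R.concl ∈ R.hyps

open Classical in
/-- The fact is `attacker(x)` where the variable `x` does not occur elsewhere in the clause. -/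
def UselessAttacker {S : ConSig} (R : Clause S) (F : HornFact S) : Prop :=
  ∃ x, F = .attacker (.var x) ∧ x ∉ R.concl.vars ∧ ∀ F' ∈ R.hyps.erase F, x ∉ F'.vars

open Classical in
noncomputable def elimattx {S : ConSig} (R : Clause S) : Clause S :=
  ⟨R.hyps.filter (fun F => ¬ UselessAttacker R F), R.concl⟩

/-- `T` is a result of `simplify(R)`, where `simplify` is
`elimattx ∘ elimtaut ∘ elimnot ∘ elimredundanthyp ∘ elimdup ∘ decomp`. -/
def IsSimplify (𝒞 : Calculus) (Fnot : Set (HornFact 𝒞.toConSig)) (R : Clause 𝒞.toConSig)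
    (T : Set (Clause 𝒞.toConSig)) : Prop :=
  ∃ red : Clause 𝒞.toConSig → Clause 𝒞.toConSig, (∀ R₁, ElimRedundantHyp R₁ (red R₁)) ∧
    T = {R' | ∃ R₁ ∈ decomp 𝒞 R, ¬ HasNotHyp Fnot (red (elimdup R₁)) ∧
      ¬ IsTaut (red (elimdup R₁)) ∧ R' = elimattx (red (elimdup R₁))}

/-- `T` is a result of `simplify'(R)`, where `simplify'` is
`elimattx ∘ elimnot ∘ elimredundanthyp ∘ elimdup ∘ decomphyp`. -/
def IsSimplify' (𝒞 : Calculus) (Fnot : Set (HornFact 𝒞.toConSig)) (R : Clause 𝒞.toConSig)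
    (T : Set (Clause 𝒞.toConSig)) : Prop :=
  ∃ red : Clause 𝒞.toConSig → Clause 𝒞.toConSig, (∀ R₁, ElimRedundantHyp R₁ (red R₁)) ∧
    T = {R' | ¬ HasNotHyp Fnot (red (elimdup (decomphyp 𝒞 R))) ∧
      R' = elimattx (red (elimdup (decomphyp 𝒞 R)))}

/-- `B` is a result of `elim(A)`: the clauses of `A` subsumed by others are removed (one clause
remains among clauses that subsume each other). -/
def IsElim {S : ConSig} (A B : Set (Clause S)) : Prop :=
  B ⊆ A ∧ (∀ R ∈ A, ∃ R' ∈ B, Subsumes R' R) ∧ ∀ R ∈ B, ∀ R' ∈ B, Subsumes R' R → R' = R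

/-! ## The solving algorithm -/

/-- One execution of `ℛ ← elim(simplify(R) ∪ ℛ)`. -/
def AddClause (𝒞 : Calculus) (Fnot : Set (HornFact 𝒞.toConSig)) (R : Clause 𝒞.toConSig)
    (A B : Set (Clause 𝒞.toConSig)) : Prop :=
  ∃ T, IsSimplify 𝒞 Fnot R T ∧ IsElim (T ∪ A) B

/-- Step 1 of `saturate`, for the list of initial clauses. -/
inductive AddClauses (𝒞 : Calculus) (Fnot : Set (HornFact 𝒞.toConSig)) :
    List (Clause 𝒞.toConSig) → Set (Clause 𝒞.toConSig) → Set (Clause 𝒞.toConSig) → Prop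
  | nil (A : Set (Clause 𝒞.toConSig)) : AddClauses 𝒞 Fnot [] A A
  | cons (R : Clause 𝒞.toConSig) (L : List (Clause 𝒞.toConSig)) (A B C : Set (Clause 𝒞.toConSig))
      (h : AddClause 𝒞 Fnot R A B) (hL : AddClauses 𝒞 Fnot L B C) : AddClauses 𝒞 Fnot (R :: L) A C

/-- The instruction of step 2 of `saturate` is executed for the clauses `R`, `R'` and the selected
fact `F₀`. -/
def ResolveStep (𝒞 : Calculus) (Fnot : Set (HornFact 𝒞.toConSig)) (R : Clause 𝒞.toConSig)
    (F₀ : HornFact 𝒞.toConSig) (R' : Clause 𝒞.toConSig) (A B : Set (Clause 𝒞.toConSig)) : Prop :=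
  ∃ R'', IsResolvent R F₀ R' R'' ∧ AddClause 𝒞 Fnot R'' A B

/-- The conditions of the loops in step 2 of `saturate`. -/
def CanResolve {𝒞 : Calculus} (sel : Selection 𝒞.toConSig) (A : Set (Clause 𝒞.toConSig))
    (R : Clause 𝒞.toConSig) (F₀ : HornFact 𝒞.toConSig) (R' : Clause 𝒞.toConSig) : Prop :=
  R ∈ A ∧ sel.sel R = ∅ ∧ R' ∈ A ∧ F₀ ∈ sel.sel R' ∧ ResolutionDefined R F₀ R'

/-- `R₁` is a result of `saturate(R₀)`: step 1 adds the clauses of `R₀`, enumerated by a list; step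
2 resolves clauses until a fixpoint is reached; step 3 keeps the clauses with empty selection. -/
def Saturate (𝒞 : Calculus) (sel : Selection 𝒞.toConSig) (Fnot : Set (HornFact 𝒞.toConSig))
    (R₀ R₁ : Set (Clause 𝒞.toConSig)) : Prop :=
  ∃ (L : List (Clause 𝒞.toConSig)) (A B : Set (Clause 𝒞.toConSig)),
    {R | R ∈ L} = R₀ ∧ AddClauses 𝒞 Fnot L ∅ A ∧
    Relation.ReflTransGen
      (fun A B => ∃ R F₀ R', CanResolve sel A R F₀ R' ∧ ResolveStep 𝒞 Fnot R F₀ R' A B) A B ∧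
    (∀ R F₀ R', CanResolve sel B R F₀ R' → ResolveStep 𝒞 Fnot R F₀ R' B B) ∧
    R₁ = {R ∈ B | sel.sel R = ∅}

/-- `Deriv 𝒞 sel Fnot R₁ R A out`: the (terminating) evaluation of `deriv(R, A, R₁)` returns `out`.
In the third case, `next R' F₀` is `simplify'(R' ∘_{F₀} R)`. -/
inductive Deriv (𝒞 : Calculus) (sel : Selection 𝒞.toConSig) (Fnot : Set (HornFact 𝒞.toConSig))
    (R₁ : Set (Clause 𝒞.toConSig)) :
    Clause 𝒞.toConSig → Set (Clause 𝒞.toConSig) → Set (Clause 𝒞.toConSig) → Prop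
  | cycle (R : Clause 𝒞.toConSig) (A : Set (Clause 𝒞.toConSig))
      (h : ∃ R' ∈ A, Subsumes R' R) : Deriv 𝒞 sel Fnot R₁ R A ∅
  | found (R : Clause 𝒞.toConSig) (A : Set (Clause 𝒞.toConSig))
      (h : ¬ ∃ R' ∈ A, Subsumes R' R) (hsel : sel.sel R = ∅) : Deriv 𝒞 sel Fnot R₁ R A {R}
  | search (R : Clause 𝒞.toConSig) (A : Set (Clause 𝒞.toConSig))
      (h : ¬ ∃ R' ∈ A, Subsumes R' R) (hsel : sel.sel R ≠ ∅)
      (next : Clause 𝒞.toConSig → HornFact 𝒞.toConSig → Set (Clause 𝒞.toConSig))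
      (out : Clause 𝒞.toConSig → HornFact 𝒞.toConSig → Clause 𝒞.toConSig → Set (Clause 𝒞.toConSig))
      (hnext : ∀ R' ∈ R₁, ∀ F₀ ∈ sel.sel R, ResolutionDefined R' F₀ R →
        ∃ R'', IsResolvent R' F₀ R R'' ∧ IsSimplify' 𝒞 Fnot R'' (next R' F₀))
      (hout : ∀ R' ∈ R₁, ∀ F₀ ∈ sel.sel R, ResolutionDefined R' F₀ R →
        ∀ D ∈ next R' F₀, Deriv 𝒞 sel Fnot R₁ D ({R} ∪ A) (out R' F₀ D)) :
      Deriv 𝒞 sel Fnot R₁ R A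
        {C | ∃ R' ∈ R₁, ∃ F₀ ∈ sel.sel R, ResolutionDefined R' F₀ R ∧
          ∃ D ∈ next R' F₀, C ∈ out R' F₀ D}

/-- `derivable(F, R₁)` returns `out`. -/
def Derivable (𝒞 : Calculus) (sel : Selection 𝒞.toConSig) (Fnot : Set (HornFact 𝒞.toConSig))
    (F : HornFact 𝒞.toConSig) (R₁ out : Set (Clause 𝒞.toConSig)) : Prop :=
  Deriv 𝒞 sel Fnot R₁ ⟨{F}, F⟩ ∅ out

/-- The algorithm `solve_{P', Init}(F)`, run with the selection function `sel` and the secrecy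
assumptions `Fnot`, terminates without error and returns the set of clauses `out`. -/
def Solve {𝒞 : Calculus} (sel : Selection 𝒞.toConSig) (Fnot : Set (HornFact 𝒞.toConSig))
    (P' : IProc 𝒞 0 0 0) (Init : Finset Name) (F : HornFact 𝒞.toConSig)
    (out : Set (Clause 𝒞.toConSig)) : Prop :=
  ∃ R₀ R₁, IsClauseSet P' Init R₀ ∧ Saturate 𝒞 sel Fnot R₀ R₁ ∧
    (∀ F' ∈ Fnot, Derivable 𝒞 sel Fnot F' R₁ ∅) ∧
    Derivable 𝒞 sel Fnot F R₁ out

end ProVerif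

open ProVerif

/-! The proof has two independent halves, joined by an injectivity argument.

Semantic half. Along a trace, each name receives a pattern `lam`: a free name `a` gets `a[]`, a name
created by a restriction of the protocol gets the label of that restriction applied to the current
values and session identifiers, and a name `b` created by the adversary gets `b₀[b[]]`. Every
communication and every event of the trace is then derivable (`Der`) from the initial clauses and
the must-event facts of those events that the trace executes (`TraceInv`). This is an induction on
reductions with the invariant `Inv`: each running process is either an instance of a subprocess of
the protocol, whose accumulated hypotheses are derivable (`Desc`), or an adversary process that
holds only derivable terms (`Adv`). Admitting must-event facts for executed events only is what
makes correspondences provable: a must-event used by a derivation certifies an execution.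

Algorithmic half. The solver loses nothing: each derivable instance of the query is an instance of
the conclusion of some returned clause, with the instances of its must-event hypotheses among the
executed events (`Saturate.exists_mem`). The tool is derivability with sizes (`DerSz`); a clause
instance is weighed by the total least size of derivations of its hypotheses (`wt`). Resolution on a
selected hypothesis replaces its size by the strictly smaller weight of the premises that derive it.
This decrease gives completeness of saturation (`Saturated.dv_concl`), shows that the loop check of
the backward search never cuts all ways to a derivable fact (`Deriv.exists_mem`), and discharges the
secrecy assumptions: a derivable one of least size would have been found (`not_dv_of_derivable`).

Data constructors need care, since simplification decomposes them. In `DerSz` a fact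
`attacker(f(…))`, with `f` a data constructor, can only come from its components, so decomposition
of hypotheses is an inversion. The price is to show that a clause whose conclusion is instantiated
to such a fact also yields the components (`Saturated.exists_projection`).

Joining. A returned clause gives equalities of patterns, whereas the correspondence is about terms.
No two names are created at the same address (program point and session identifiers), so `lam` is
injective on the names of the configuration (`Inv.injOn`), and equalities of patterns lift to
equalities of terms (`Inv.inst_eq`). -/

namespace ProVerif

/-! ## Composition of substitutions -/

/-- `σ.comp δ` applies `σ` first. -/
def Subst.comp {S : ConSig} (σ δ : Subst S) : Subst S :=
  ⟨fun x => (σ.ord x).subst δ, fun i => (σ.sess i).subst δ⟩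

theorem SessId.subst_subst {S : ConSig} (σ δ : Subst S) (i : SessId) :
    (i.subst σ).subst δ = i.subst (σ.comp δ) := by
  cases i <;> rfl

theorem Pattern.subst_subst {S : ConSig} (σ δ : Subst S) (p : Pattern S) :
    (p.subst σ).subst δ = p.subst (σ.comp δ) := by
  induction p with
  | var x => rfl
  | name a k args sess ih =>
    simp only [Pattern.subst, ih, List.map_map]
    congr 1
    exact List.map_congr_left fun i _ => SessId.subst_subst σ δ i
  | app f args ih => simp only [Pattern.subst, ih]

theorem HornFact.subst_subst {S : ConSig} (σ δ : Subst S) (F : HornFact S) :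
    (F.subst σ).subst δ = F.subst (σ.comp δ) := by
  cases F <;> simp only [HornFact.subst, Pattern.subst_subst]

def Subst.id (S : ConSig) : Subst S := ⟨.var, .var⟩

theorem SessId.subst_id {S : ConSig} (i : SessId) : i.subst (Subst.id S) = i := by
  cases i <;> rfl

theorem Pattern.subst_id {S : ConSig} (p : Pattern S) : p.subst (Subst.id S) = p := by
  induction p with
  | var x => rfl
  | name a k args sess ih =>
    simp only [Pattern.subst, ih]
    congr 1
    exact (List.map_congr_left fun i _ => SessId.subst_id i).trans (List.map_id sess)
  | app f args ih => simp only [Pattern.subst, ih]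

theorem HornFact.subst_id {S : ConSig} (F : HornFact S) : F.subst (Subst.id S) = F := by
  cases F <;> simp only [HornFact.subst, Pattern.subst_id]

theorem Subsumes.refl {S : ConSig} (R : Clause S) : Subsumes R R :=
  ⟨Subst.id S, HornFact.subst_id _, by
    rw [Multiset.map_congr rfl fun F _ => HornFact.subst_id F, Multiset.map_id']⟩

theorem Subsumes.trans {S : ConSig} {R₁ R₂ R₃ : Clause S} (h : Subsumes R₁ R₂)
    (h' : Subsumes R₂ R₃) : Subsumes R₁ R₃ := by
  obtain ⟨σ, hc, hh⟩ := h
  obtain ⟨τ, hc', hh'⟩ := h'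
  refine ⟨σ.comp τ, by rw [← HornFact.subst_subst, hc, hc'], le_trans ?_ hh'⟩
  have := Multiset.map_le_map (f := HornFact.subst τ) hh
  rw [Multiset.map_map] at this
  simpa only [Function.comp_def, HornFact.subst_subst] using this

/-! ## Atomic facts and sizes -/

/-- The fact is not `attacker(f(…))` for a data constructor `f`. -/
def HornFact.Atomic (𝒞 : Calculus) (F : HornFact 𝒞.toConSig) : Prop :=
  ∀ f ∈ 𝒞.data, ∀ args, F ≠ .attacker (.app f args)

/-- The second component of the induction measure in `Saturated.dv_concl`. Names have size 1 because
decomposition never looks inside them. -/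
def Pattern.size {S : ConSig} : Pattern S → ℕ
  | .var _ => 1
  | .name _ _ _ _ => 1
  | .app _ args => 1 + ∑ i, (args i).size

def HornFact.size {S : ConSig} : HornFact S → ℕ
  | .attacker p => p.size
  | _ => 0

theorem Pattern.size_arg_lt {S : ConSig} {f : S.Con} (args : Fin (S.arity f) → Pattern S)
    (i : Fin (S.arity f)) : (args i).size < (Pattern.app f args).size := by
  have := Finset.single_le_sum (f := fun i => (args i).size) (fun _ _ => Nat.zero_le _)
    (Finset.mem_univ i)
  simp only [Pattern.size]
  omega

theorem Pattern.decomp_size {𝒞 : Calculus} (σ : Subst 𝒞.toConSig) (p : Pattern 𝒞.toConSig) :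
    ∀ q ∈ p.decomp 𝒞, (q.subst σ).size ≤ (p.subst σ).size := by
  induction p with
  | var x => simp [Pattern.decomp]
  | name a k args sess ih => simp [Pattern.decomp]
  | app f args ih =>
    intro q hq
    rw [Pattern.decomp] at hq
    split at hq
    · obtain ⟨i, -, hi⟩ := Multiset.mem_sum.1 hq
      exact (ih i q hi).trans (Pattern.size_arg_lt (fun i => (args i).subst σ) i).le
    · rw [Multiset.mem_singleton.1 hq]

theorem HornFact.decomp_size {𝒞 : Calculus} (σ : Subst 𝒞.toConSig) (F G : HornFact 𝒞.toConSig)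
    (hG : G ∈ F.decomp 𝒞) : (G.subst σ).size ≤ (F.subst σ).size := by
  cases F with
  | attacker p =>
    obtain ⟨q, hq, rfl⟩ := Multiset.mem_map.1 hG
    exact p.decomp_size σ q hq
  | _ => rw [Multiset.mem_singleton.1 hG]

/-! ## Sized derivability -/

/-- Derivability, with the size of derivations, from must-events in `Me`, composition of data
constructors, and those instances of clauses of `R₁` that have an atomic conclusion. -/
inductive DerSz (𝒞 : Calculus) (R₁ : Set (Clause 𝒞.toConSig)) (Me : Set (Pattern 𝒞.toConSig)) :
    HornFact 𝒞.toConSig → ℕ → Prop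
  | me (p) (hp : p ∈ Me) : DerSz 𝒞 R₁ Me (.mevent p) 0
  | data (f) (hf : f ∈ 𝒞.data) (args : Fin (𝒞.arity f) → Pattern 𝒞.toConSig)
      (w : Fin (𝒞.arity f) → ℕ) (h : ∀ i, DerSz 𝒞 R₁ Me (.attacker (args i)) (w i)) :
      DerSz 𝒞 R₁ Me (.attacker (.app f args)) (1 + ∑ i, w i)
  | clause (R) (hR : R ∈ R₁) (σ : Subst 𝒞.toConSig) (w : HornFact 𝒞.toConSig → ℕ)
      (hat : (R.concl.subst σ).Atomic 𝒞)
      (h : ∀ F ∈ R.hyps, DerSz 𝒞 R₁ Me (F.subst σ) (w F)) :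
      DerSz 𝒞 R₁ Me (R.concl.subst σ) (1 + (R.hyps.map w).sum)

variable {𝒞 : Calculus} {R₁ : Set (Clause 𝒞.toConSig)} {Me : Set (Pattern 𝒞.toConSig)}

def Dv (R₁ : Set (Clause 𝒞.toConSig)) (Me : Set (Pattern 𝒞.toConSig))
    (F : HornFact 𝒞.toConSig) : Prop := ∃ k, DerSz 𝒞 R₁ Me F k

/-- The least size of a derivation. -/
noncomputable def sz (R₁ : Set (Clause 𝒞.toConSig)) (Me : Set (Pattern 𝒞.toConSig))
    (F : HornFact 𝒞.toConSig) : ℕ := sInf {k | DerSz 𝒞 R₁ Me F k}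

/-- The sum of the sizes of the derivations of the instances of facts. -/
noncomputable def wt (R₁ : Set (Clause 𝒞.toConSig)) (Me : Set (Pattern 𝒞.toConSig))
    (σ : Subst 𝒞.toConSig) (H : Multiset (HornFact 𝒞.toConSig)) : ℕ :=
  (H.map fun F => sz R₁ Me (F.subst σ)).sum

theorem Dv.derSz {F : HornFact 𝒞.toConSig} (h : Dv R₁ Me F) : DerSz 𝒞 R₁ Me F (sz R₁ Me F) :=
  Nat.sInf_mem h

theorem sz_le {F : HornFact 𝒞.toConSig} {k : ℕ} (h : DerSz 𝒞 R₁ Me F k) : sz R₁ Me F ≤ k :=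
  Nat.sInf_le h

theorem wt_mono {σ : Subst 𝒞.toConSig} {H H' : Multiset (HornFact 𝒞.toConSig)} (h : H ≤ H') :
    wt R₁ Me σ H ≤ wt R₁ Me σ H' := by
  obtain ⟨K, rfl⟩ := Multiset.le_iff_exists_add.1 h
  simp [wt]

theorem wt_add {σ : Subst 𝒞.toConSig} {H H' : Multiset (HornFact 𝒞.toConSig)} :
    wt R₁ Me σ (H + H') = wt R₁ Me σ H + wt R₁ Me σ H' := by
  simp [wt]

theorem wt_map {σ τ : Subst 𝒞.toConSig} {H : Multiset (HornFact 𝒞.toConSig)} :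
    wt R₁ Me τ (H.map (HornFact.subst σ)) = wt R₁ Me (σ.comp τ) H := by
  simp only [wt, Multiset.map_map, Function.comp_def, HornFact.subst_subst]

theorem wt_congr {σ τ : Subst 𝒞.toConSig} {H : Multiset (HornFact 𝒞.toConSig)}
    (h : ∀ F ∈ H, F.subst σ = F.subst τ) : wt R₁ Me σ H = wt R₁ Me τ H := by
  rw [wt, wt, Multiset.map_congr rfl fun F hF => by rw [h F hF]]

theorem Dv.data {f : 𝒞.Con} (hf : f ∈ 𝒞.data) {args : Fin (𝒞.arity f) → Pattern 𝒞.toConSig}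
    (h : ∀ i, Dv R₁ Me (.attacker (args i))) : Dv R₁ Me (.attacker (.app f args)) :=
  ⟨_, .data f hf args _ fun i => (h i).derSz⟩

theorem Dv.clause {R : Clause 𝒞.toConSig} (hR : R ∈ R₁) (σ : Subst 𝒞.toConSig)
    (hat : (R.concl.subst σ).Atomic 𝒞) (h : ∀ F ∈ R.hyps, Dv R₁ Me (F.subst σ)) :
    Dv R₁ Me (R.concl.subst σ) :=
  ⟨_, .clause R hR σ (fun F => sz R₁ Me (F.subst σ)) hat fun F hF => (h F hF).derSz⟩

/-- Clause instances in `DerSz` have atomic conclusions, so composition is the only possible last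
rule. It adds 1 to the size, hence the strict inequality. -/
theorem Dv.data_inv {f : 𝒞.Con} (hf : f ∈ 𝒞.data) {args : Fin (𝒞.arity f) → Pattern 𝒞.toConSig}
    (h : Dv R₁ Me (.attacker (.app f args))) :
    (∀ i, Dv R₁ Me (.attacker (args i))) ∧
      ∑ i, sz R₁ Me (.attacker (args i)) < sz R₁ Me (.attacker (.app f args)) := by
  have h' := h.derSz
  generalize hk : sz R₁ Me (.attacker (.app f args)) = k at h' ⊢
  generalize hF : HornFact.attacker (Pattern.app f args) = F at h'
  cases h' with
  | me p hp => cases hF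
  | data f' hf' args' w h' =>
    cases hF
    refine ⟨fun i => ⟨_, h' i⟩, ?_⟩
    have := Finset.sum_le_sum fun i (_ : i ∈ Finset.univ) => sz_le (h' i)
    omega
  | clause R hR σ w hat h' => exact absurd hF.symm (hat f hf args)

theorem Dv.atomic_inv {F : HornFact 𝒞.toConSig} (hF : F.Atomic 𝒞) (h : Dv R₁ Me F) :
    (∃ p ∈ Me, F = .mevent p) ∨ ∃ R ∈ R₁, ∃ σ : Subst 𝒞.toConSig, R.concl.subst σ = F ∧
      (∀ G ∈ R.hyps, Dv R₁ Me (G.subst σ)) ∧ wt R₁ Me σ R.hyps < sz R₁ Me F := by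
  have h' := h.derSz
  generalize hk : sz R₁ Me F = k at h' ⊢
  cases h' with
  | me p hp => exact .inl ⟨p, hp, rfl⟩
  | data f' hf' args' w h' => exact absurd rfl (hF f' hf' args')
  | clause R hR σ w hat h' =>
    refine .inr ⟨R, hR, σ, rfl, fun G hG => ⟨_, h' G hG⟩, ?_⟩
    have : wt R₁ Me σ R.hyps ≤ (R.hyps.map w).sum :=
      Multiset.sum_map_le_sum_map _ _ fun G hG => sz_le (h' G hG)
    omega

/-- Iterates `Dv.data_inv`. The bound ensures that decomposing hypotheses never increases the weight
of a clause. -/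
theorem Dv.decomp_hyp {p : Pattern 𝒞.toConSig} {σ : Subst 𝒞.toConSig}
    (h : Dv R₁ Me (.attacker (p.subst σ))) :
    (∀ q ∈ p.decomp 𝒞, Dv R₁ Me (.attacker (q.subst σ))) ∧
      ((p.decomp 𝒞).map fun q => sz R₁ Me (.attacker (q.subst σ))).sum ≤
        sz R₁ Me (.attacker (p.subst σ)) := by
  induction p with
  | var x => simpa [Pattern.decomp] using h
  | name a k args sess ih => simpa [Pattern.decomp] using h
  | app f args ih =>
    rw [Pattern.decomp]
    split
    · rename_i hf
      obtain ⟨h1, h2⟩ := Dv.data_inv hf h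
      constructor
      · intro q hq
        obtain ⟨i, -, hi⟩ := Multiset.mem_sum.1 hq
        exact (ih i (h1 i)).1 q hi
      · refine le_trans ?_ h2.le
        -- Mapping and summing multisets are additive, so both pass through the sum over the
        -- arguments of `f`.
        rw [← Multiset.coe_mapAddMonoidHom, map_sum, ← Multiset.coe_sumAddMonoidHom, map_sum]
        exact Finset.sum_le_sum fun i _ => (ih i (h1 i)).2
    · simpa using h

theorem Dv.decomp_concl {p : Pattern 𝒞.toConSig} {σ : Subst 𝒞.toConSig}
    (h : ∀ q ∈ p.decomp 𝒞, Dv R₁ Me (.attacker (q.subst σ))) :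
    Dv R₁ Me (.attacker (p.subst σ)) := by
  induction p with
  | var x => exact h _ (by simp [Pattern.decomp])
  | name a k args sess ih => exact h _ (by simp [Pattern.decomp])
  | app f args ih =>
    rw [Pattern.decomp] at h
    split at h
    · rename_i hf
      exact Dv.data hf fun i => ih i fun q hq => h q (Multiset.mem_sum.2 ⟨i, Finset.mem_univ i, hq⟩)
    · exact h _ (Multiset.mem_singleton_self _)

theorem Dv.fact_decomp_hyp {F : HornFact 𝒞.toConSig} {σ : Subst 𝒞.toConSig}
    (h : Dv R₁ Me (F.subst σ)) :
    (∀ G ∈ F.decomp 𝒞, Dv R₁ Me (G.subst σ)) ∧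
      wt R₁ Me σ (F.decomp 𝒞) ≤ sz R₁ Me (F.subst σ) := by
  cases F with
  | attacker p =>
    obtain ⟨h1, h2⟩ := Dv.decomp_hyp h
    refine ⟨fun G hG => ?_, ?_⟩
    · obtain ⟨q, hq, rfl⟩ := Multiset.mem_map.1 hG
      exact h1 q hq
    · rw [HornFact.decomp, wt, Multiset.map_map]
      exact h2
  | _ =>
    refine ⟨fun G hG => ?_, ?_⟩
    · rwa [Multiset.mem_singleton.1 hG]
    · simp [HornFact.decomp, wt]

theorem Dv.fact_decomp_concl {F : HornFact 𝒞.toConSig} {σ : Subst 𝒞.toConSig}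
    (h : ∀ G ∈ F.decomp 𝒞, Dv R₁ Me (G.subst σ)) : Dv R₁ Me (F.subst σ) := by
  cases F with
  | attacker p => exact Dv.decomp_concl fun q hq => h _ (Multiset.mem_map_of_mem _ hq)
  | _ => exact h _ (Multiset.mem_singleton_self _)

theorem Dv.hyps_decomp {H : Multiset (HornFact 𝒞.toConSig)} {σ : Subst 𝒞.toConSig}
    (h : ∀ F ∈ H, Dv R₁ Me (F.subst σ)) :
    (∀ G ∈ H.bind (HornFact.decomp 𝒞), Dv R₁ Me (G.subst σ)) ∧
      wt R₁ Me σ (H.bind (HornFact.decomp 𝒞)) ≤ wt R₁ Me σ H := by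
  constructor
  · intro G hG
    obtain ⟨F, hF, hG⟩ := Multiset.mem_bind.1 hG
    exact (h F hF).fact_decomp_hyp.1 G hG
  · rw [wt, Multiset.map_bind, Multiset.sum_bind]
    exact Multiset.sum_map_le_sum_map _ _ fun F hF => (h F hF).fact_decomp_hyp.2

end ProVerif

/-! ### Simplification, resolution and backward search measured by derivation sizes -/

namespace ProVerif

variable {𝒞 : Calculus} {R₁ : Set (Clause 𝒞.toConSig)} {Me : Set (Pattern 𝒞.toConSig)}
  {sel : Selection 𝒞.toConSig} {Fnot : Set (HornFact 𝒞.toConSig)}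

/-! ## Simplification -/

/-- For completeness only the loss of hypotheses matters: a clause with fewer hypotheses applies
whenever the original does. The condition that justifies the removal plays no role. -/
theorem ElimRedundantHyp.le {S : ConSig} {R R' : Clause S} (h : ElimRedundantHyp R R') :
    R'.hyps ≤ R.hyps ∧ R'.concl = R.concl := by
  induction h with
  | refl => exact ⟨le_rfl, rfl⟩
  | tail _ hs ih =>
    obtain ⟨H, σ, h1, h2, -⟩ := hs
    exact ⟨le_trans (h1 ▸ Multiset.le_add_left _ _) ih.1, h2.symm.trans ih.2⟩

theorem elimdup_le {S : ConSig} (R : Clause S) : (elimdup R).hyps ≤ R.hyps :=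
  by classical exact Multiset.dedup_le _

theorem elimattx_le {S : ConSig} (R : Clause S) : (elimattx R).hyps ≤ R.hyps :=
  by classical exact Multiset.filter_le _ _

/-- Some hypothesis of the clause is an instance of a fact of `Fnot`, or the clause is a tautology,
or some clause of `T` has the same conclusion and fewer hypotheses. -/
theorem IsSimplify.exists_mem {R R' : Clause 𝒞.toConSig} {T : Set (Clause 𝒞.toConSig)}
    (hT : IsSimplify 𝒞 Fnot R T) (hR' : R' ∈ decomp 𝒞 R) :
    HasNotHyp Fnot R' ∨ IsTaut R' ∨ ∃ D ∈ T, D.hyps ≤ R'.hyps ∧ D.concl = R'.concl := by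
  obtain ⟨red, hred, rfl⟩ := hT
  obtain ⟨h1, h2⟩ := (hred (elimdup R')).le
  have h1 := h1.trans (elimdup_le R')
  by_cases hn : HasNotHyp Fnot (red (elimdup R'))
  · obtain ⟨F, hF, h⟩ := hn
    exact .inl ⟨F, Multiset.mem_of_le h1 hF, h⟩
  by_cases ht : IsTaut (red (elimdup R'))
  · refine .inr (.inl ?_)
    rw [IsTaut, h2] at ht
    exact Multiset.mem_of_le h1 ht
  · exact .inr (.inr ⟨_, ⟨R', hR', hn, ht, rfl⟩, (elimattx_le _).trans h1, h2⟩)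

theorem IsSimplify'.exists_mem {R : Clause 𝒞.toConSig} {T : Set (Clause 𝒞.toConSig)}
    (hT : IsSimplify' 𝒞 Fnot R T) :
    HasNotHyp Fnot (decomphyp 𝒞 R) ∨
      ∃ D ∈ T, D.hyps ≤ (decomphyp 𝒞 R).hyps ∧ D.concl = R.concl := by
  obtain ⟨red, hred, rfl⟩ := hT
  obtain ⟨h1, h2⟩ := (hred (elimdup (decomphyp 𝒞 R))).le
  have h1 := h1.trans (elimdup_le _)
  by_cases hn : HasNotHyp Fnot (red (elimdup (decomphyp 𝒞 R)))
  · obtain ⟨F, hF, h⟩ := hn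
    exact .inl ⟨F, Multiset.mem_of_le h1 hF, h⟩
  · refine .inr ⟨_, ⟨hn, rfl⟩, (elimattx_le _).trans h1, h2.trans ?_⟩
    simp only [elimdup, decomphyp]
    split <;> rfl

theorem Dv.hyps_decomphyp {R : Clause 𝒞.toConSig} {σ : Subst 𝒞.toConSig}
    (h : ∀ F ∈ R.hyps, Dv R₁ Me (F.subst σ)) :
    (∀ G ∈ (decomphyp 𝒞 R).hyps, Dv R₁ Me (G.subst σ)) ∧
      wt R₁ Me σ (decomphyp 𝒞 R).hyps ≤ wt R₁ Me σ R.hyps := by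
  rw [decomphyp]
  split
  · exact ⟨h, le_rfl⟩
  · exact Dv.hyps_decomp h

/-- The components of the conclusion are recomposed by the data rule. The bounds on weight and size
are passed on to serve as induction measure. -/
theorem Dv.of_decomp {R : Clause 𝒞.toConSig} {σ : Subst 𝒞.toConSig}
    (h : ∀ F ∈ R.hyps, Dv R₁ Me (F.subst σ))
    (H : ∀ R' ∈ decomp 𝒞 R, (∀ F ∈ R'.hyps, Dv R₁ Me (F.subst σ)) →
      wt R₁ Me σ R'.hyps ≤ wt R₁ Me σ R.hyps →
      (R'.concl.subst σ).size ≤ (R.concl.subst σ).size → Dv R₁ Me (R'.concl.subst σ)) :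
    Dv R₁ Me (R.concl.subst σ) := by
  rw [decomp] at H
  split at H
  · exact H R rfl h le_rfl le_rfl
  · obtain ⟨h1, h2⟩ := Dv.hyps_decomp h
    exact Dv.fact_decomp_concl fun G hG =>
      H ⟨_, G⟩ ⟨G, hG, rfl⟩ h1 h2 (HornFact.decomp_size σ _ _ hG)

/-- The size bound matters: it makes the deletion of clauses by secrecy assumptions compatible with
an argument by minimal size, before these assumptions are known to hold. -/
theorem HasNotHyp.dv {R : Clause 𝒞.toConSig} {σ : Subst 𝒞.toConSig} (hn : HasNotHyp Fnot R)
    (h : ∀ F ∈ R.hyps, Dv R₁ Me (F.subst σ)) :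
    ∃ F ∈ Fnot, ∃ τ : Subst 𝒞.toConSig, Dv R₁ Me (F.subst τ) ∧
      sz R₁ Me (F.subst τ) ≤ wt R₁ Me σ R.hyps := by
  obtain ⟨F, hF, F', hF', τ, rfl⟩ := hn
  refine ⟨F', hF', τ.comp σ, ?_⟩
  rw [← HornFact.subst_subst]
  exact ⟨h _ hF, Multiset.single_le_sum (fun _ _ => Nat.zero_le _) _
    (Multiset.mem_map_of_mem (fun F => sz R₁ Me (F.subst σ)) hF)⟩

/-- Deleted clauses are harmless: either some hypothesis is an instance of a secrecy assumption,
hence not derivable, or the conclusion is already among the derivable hypotheses. -/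
theorem Dv.of_simplify {R : Clause 𝒞.toConSig} {T : Set (Clause 𝒞.toConSig)}
    (hT : IsSimplify 𝒞 Fnot R T) {σ : Subst 𝒞.toConSig}
    (hnot : ∀ F ∈ Fnot, ∀ τ : Subst 𝒞.toConSig, ¬ Dv R₁ Me (F.subst τ))
    (h : ∀ F ∈ R.hyps, Dv R₁ Me (F.subst σ))
    (H : ∀ D ∈ T, (∀ F ∈ D.hyps, Dv R₁ Me (F.subst σ)) →
      wt R₁ Me σ D.hyps ≤ wt R₁ Me σ R.hyps →
      (D.concl.subst σ).size ≤ (R.concl.subst σ).size → Dv R₁ Me (D.concl.subst σ)) :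
    Dv R₁ Me (R.concl.subst σ) := by
  refine Dv.of_decomp h fun R' hR' h1 h2 h3 => ?_
  obtain hn | ht | ⟨D, hD, h4, h5⟩ := hT.exists_mem hR'
  · obtain ⟨F, hF, τ, hτ, -⟩ := hn.dv h1
    exact absurd hτ (hnot F hF τ)
  · exact h1 _ ht
  · rw [← h5] at h3 ⊢
    exact H D hD (fun F hF => h1 F (Multiset.mem_of_le h4 hF)) ((wt_mono h4).trans h2) h3

theorem Subsumes.dv {R D : Clause 𝒞.toConSig} (hs : Subsumes R D) {σ : Subst 𝒞.toConSig}
    (h : ∀ F ∈ D.hyps, Dv R₁ Me (F.subst σ)) :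
    ∃ τ : Subst 𝒞.toConSig, R.concl.subst τ = D.concl.subst σ ∧
      (∀ F ∈ R.hyps, Dv R₁ Me (F.subst τ)) ∧ wt R₁ Me τ R.hyps ≤ wt R₁ Me σ D.hyps := by
  obtain ⟨ρ, hc, hh⟩ := hs
  refine ⟨ρ.comp σ, by rw [← HornFact.subst_subst, hc], fun F hF => ?_, ?_⟩
  · rw [← HornFact.subst_subst]
    exact h _ (Multiset.mem_of_le hh (Multiset.mem_map_of_mem _ hF))
  · rw [← wt_map]
    exact wt_mono hh

open Classical in
-- The two instances form a unifier, which factors through the most general one by `δ`. The weight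
-- identity shows that the size of the resolved hypothesis is traded for the weight of the premises
-- of `R`.
theorem IsResolvent.dv {R R' R'' : Clause 𝒞.toConSig} {F₀ : HornFact 𝒞.toConSig}
    (hr : IsResolvent R F₀ R' R'') {σ σ' : Subst 𝒞.toConSig}
    (he : R.concl.subst σ = F₀.subst σ') (h : ∀ F ∈ R.hyps, Dv R₁ Me (F.subst σ))
    (h' : ∀ F ∈ R'.hyps.erase F₀, Dv R₁ Me (F.subst σ')) :
    ∃ δ : Subst 𝒞.toConSig, R''.concl.subst δ = R'.concl.subst σ' ∧
      (∀ F ∈ R''.hyps, Dv R₁ Me (F.subst δ)) ∧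
      wt R₁ Me δ R''.hyps = wt R₁ Me σ R.hyps + wt R₁ Me σ' (R'.hyps.erase F₀) := by
  obtain ⟨-, τ, τ', -, hmgu, rfl⟩ := hr
  obtain ⟨δ, hδ, hδ'⟩ := hmgu σ σ' he
  refine ⟨δ, (hδ' _ (.inr rfl)).symm, fun F hF => ?_, ?_⟩
  · obtain hF | hF := Multiset.mem_add.1 hF
    · obtain ⟨G, hG, rfl⟩ := Multiset.mem_map.1 hF
      rw [← hδ G (.inl hG)]
      exact h G hG
    · obtain ⟨G, hG, rfl⟩ := Multiset.mem_map.1 hF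
      rw [← hδ' G (.inl (Multiset.mem_of_mem_erase hG))]
      exact h' G hG
  · rw [wt_add, wt_map, wt_map]
    congr 1
    · exact wt_congr fun F hF => by rw [← HornFact.subst_subst, hδ F (.inl hF)]
    · exact wt_congr fun F hF => by
        rw [← HornFact.subst_subst, hδ' F (.inl (Multiset.mem_of_mem_erase hF))]

open Classical in
theorem wt_erase {σ : Subst 𝒞.toConSig} {H : Multiset (HornFact 𝒞.toConSig)}
    {F : HornFact 𝒞.toConSig} (hF : F ∈ H) :
    wt R₁ Me σ H = sz R₁ Me (F.subst σ) + wt R₁ Me σ (H.erase F) := by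
  conv_lhs => rw [← Multiset.cons_erase hF]
  simp [wt]

/-! ## Backward search -/

/-- Every derivable fact other than a must-event is obtained by a clause of `R₁` from hypotheses
that have smaller derivations. -/
def Invertible (R₁ : Set (Clause 𝒞.toConSig)) (Me : Set (Pattern 𝒞.toConSig)) : Prop :=
  ∀ F : HornFact 𝒞.toConSig, Dv R₁ Me F → (∀ p, F ≠ .mevent p) →
    ∃ R ∈ R₁, ∃ σ : Subst 𝒞.toConSig, R.concl.subst σ = F ∧
      (∀ G ∈ R.hyps, Dv R₁ Me (G.subst σ)) ∧ wt R₁ Me σ R.hyps < sz R₁ Me F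

theorem Selection.ne_mevent {S : ConSig} (sel : Selection S) {R : Clause S} {F : HornFact S}
    (hF : F ∈ sel.sel R) (σ : Subst S) (p : Pattern S) : F.subst σ ≠ .mevent p := by
  intro h
  cases F with
  | mevent q => exact sel.selectable R _ hF (.inr ⟨q, rfl⟩)
  | _ => cases h

/-- The search follows a derivation backwards: the selected hypothesis is inverted and resolved
away, and the weight drops. Two prunings must not cut this path. Deletion by a secrecy assumption is
excluded by `hk`, since after one resolution all hypotheses are lighter than `k`. The loop check is
excluded by `hA`: every ancestor instance with the same conclusion and derivable hypotheses is
strictly heavier, whereas a subsuming ancestor would have an instance at most as heavy. -/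
theorem Deriv.exists_mem {R : Clause 𝒞.toConSig} {A out : Set (Clause 𝒞.toConSig)}
    (hD : Deriv 𝒞 sel Fnot R₁ R A out) (inv : Invertible R₁ Me) {k : ℕ}
    (hk : ∀ F ∈ Fnot, ∀ τ : Subst 𝒞.toConSig, Dv R₁ Me (F.subst τ) → k ≤ sz R₁ Me (F.subst τ))
    (σ : Subst 𝒞.toConSig) (h : ∀ F ∈ R.hyps, Dv R₁ Me (F.subst σ))
    (hw : wt R₁ Me σ R.hyps ≤ k)
    (hA : ∀ R' ∈ A, ∀ τ : Subst 𝒞.toConSig, R'.concl.subst τ = R.concl.subst σ →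
      (∀ F ∈ R'.hyps, Dv R₁ Me (F.subst τ)) → wt R₁ Me σ R.hyps < wt R₁ Me τ R'.hyps) :
    ∃ R' ∈ out, ∃ τ : Subst 𝒞.toConSig, R'.concl.subst τ = R.concl.subst σ ∧
      ∀ F ∈ R'.hyps, Dv R₁ Me (F.subst τ) := by
  classical
  induction hD generalizing σ with
  | cycle R A hc =>
    obtain ⟨R', hR', hs⟩ := hc
    obtain ⟨τ, h1, h2, h3⟩ := hs.dv h
    exact absurd (hA R' hR' τ h1 h2) (not_lt.2 h3)
  | found R A hc hsel => exact ⟨R, rfl, σ, rfl, h⟩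
  | search R A hc hsel next out hnext hout ih =>
    -- The instance is replaced by one of least weight with the same conclusion. A resolvent lighter
    -- than it is lighter than all such instances of `R`, which is what `hA` demands once `R` joins
    -- `A`.
    let P : ℕ → Prop := fun w => ∃ τ : Subst 𝒞.toConSig, R.concl.subst τ = R.concl.subst σ ∧
      (∀ F ∈ R.hyps, Dv R₁ Me (F.subst τ)) ∧ wt R₁ Me τ R.hyps = w
    have hP : ∃ w, P w := ⟨_, σ, rfl, h, rfl⟩
    obtain ⟨σ₀, hc₀, h₀, hw₀⟩ := Nat.find_spec hP
    have hmin : ∀ τ : Subst 𝒞.toConSig, R.concl.subst τ = R.concl.subst σ →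
        (∀ F ∈ R.hyps, Dv R₁ Me (F.subst τ)) → wt R₁ Me σ₀ R.hyps ≤ wt R₁ Me τ R.hyps :=
      fun τ h1 h2 => hw₀ ▸ Nat.find_min' hP ⟨τ, h1, h2, rfl⟩
    obtain ⟨F₀, hF₀⟩ := Set.nonempty_iff_ne_empty.2 hsel
    have hF₀R := sel.subset_hyps R F₀ hF₀
    obtain ⟨R', hR', σ', he, h', hw'⟩ := inv _ (h₀ F₀ hF₀R) (sel.ne_mevent hF₀ σ₀)
    have hdef : ResolutionDefined R' F₀ R := ⟨hF₀R, σ', σ₀, he⟩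
    obtain ⟨R'', hres, hsim⟩ := hnext R' hR' F₀ hF₀ hdef
    obtain ⟨δ, hδc, hδh, hδw⟩ := hres.dv he h' fun F hF => h₀ F (Multiset.mem_of_mem_erase hF)
    have hlt : wt R₁ Me δ R''.hyps < wt R₁ Me σ₀ R.hyps := by
      rw [hδw, wt_erase hF₀R]
      omega
    obtain ⟨h1, h2⟩ := Dv.hyps_decomphyp hδh
    have hle := hmin σ rfl h
    obtain hn | ⟨D, hD, h3, h4⟩ := hsim.exists_mem
    -- The resolvent weighs strictly less than `k`, whereas derivable instances of `Fnot` have size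
    -- at least `k`.
    · obtain ⟨F, hF, τ, hτ, hs⟩ := hn.dv h1
      have := hk F hF τ hτ
      omega
    · have h5 := wt_mono (R₁ := R₁) (Me := Me) (σ := δ) h3
      have hcD : D.concl.subst δ = R.concl.subst σ := by rw [h4, hδc, hc₀]
      obtain ⟨C, hC, τ, hτ, hτh⟩ := ih R' hR' F₀ hF₀ hdef D hD δ
        (fun F hF => h1 F (Multiset.mem_of_le h3 hF)) (by omega) (by
          rintro R₂ (rfl | hR₂) τ hτ hτh
          · have := hmin τ (hτ.trans hcD) hτh
            omega
          · have := hA R₂ hR₂ τ (hτ.trans hcD) hτh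
            omega)
      exact ⟨C, ⟨R', hR', F₀, hF₀, hdef, D, hD, hC⟩, τ, hτ.trans hcD, hτh⟩

theorem Derivable.exists_mem {F : HornFact 𝒞.toConSig} {out : Set (Clause 𝒞.toConSig)}
    (hD : Derivable 𝒞 sel Fnot F R₁ out) (inv : Invertible R₁ Me) (σ : Subst 𝒞.toConSig)
    (hF : Dv R₁ Me (F.subst σ))
    (hk : ∀ F' ∈ Fnot, ∀ τ : Subst 𝒞.toConSig, Dv R₁ Me (F'.subst τ) →
      sz R₁ Me (F.subst σ) ≤ sz R₁ Me (F'.subst τ)) :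
    ∃ R' ∈ out, ∃ τ : Subst 𝒞.toConSig, R'.concl.subst τ = F.subst σ ∧
      ∀ G ∈ R'.hyps, Dv R₁ Me (G.subst τ) :=
  Deriv.exists_mem hD inv hk σ
    (fun G hG => by rwa [Multiset.mem_singleton.1 hG]) (by simp [wt]) (fun _ h => h.elim)

/-- Among the derivable instances of secrecy assumptions, one of least size satisfies the side
condition of the search with `k` its own size, so the search would return a clause for it. -/
theorem not_dv_of_derivable (inv : Invertible R₁ Me)
    (hD : ∀ F ∈ Fnot, Derivable 𝒞 sel Fnot F R₁ ∅) (F : HornFact 𝒞.toConSig) (hF : F ∈ Fnot)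
    (σ : Subst 𝒞.toConSig) : ¬ Dv R₁ Me (F.subst σ) := by
  classical
  intro h
  have hP : ∃ k, ∃ F ∈ Fnot, ∃ σ : Subst 𝒞.toConSig, Dv R₁ Me (F.subst σ) ∧
    sz R₁ Me (F.subst σ) = k := ⟨_, F, hF, σ, h, rfl⟩
  obtain ⟨F', hF', σ', h', hk⟩ := Nat.find_spec hP
  obtain ⟨R', hR', -⟩ := (hD F' hF').exists_mem inv σ' h' fun G hG τ hτ =>
    hk ▸ Nat.find_min' hP ⟨G, hG, τ, hτ, rfl⟩
  exact hR'

/-- A hypothesis `attacker(x)` is unselectable, so the search would return its starting clause.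
Consequently a secrecy assumption cannot delete a clause because of a hypothesis `attacker(x)`. -/
theorem Derivable.ne_attacker_var {F : HornFact 𝒞.toConSig}
    (hD : Derivable 𝒞 sel Fnot F R₁ ∅) (x : ℕ) : F ≠ .attacker (.var x) := by
  rintro rfl
  generalize hout : (∅ : Set (Clause 𝒞.toConSig)) = out at hD
  obtain ⟨-, -, h⟩ | ⟨-, -, -, -⟩ | ⟨-, -, -, hsel, -⟩ := hD
  · exact absurd h (by simp)
  · exact (Set.singleton_ne_empty _ hout.symm).elim
  · obtain ⟨F₀, hF₀⟩ := Set.nonempty_iff_ne_empty.2 hsel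
    have := Multiset.mem_singleton.1 (sel.subset_hyps _ F₀ hF₀)
    exact sel.selectable _ F₀ hF₀ (.inl ⟨x, this⟩)

/-- No clause of `R₁` with derivable hypotheses has an instance of a fact of `Fnot` as
conclusion. -/
theorem concl_ne_of_derivable (inv : Invertible R₁ Me)
    (hD : ∀ F ∈ Fnot, Derivable 𝒞 sel Fnot F R₁ ∅) {F : HornFact 𝒞.toConSig} (hF : F ∈ Fnot)
    (τ : Subst 𝒞.toConSig) {R : Clause 𝒞.toConSig} (hR : R ∈ R₁) (σ : Subst 𝒞.toConSig)
    (h : ∀ G ∈ R.hyps, Dv R₁ Me (G.subst σ)) : R.concl.subst σ ≠ F.subst τ := by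
  classical
  intro he
  have hnot := not_dv_of_derivable inv hD
  have hDF := hD F hF
  generalize hout : (∅ : Set (Clause 𝒞.toConSig)) = out at hDF
  obtain ⟨-, -, h⟩ | ⟨-, -, -, -⟩ | ⟨-, -, -, hsel, next, out', hnext, hout'⟩ := hDF
  · exact absurd h (by simp)
  · exact (Set.singleton_ne_empty _ hout.symm).elim
  · obtain ⟨F₀, hF₀⟩ := Set.nonempty_iff_ne_empty.2 hsel
    obtain rfl := Multiset.mem_singleton.1 (sel.subset_hyps _ F₀ hF₀)
    -- The conclusion itself need not be derivable in the sense of `Dv`, because it may be a data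
    -- constructor application. The first resolution of the search is therefore made by hand with
    -- `R`; the hypotheses that remain are derivable and the general lemma applies to them.
    have hdef : ResolutionDefined R F₀ ⟨{F₀}, F₀⟩ := ⟨Multiset.mem_singleton_self _, σ, τ, he⟩
    obtain ⟨R'', hres, hsim⟩ := hnext R hR F₀ hF₀ hdef
    obtain ⟨δ, hδc, hδh, hδw⟩ := hres.dv he h (by simp)
    obtain ⟨h1, h2⟩ := Dv.hyps_decomphyp hδh
    obtain hn | ⟨D, hD, h3, h4⟩ := hsim.exists_mem
    · obtain ⟨F, hF, τ, hτ, hs⟩ := hn.dv h1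
      exact hnot F hF τ hτ
    · obtain ⟨C, hC, -⟩ := (hout' R hR F₀ hF₀ hdef D hD).exists_mem inv
        (fun F hF τ hτ => absurd hτ (hnot F hF τ)) δ
        (fun F hF => h1 F (Multiset.mem_of_le h3 hF)) le_rfl (by
          -- The only ancestor is the starting clause, and it has no instance with a derivable
          -- hypothesis.
          rintro R₂ (rfl | hR₂) τ' hτ hτh
          · exact absurd (hτh F₀ (Multiset.mem_singleton_self _)) (hnot F₀ hF τ')
          · exact hR₂.elim)
      have : C ∈ (∅ : Set (Clause 𝒞.toConSig)) := by
        rw [hout]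
        exact ⟨R, hR, F₀, hF₀, hdef, D, hD, hC⟩
      exact this

end ProVerif

/-! ### Invariants of the saturation loop -/

namespace ProVerif

variable {𝒞 : Calculus} {R₁ : Set (Clause 𝒞.toConSig)} {Me : Set (Pattern 𝒞.toConSig)}
  {sel : Selection 𝒞.toConSig} {Fnot : Set (HornFact 𝒞.toConSig)}

theorem sum_singleton_eq_map {n : ℕ} {β : Type*} (f : Fin n → β) :
    (∑ i, {f i} : Multiset β) = (Finset.univ : Finset (Fin n)).val.map f := by
  have := Multiset.sum_map_singleton ((Finset.univ : Finset (Fin n)).val.map f)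
  rwa [Multiset.map_map] at this

theorem mem_sum_singleton {n : ℕ} {β : Type*} (f : Fin n → β) (b : β) :
    b ∈ (∑ i, {f i} : Multiset β) ↔ ∃ i, b = f i := by
  simp [sum_singleton_eq_map, eq_comm]

theorem IsSimplify.concl_ne_mevent {R D : Clause 𝒞.toConSig} {T : Set (Clause 𝒞.toConSig)}
    (hT : IsSimplify 𝒞 Fnot R T) (hD : D ∈ T) (hR : ∀ p, R.concl ≠ .mevent p)
    (p : Pattern 𝒞.toConSig) : D.concl ≠ .mevent p := by
  obtain ⟨red, hred, rfl⟩ := hT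
  obtain ⟨R', hR', -, -, rfl⟩ := hD
  have h2 : (elimattx (red (elimdup R'))).concl = R'.concl := (hred (elimdup R')).le.2
  rw [h2]
  rw [decomp] at hR'
  split at hR'
  · obtain rfl := hR'
    exact hR p
  · obtain ⟨C, hC, rfl⟩ := hR'
    generalize hF : R.concl = F at hC hR
    cases F with
    | attacker q =>
      obtain ⟨q', -, rfl⟩ := Multiset.mem_map.1 hC
      intro h
      cases h
    | mevent q => exact absurd rfl (hR q)
    | _ =>
      cases Multiset.mem_singleton.1 hC
      intro h
      cases h

/-! ## Saturation -/

/-- Every clause of some result of `simplify(R)` is subsumed by a clause of `B`. -/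
def Covered (𝒞 : Calculus) (Fnot : Set (HornFact 𝒞.toConSig)) (B : Set (Clause 𝒞.toConSig))
    (R : Clause 𝒞.toConSig) : Prop :=
  ∃ T, IsSimplify 𝒞 Fnot R T ∧ ∀ D ∈ T, ∃ R' ∈ B, Subsumes R' D

theorem IsElim.exists_subsumes {S : ConSig} {A B : Set (Clause S)} (h : IsElim A B) {R : Clause S}
    (hR : ∃ R' ∈ A, Subsumes R' R) : ∃ R' ∈ B, Subsumes R' R := by
  obtain ⟨R', hR', hs⟩ := hR
  obtain ⟨R'', hR'', hs'⟩ := h.2.1 R' hR'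
  exact ⟨R'', hR'', hs'.trans hs⟩

theorem AddClause.covered {R : Clause 𝒞.toConSig} {A B : Set (Clause 𝒞.toConSig)}
    (h : AddClause 𝒞 Fnot R A B) : Covered 𝒞 Fnot B R := by
  obtain ⟨T, hT, he⟩ := h
  exact ⟨T, hT, fun D hD => he.exists_subsumes ⟨D, .inl hD, .refl D⟩⟩

/-- By transitivity of subsumption, removing subsumed clauses never uncovers a clause. -/
theorem AddClause.covered_of_covered {R D : Clause 𝒞.toConSig} {A B : Set (Clause 𝒞.toConSig)}
    (h : AddClause 𝒞 Fnot R A B) (hD : Covered 𝒞 Fnot A D) : Covered 𝒞 Fnot B D := by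
  obtain ⟨T, hT, he⟩ := h
  obtain ⟨T', hT', h'⟩ := hD
  refine ⟨T', hT', fun E hE => he.exists_subsumes ?_⟩
  obtain ⟨R', hR', hs⟩ := h' E hE
  exact ⟨R', .inr hR', hs⟩

/-- No conclusion of a clause is a must-event. -/
def NoMevent (A : Set (Clause 𝒞.toConSig)) : Prop :=
  ∀ R ∈ A, ∀ p, R.concl ≠ .mevent p

theorem AddClause.noMevent {R : Clause 𝒞.toConSig} {A B : Set (Clause 𝒞.toConSig)}
    (h : AddClause 𝒞 Fnot R A B) (hR : ∀ p, R.concl ≠ .mevent p) (hA : NoMevent A) :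
    NoMevent B := by
  obtain ⟨T, hT, he⟩ := h
  intro D hD
  obtain hD | hD := he.1 hD
  · exact hT.concl_ne_mevent hD hR
  · exact hA D hD

theorem AddClauses.covered {L : List (Clause 𝒞.toConSig)} {A B : Set (Clause 𝒞.toConSig)}
    (h : AddClauses 𝒞 Fnot L A B) (hL : ∀ R ∈ L, ∀ p, R.concl ≠ .mevent p)
    (hA : NoMevent A) :
    NoMevent B ∧ (∀ R ∈ L, Covered 𝒞 Fnot B R) ∧
      ∀ R, Covered 𝒞 Fnot A R → Covered 𝒞 Fnot B R := by
  induction h with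
  | nil A => exact ⟨hA, by simp, fun _ h => h⟩
  | cons R L A B C h hL' ih =>
    obtain ⟨h1, h2, h3⟩ := ih (fun R hR => hL R (List.mem_cons_of_mem _ hR))
      (h.noMevent (hL R List.mem_cons_self) hA)
    refine ⟨h1, fun R' hR' => ?_, fun R' hR' => h3 R' (h.covered_of_covered hR')⟩
    obtain rfl | hR' := List.mem_cons.1 hR'
    · exact h3 _ h.covered
    · exact h2 R' hR'

/-- The properties of the set of clauses at the fixpoint reached by `saturate`. -/
structure Saturated (sel : Selection 𝒞.toConSig) (Fnot : Set (HornFact 𝒞.toConSig))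
    (R₀ B : Set (Clause 𝒞.toConSig)) : Prop where
  noMevent : NoMevent B
  covered : ∀ R ∈ R₀, Covered 𝒞 Fnot B R
  resolve : ∀ R F₀ R', CanResolve sel B R F₀ R' →
    ∃ R'', IsResolvent R F₀ R' R'' ∧ Covered 𝒞 Fnot B R''

theorem Saturate.saturated {R₀ : Set (Clause 𝒞.toConSig)} (h : Saturate 𝒞 sel Fnot R₀ R₁)
    (hR₀ : NoMevent R₀) :
    ∃ B, Saturated sel Fnot R₀ B ∧ R₁ = {R ∈ B | sel.sel R = ∅} := by
  obtain ⟨L, A, B, rfl, hL, hAB, hfix, rfl⟩ := h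
  obtain ⟨h1, h2, -⟩ := hL.covered hR₀ (fun _ h => h.elim)
  have : NoMevent B ∧ ∀ R ∈ L, Covered 𝒞 Fnot B R := by
    clear hfix
    induction hAB with
    | refl => exact ⟨h1, h2⟩
    | tail _ hs ih =>
      obtain ⟨R, F₀, R', hc, R'', ⟨-, σ, σ', -, -, rfl⟩, ha⟩ := hs
      refine ⟨ha.noMevent (fun p hp => ?_) ih.1, fun D hD => ha.covered_of_covered (ih.2 D hD)⟩
      have hne := ih.1 R' hc.2.2.1
      generalize R'.concl = F at hp hne
      cases F with
      | mevent q => exact hne q rfl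
      | _ => cases hp
  refine ⟨B, ⟨this.1, this.2, fun R F₀ R' hc => ?_⟩, rfl⟩
  obtain ⟨R'', hr, ha⟩ := hfix R F₀ R' hc
  exact ⟨R'', hr, ha.covered⟩

end ProVerif

/-! ### The unselected clauses of a saturated set derive as much as the whole set -/

namespace ProVerif

variable {𝒞 : Calculus} {R₁ : Set (Clause 𝒞.toConSig)} {Me : Set (Pattern 𝒞.toConSig)}
  {sel : Selection 𝒞.toConSig} {Fnot : Set (HornFact 𝒞.toConSig)}

/-! ## Completeness of saturation -/

theorem HornFact.subst_eq_attacker_var {S : ConSig} {F : HornFact S} {σ : Subst S} {x : ℕ}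
    (h : F.subst σ = .attacker (.var x)) : ∃ y, F = .attacker (.var y) := by
  cases F with
  | attacker p =>
    cases p with
    | var y => exact ⟨y, rfl⟩
    | _ => simp [HornFact.subst, Pattern.subst] at h
  | _ => cases h

theorem HornFact.not_atomic {F : HornFact 𝒞.toConSig} (h : ¬ F.Atomic 𝒞) :
    ∃ f ∈ 𝒞.data, ∃ args, F = .attacker (.app f args) := by
  simpa [HornFact.Atomic] using h

/-- The substitution of the first `n` variables. -/
def Subst.ofFin {S : ConSig} {n : ℕ} (θ : Fin n → Pattern S) : Subst S :=
  ⟨fun x => if h : x < n then θ ⟨x, h⟩ else .var x, .var⟩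

@[simp]
theorem Subst.ofFin_ord {S : ConSig} {n : ℕ} (θ : Fin n → Pattern S) (i : Fin n) :
    (Subst.ofFin θ).ord i = θ i := by
  simp [Subst.ofFin]

theorem clauseRf_mem {R₀ : Set (Clause 𝒞.toConSig)} {Init : Finset Name}
    (hR₀ : attackerClauses 𝒞 Init ⊆ R₀) {f : 𝒞.Con} (hf : 𝒞.pubCon f) :
    clauseRf 𝒞.toConSig f (fun i => i) ∈ R₀ :=
  hR₀ (.inl (.inl (.inr ⟨f, hf, rfl⟩)))

theorem Subsumes.exists_instance {S : ConSig} {R D : Clause S} (h : Subsumes R D) (τ : Subst S) :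
    ∃ σ : Subst S, R.concl.subst σ = D.concl.subst τ ∧
      R.hyps.map (HornFact.subst σ) ≤ D.hyps.map (HornFact.subst τ) := by
  obtain ⟨ρ, hc, hh⟩ := h
  refine ⟨ρ.comp τ, by rw [← HornFact.subst_subst, hc], ?_⟩
  have := Multiset.map_le_map (f := HornFact.subst τ) hh
  rw [Multiset.map_map] at this
  simpa only [Function.comp_def, HornFact.subst_subst] using this

/-- Composition clauses are exempt from decomposition, and their hypotheses `attacker(xᵢ)` cannot
trigger a deletion. A fact with instance `attacker(xᵢ)` is itself `attacker(y)`, so all hypotheses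
of the subsuming clause are unselectable. -/
theorem Saturated.exists_composition {R₀ B : Set (Clause 𝒞.toConSig)} {Init : Finset Name}
    (hB : Saturated sel Fnot R₀ B) (hR₀ : attackerClauses 𝒞 Init ⊆ R₀)
    (hvar : ∀ x, .attacker (.var x) ∉ Fnot) {f : 𝒞.Con} (hf : f ∈ 𝒞.data) :
    ∃ R ∈ B, sel.sel R = ∅ ∧ Subsumes R (clauseRf _ f (fun i => i)) := by
  have hd : IsDataClause 𝒞 (clauseRf 𝒞.toConSig f (fun i => i)) :=
    ⟨f, hf, _, fun i j h => Fin.ext h, .inl rfl⟩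
  obtain ⟨T, hT, h⟩ := hB.covered _ (clauseRf_mem hR₀ (𝒞.data_pub f hf))
  obtain ⟨F, hF, F', hF', σ, rfl⟩ | ht | ⟨D, hD, h1, h2⟩ :=
    hT.exists_mem (R' := clauseRf 𝒞.toConSig f (fun i => i)) (by rw [decomp, if_pos hd]; rfl)
  · obtain ⟨i, hi⟩ := (mem_sum_singleton _ _).1 hF
    obtain ⟨y, rfl⟩ := HornFact.subst_eq_attacker_var hi
    exact absurd hF' (hvar y)
  · obtain ⟨i, hi⟩ := (mem_sum_singleton _ _).1 ht
    cases hi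
  · obtain ⟨R, hR, ρ, hc, hh⟩ := h D hD
    refine ⟨R, hR, Set.eq_empty_iff_forall_notMem.2 fun F hF => ?_, ρ, hc.trans h2, hh.trans h1⟩
    have := Multiset.mem_of_le (hh.trans h1)
      (Multiset.mem_map_of_mem _ (sel.subset_hyps R F hF))
    obtain ⟨i, hi⟩ := (mem_sum_singleton _ _).1 this
    exact sel.selectable R F hF (.inl (HornFact.subst_eq_attacker_var hi))

/-- The data rule of `DerSz` is not a clause, so for non-atomic facts it is simulated by the clause
from `Saturated.exists_composition`. -/
theorem Saturated.invertible {R₀ B : Set (Clause 𝒞.toConSig)} {Init : Finset Name}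
    (hB : Saturated sel Fnot R₀ B) (hR₀ : attackerClauses 𝒞 Init ⊆ R₀)
    (hvar : ∀ x, .attacker (.var x) ∉ Fnot) : Invertible {R ∈ B | sel.sel R = ∅} Me := by
  intro F hF hm
  by_cases hat : F.Atomic 𝒞
  · obtain ⟨p, -, rfl⟩ | h := hF.atomic_inv hat
    · exact absurd rfl (hm p)
    · exact h
  · obtain ⟨f, hf, args, rfl⟩ := HornFact.not_atomic hat
    obtain ⟨h1, h2⟩ := hF.data_inv hf
    obtain ⟨R, hR, hsel, hs⟩ := hB.exists_composition hR₀ hvar hf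
    obtain ⟨τ, h3, h4, h5⟩ := hs.dv (R₁ := {R ∈ B | sel.sel R = ∅}) (Me := Me)
        (σ := Subst.ofFin args) (by
      intro F hF
      obtain ⟨i, rfl⟩ := (mem_sum_singleton _ _).1 hF
      simpa [HornFact.subst, Pattern.subst] using h1 i)
    refine ⟨R, ⟨hR, hsel⟩, τ, ?_, h4, lt_of_le_of_lt h5 (lt_of_eq_of_lt ?_ h2)⟩
    · rw [h3]
      simp [clauseRf, HornFact.subst, Pattern.subst]
    · rw [wt, clauseRf, sum_singleton_eq_map, Multiset.map_map, Finset.sum_eq_multiset_sum]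
      refine congrArg Multiset.sum (Multiset.map_congr rfl fun i _ => ?_)
      simp [HornFact.subst, Pattern.subst]

theorem Dv.attacker_of_forall_atomic
    (h : ∀ p : Pattern 𝒞.toConSig, (HornFact.attacker p).Atomic 𝒞 → Dv R₁ Me (.attacker p))
    (p : Pattern 𝒞.toConSig) : Dv R₁ Me (.attacker p) := by
  induction p with
  | var x => exact h _ (by simp [HornFact.Atomic])
  | name => exact h _ (by simp [HornFact.Atomic])
  | app f args ih =>
    by_cases hf : f ∈ 𝒞.data
    · exact Dv.data hf ih
    · refine h _ fun f' hf' args' he => hf ?_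
      injection he with he
      injection he with he
      exact he ▸ hf'

theorem projection_mem {R₀ : Set (Clause 𝒞.toConSig)} {Init : Finset Name}
    (hR₀ : attackerClauses 𝒞 Init ⊆ R₀) {f : 𝒞.Con} (hf : f ∈ 𝒞.data) (i : Fin (𝒞.arity f)) :
    (⟨{.attacker (.app f (fun j => .var j))}, .attacker (.var i)⟩ : Clause 𝒞.toConSig) ∈ R₀ := by
  obtain ⟨g, hg, hd, hr⟩ := 𝒞.data_proj f hf i
  refine hR₀ (.inl (.inr ⟨g, hg, projRule _ f i _ hd, by rw [hr]; exact List.mem_singleton_self _,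
    ?_⟩))
  have key : ∀ (d : ℕ) (hd : d = 1), (⟨{.attacker (.app f (fun j => .var j))},
      .attacker (.var i)⟩ : Clause 𝒞.toConSig) = clauseRg _ (projRule 𝒞.toConSig f i d hd) := by
    rintro d rfl
    rw [clauseRg, Fin.sum_univ_one]
    rfl
  exact key _ hd

/-- Only the existence of some derivable attacker fact is needed, to fill the side hypotheses
`attacker(y)` in `Saturated.exists_projection`. -/
theorem Dv.attacker_b0 {R₀ B : Set (Clause 𝒞.toConSig)} {Init : Finset Name}
    (hB : Saturated sel Fnot R₀ B) (hR₀ : attackerClauses 𝒞 Init ⊆ R₀) :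
    ∃ p, Dv {R ∈ B | sel.sel R = ∅} Me (.attacker p) := by
  refine ⟨.name .b0 1 (fun _ => .var 0) [], ?_⟩
  obtain ⟨T, hT, h⟩ := hB.covered _ (hR₀ (.inl (.inl (.inl (.inr rfl)))))
  obtain ⟨F, hF, -⟩ | ht | ⟨D, hD, h1, h2⟩ :=
    hT.exists_mem (R' := clauseRn 𝒞.toConSig) (by
      rw [decomp]
      split
      · rfl
      · exact ⟨_, Multiset.mem_singleton_self _, rfl⟩)
  · exact absurd hF (Multiset.notMem_zero _)
  · exact absurd ht (Multiset.notMem_zero _)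
  · obtain ⟨R, hR, ρ, hc, hh⟩ := h D hD
    have h0 : R.hyps = 0 := Multiset.map_eq_zero.1 (Multiset.le_zero.1 (hh.trans h1))
    have he : R.concl.subst ρ = .attacker (.name .b0 1 (fun _ => .var 0) []) := hc.trans h2
    rw [← he]
    refine Dv.clause (R₁ := {R ∈ B | sel.sel R = ∅}) ⟨hR, Set.eq_empty_iff_forall_notMem.2 fun F hF => ?_⟩ ρ ?_ (by simp [h0])
    · have := sel.subset_hyps R F hF
      simp [h0] at this
    · rw [he]
      simp [HornFact.Atomic]

open Classical in
/-- A clause without selected facts and with conclusion `attacker(x)`: the components of the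
instances of `x` are derivable, or are obtained by resolution with a selected hypothesis. -/
theorem Saturated.exists_projection {R₀ B : Set (Clause 𝒞.toConSig)} {Init : Finset Name}
    (hB : Saturated sel Fnot R₀ B) (hR₀ : attackerClauses 𝒞 Init ⊆ R₀)
    (hD : ∀ F ∈ Fnot, Derivable 𝒞 sel Fnot F {R ∈ B | sel.sel R = ∅} ∅)
    {R : Clause 𝒞.toConSig} (hR : R ∈ B) (hsel : sel.sel R = ∅) {σ : Subst 𝒞.toConSig}
    (h : ∀ F ∈ R.hyps, Dv {R ∈ B | sel.sel R = ∅} Me (F.subst σ)) {f : 𝒞.Con} (hf : f ∈ 𝒞.data)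
    {args : Fin (𝒞.arity f) → Pattern 𝒞.toConSig}
    (hc : R.concl.subst σ = .attacker (.app f args)) (i : Fin (𝒞.arity f)) :
    Dv {R ∈ B | sel.sel R = ∅} Me (.attacker (args i)) ∨
      ∃ R' ∈ B, ∃ F₀ ∈ sel.sel R', ∃ τ : Subst 𝒞.toConSig, R.concl.subst σ = F₀.subst τ ∧
        R'.concl.subst τ = .attacker (args i) ∧ R'.hyps.erase F₀ = 0 := by
  have hvar : ∀ x, .attacker (.var x) ∉ Fnot := fun x hx => (hD _ hx).ne_attacker_var x rfl
  have inv := hB.invertible (Me := Me) hR₀ hvar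
  have hd : IsDataClause 𝒞 ⟨{.attacker (.app f (fun j => .var j))}, .attacker (.var i)⟩ :=
    ⟨f, hf, _, fun i j h => Fin.ext h, .inr ⟨i, rfl⟩⟩
  have hof : (HornFact.attacker (.app f (fun j => .var j))).subst (Subst.ofFin args) =
      .attacker (.app f args) := by simp [HornFact.subst, Pattern.subst]
  obtain ⟨T, hT, hcov⟩ := hB.covered _ (projection_mem hR₀ hf i)
  obtain ⟨F, hF, F', hF', ρ, rfl⟩ | ht | ⟨D, hD', h1, h2⟩ :=
    hT.exists_mem (R' := ⟨{.attacker (.app f (fun j => .var j))}, .attacker (.var i)⟩)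
      (by rw [decomp, if_pos hd]; rfl)
  -- If a secrecy assumption deleted the projection clause, the conclusion of `R` would be an
  -- instance of that assumption.
  · refine absurd ?_ (concl_ne_of_derivable inv hD hF' (ρ.comp (Subst.ofFin args)) ⟨hR, hsel⟩ σ h)
    rw [← HornFact.subst_subst, Multiset.mem_singleton.1 hF, hof, hc]
  · cases Multiset.mem_singleton.1 ht
  · obtain ⟨R', hR', hs⟩ := hcov D hD'
    have hs' : Subsumes R' ⟨{.attacker (.app f (fun j => .var j))}, .attacker (.var i)⟩ := by
      obtain ⟨ρ, h3, h4⟩ := hs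
      exact ⟨ρ, h3.trans h2, h4.trans h1⟩
    -- The conclusion of `R'` is `attacker(z)`, which brings the requirement on selection functions
    -- for such conclusions into play.
    obtain ⟨z, hz⟩ := HornFact.subst_eq_attacker_var (hs'.choose_spec.1)
    obtain ⟨τ, hτ, hτh⟩ := hs'.exists_instance (Subst.ofFin args)
    rw [Multiset.map_singleton, hof] at hτh
    have hτ : R'.concl.subst τ = .attacker (args i) := by
      simpa [HornFact.subst, Pattern.subst] using hτ
    by_cases hsel' : (sel.sel R').Nonempty
    · obtain ⟨F₀, hF₀⟩ := hsel'
      have hF₀R := sel.subset_hyps R' F₀ hF₀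
      refine .inr ⟨R', hR', F₀, hF₀, τ, ?_, hτ, ?_⟩
      · rw [hc]
        exact (Multiset.mem_singleton.1
          (Multiset.mem_of_le hτh (Multiset.mem_map_of_mem _ hF₀R))).symm
      -- The subsumed projection clause has a single hypothesis, so `F₀` is the only hypothesis of
      -- `R'`.
      · have := Multiset.card_le_card hτh
        rw [Multiset.card_map, Multiset.card_singleton, ← Multiset.cons_erase hF₀R,
          Multiset.card_cons] at this
        exact Multiset.card_eq_zero.1 (by omega)
    · left
      -- With nothing selected, every hypothesis is some `attacker(y)`. The matching sends `y` to
      -- `f(…)` and `z` to a variable, so they differ. Such a clause derives every attacker fact as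
      -- soon as one is derivable.
      have huns : ∀ F ∈ R'.hyps, ∃ y, F = .attacker (.var y) ∧ y ≠ z := by
        intro F hF
        have hun : F.Unselectable := by
          by_contra hun
          exact hsel' (sel.nonempty_of_attacker_var R' z hz ⟨F, hF, hun⟩)
        obtain ⟨ρ, h3, h4⟩ := hs'
        have h5 := Multiset.mem_singleton.1 (Multiset.mem_of_le h4 (Multiset.mem_map_of_mem _ hF))
        obtain ⟨y, rfl⟩ | ⟨p, rfl⟩ := hun
        · refine ⟨y, rfl, ?_⟩
          rintro rfl
          rw [hz] at h3
          cases h3.symm.trans h5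
        · cases h5
      obtain ⟨q, hq⟩ := Dv.attacker_b0 (Me := Me) hB hR₀
      refine Dv.attacker_of_forall_atomic (fun p hp => ?_) _
      have he : R'.concl.subst ⟨fun x => if x = z then p else q, .var⟩ = .attacker p := by
        simp [hz, HornFact.subst, Pattern.subst]
      rw [← he]
      refine Dv.clause (R₁ := {R ∈ B | sel.sel R = ∅}) ⟨hR', Set.not_nonempty_iff_eq_empty.1 hsel'⟩ _ (by rwa [he]) fun F hF => ?_
      obtain ⟨y, rfl, hy⟩ := huns F hF
      simpa [HornFact.subst, Pattern.subst, hy] using hq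

/-- The instances of clauses of a saturated set preserve derivability. -/
theorem Saturated.dv_concl {R₀ B : Set (Clause 𝒞.toConSig)} {Init : Finset Name}
    (hB : Saturated sel Fnot R₀ B) (hR₀ : attackerClauses 𝒞 Init ⊆ R₀)
    (hD : ∀ F ∈ Fnot, Derivable 𝒞 sel Fnot F {R ∈ B | sel.sel R = ∅} ∅)
    {R : Clause 𝒞.toConSig} (hR : R ∈ B) (σ : Subst 𝒞.toConSig)
    (h : ∀ F ∈ R.hyps, Dv {R ∈ B | sel.sel R = ∅} Me (F.subst σ)) :
    Dv {R ∈ B | sel.sel R = ∅} Me (R.concl.subst σ) := by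
  classical
  have hvar : ∀ x, .attacker (.var x) ∉ Fnot := fun x hx => (hD _ hx).ne_attacker_var x rfl
  have inv := hB.invertible (Me := Me) hR₀ hvar
  have hnot := not_dv_of_derivable inv hD
  generalize hw : wt {R ∈ B | sel.sel R = ∅} Me σ R.hyps = w
  generalize hk : (R.concl.subst σ).size = k
  -- Lexicographic induction on the weight of the hypotheses, then on the size of the instantiated
  -- conclusion. Simplification and subsumption increase neither component.
  induction w using Nat.strong_induction_on generalizing R σ k with | _ w ihw =>
  induction k using Nat.strong_induction_on generalizing R σ with | _ k ihk =>
  have key : ∀ R'' : Clause 𝒞.toConSig, Covered 𝒞 Fnot B R'' → ∀ δ : Subst 𝒞.toConSig,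
      (∀ F ∈ R''.hyps, Dv {R ∈ B | sel.sel R = ∅} Me (F.subst δ)) →
      (wt {R ∈ B | sel.sel R = ∅} Me δ R''.hyps < w ∨
        wt {R ∈ B | sel.sel R = ∅} Me δ R''.hyps = w ∧ (R''.concl.subst δ).size < k) →
      Dv {R ∈ B | sel.sel R = ∅} Me (R''.concl.subst δ) := by
    rintro R'' ⟨T, hT, hcov⟩ δ hδ hm
    refine Dv.of_simplify hT hnot hδ fun D hDT h1 h2 h3 => ?_
    obtain ⟨R', hR', hs⟩ := hcov D hDT
    obtain ⟨τ, h4, h5, h6⟩ := hs.dv h1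
    rw [← h4] at h3 ⊢
    by_cases hlt : wt {R ∈ B | sel.sel R = ∅} Me τ R'.hyps < w
    · exact ihw _ hlt hR' τ h5 rfl _ rfl
    · exact ihk _ (by omega) hR' τ h5 (by omega) rfl
  by_cases hsel : sel.sel R = ∅
  · by_cases hat : (R.concl.subst σ).Atomic 𝒞
    · exact Dv.clause (R₁ := {R ∈ B | sel.sel R = ∅}) ⟨hR, hsel⟩ σ hat h
    obtain ⟨f, hf, args, hc⟩ := HornFact.not_atomic hat
    rw [hc]
    -- Each component is obtained by resolving `R` into a clause that covers a projection: the
    -- weight stays the same and the conclusion shrinks.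
    refine Dv.data hf fun i => ?_
    obtain h' | ⟨R', hR', F₀, hF₀, τ, h1, h2, h3⟩ :=
      hB.exists_projection hR₀ hD hR hsel h hf hc i
    · exact h'
    · obtain ⟨R'', hres, hcov⟩ := hB.resolve R F₀ R'
        ⟨hR, hsel, hR', hF₀, sel.subset_hyps R' F₀ hF₀, σ, τ, h1⟩
      obtain ⟨δ, h4, h5, h6⟩ := hres.dv h1 h (by simp [h3])
      rw [← h2, ← h4]
      refine key R'' hcov δ h5 (.inr ⟨by rw [h6, h3, hw]; rfl, ?_⟩)
      rw [h4, h2, ← hk, hc]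
      exact Pattern.size_arg_lt args i
  · obtain ⟨F₀, hF₀⟩ := Set.nonempty_iff_ne_empty.2 hsel
    have hF₀R := sel.subset_hyps R F₀ hF₀
    -- The selected hypothesis is inverted and resolved away, so the weight drops. The size of the
    -- conclusion is irrelevant here.
    obtain ⟨R', ⟨hR', hsel'⟩, σ', he, h', hw'⟩ := inv _ (h F₀ hF₀R) (sel.ne_mevent hF₀ σ)
    obtain ⟨R'', hres, hcov⟩ := hB.resolve R' F₀ R ⟨hR', hsel', hR, hF₀, hF₀R, σ', σ, he⟩
    obtain ⟨δ, h4, h5, h6⟩ := hres.dv he h' fun F hF => h F (Multiset.mem_of_mem_erase hF)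
    rw [← h4]
    refine key R'' hcov δ h5 (.inl ?_)
    rw [h6, ← hw, wt_erase hF₀R]
    omega

/-- Since no clause concludes with a must-event, such a fact can only be an axiom of the derivation
system. -/
theorem Dv.mem_of_mevent (hR₁ : ∀ R ∈ R₁, ∀ p, R.concl ≠ .mevent p) {p : Pattern 𝒞.toConSig}
    (h : Dv R₁ Me (.mevent p)) : p ∈ Me := by
  obtain ⟨q, hq, he⟩ | ⟨R, hR, σ, he, -⟩ := h.atomic_inv (by simp [HornFact.Atomic])
  · cases he
    exact hq
  · have hne := hR₁ R hR
    generalize R.concl = F at he hne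
    cases F with
    | mevent q => exact absurd rfl (hne q)
    | _ => cases he

end ProVerif

/-! ### Derivations from the initial clauses; substitution in terms, processes and patterns -/

namespace ProVerif

variable {𝒞 : Calculus}

/-! ## Derivability from the initial clauses -/

/-- Derivability from instances of clauses of `R₀` and must-events of `Me`. -/
inductive Der (R₀ : Set (Clause 𝒞.toConSig)) (Me : Set (Pattern 𝒞.toConSig)) :
    HornFact 𝒞.toConSig → Prop
  | me (p) (hp : p ∈ Me) : Der R₀ Me (.mevent p)
  | clause (R) (hR : R ∈ R₀) (σ : Subst 𝒞.toConSig) (h : ∀ F ∈ R.hyps, Der R₀ Me (F.subst σ)) :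
      Der R₀ Me (R.concl.subst σ)

theorem Der.mono {R₀ : Set (Clause 𝒞.toConSig)} {Me Me' : Set (Pattern 𝒞.toConSig)}
    (hMe : Me ⊆ Me') {F : HornFact 𝒞.toConSig} (h : Der R₀ Me F) : Der R₀ Me' F := by
  induction h with
  | me p hp => exact .me p (hMe hp)
  | clause R hR σ _ ih => exact .clause R hR σ ih

theorem Der.clause' {R₀ : Set (Clause 𝒞.toConSig)} {Me : Set (Pattern 𝒞.toConSig)}
    {R : Clause 𝒞.toConSig} (hR : R ∈ R₀) (σ : Subst 𝒞.toConSig) {F : HornFact 𝒞.toConSig}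
    (hF : R.concl.subst σ = F) (h : ∀ G ∈ R.hyps, Der R₀ Me (G.subst σ)) : Der R₀ Me F :=
  hF ▸ .clause R hR σ h

/-- Each instance of `F` that is derivable from the initial clauses is an instance of the conclusion
of a clause in the result of the search, whose must-events are in `Me`. -/
theorem Saturate.exists_mem {sel : Selection 𝒞.toConSig} {Fnot : Set (HornFact 𝒞.toConSig)}
    {R₀ R₁ out : Set (Clause 𝒞.toConSig)} {Init : Finset Name} {F : HornFact 𝒞.toConSig}
    (hsat : Saturate 𝒞 sel Fnot R₀ R₁) (hatt : attackerClauses 𝒞 Init ⊆ R₀) (hme : NoMevent R₀)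
    (hD : ∀ F ∈ Fnot, Derivable 𝒞 sel Fnot F R₁ ∅) (hF : Derivable 𝒞 sel Fnot F R₁ out)
    {Me : Set (Pattern 𝒞.toConSig)} {σ : Subst 𝒞.toConSig} (h : Der R₀ Me (F.subst σ)) :
    ∃ R ∈ out, ∃ τ : Subst 𝒞.toConSig, R.concl.subst τ = F.subst σ ∧
      ∀ p, .mevent p ∈ R.hyps → p.subst τ ∈ Me := by
  obtain ⟨B, hB, rfl⟩ := hsat.saturated hme
  have hvar : ∀ x, .attacker (.var x) ∉ Fnot := fun x hx => (hD _ hx).ne_attacker_var x rfl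
  have inv := hB.invertible (Me := Me) hatt hvar
  have hnot := not_dv_of_derivable inv hD
  have hdv : ∀ G, Der R₀ Me G → Dv {R ∈ B | sel.sel R = ∅} Me G := by
    intro G hG
    induction hG with
    | me p hp => exact ⟨0, .me p hp⟩
    | clause R hR σ _ ih =>
      obtain ⟨T, hT, hcov⟩ := hB.covered R hR
      refine Dv.of_simplify hT hnot ih fun D hDT h1 _ _ => ?_
      obtain ⟨R', hR', hs⟩ := hcov D hDT
      obtain ⟨τ, h4, h5, -⟩ := hs.dv h1
      rw [← h4]
      exact hB.dv_concl hatt hD hR' τ h5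
  obtain ⟨R, hR, τ, h1, h2⟩ := hF.exists_mem inv σ (hdv _ h)
    fun F' hF' τ hτ => absurd hτ (hnot F' hF' τ)
  exact ⟨R, hR, τ, h1, fun p hp =>
    Dv.mem_of_mevent (fun R hR => hB.noMevent R hR.1) (h2 _ hp)⟩

theorem IProc.Translates.noMevent {n m s : ℕ} {P : IProc 𝒞 n m s} {ρ : Env 𝒞 n m s}
    {H : Multiset (HornFact 𝒞.toConSig)} {S : Set (Clause 𝒞.toConSig)} (h : P.Translates ρ H S) :
    NoMevent S := by
  induction P generalizing H S with
  | nil =>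
    obtain rfl : S = ∅ := h
    exact fun R hR => hR.elim
  | out M N P ih =>
    obtain ⟨S₁, h1, rfl⟩ := h
    rintro R (hR | rfl) p hp
    · exact ih h1 R hR p hp
    · cases hp
  | inp M P ih =>
    obtain ⟨x, -, h⟩ := h
    exact ih h
  | par P Q ihP ihQ =>
    obtain ⟨S₁, S₂, h1, h2, rfl⟩ := h
    rintro R (hR | hR)
    exacts [ihP h1 R hR, ihQ h2 R hR]
  | repl P ih =>
    obtain ⟨i, -, h⟩ := h
    exact ih h
  | res a t is P ih => exact ih h
  | dlet g args P Q ihP ihQ =>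
    obtain ⟨S₁, S₂, h1, h2, rfl⟩ := h
    rintro R (hR | hR)
    · simp only [Set.mem_iUnion] at hR
      obtain ⟨r, hr, hR⟩ := hR
      obtain ⟨σ, σ', -, h⟩ | ⟨-, h⟩ := h1 r hr
      · exact ihP h R hR
      · rw [h] at hR
        exact hR.elim
    · exact ihQ h2 R hR
  | ite M N P Q ihP ihQ =>
    obtain ⟨S₁, S₂, h1, h2, rfl⟩ := h
    rintro R (hR | hR)
    · obtain ⟨σ, -, h⟩ | ⟨-, rfl⟩ := h1
      · exact ihP h R hR
      · exact hR.elim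
    · exact ihQ h2 R hR
  | event M P ih =>
    obtain ⟨S₁, h1, rfl⟩ := h
    rintro R (hR | rfl) p hp
    · exact ih h1 R hR p hp
    · cases hp

theorem attackerClauses_noMevent (Init : Finset Name) : NoMevent (attackerClauses 𝒞 Init) := by
  rintro R ((((⟨a, -, rfl⟩ | rfl) | ⟨f, -, rfl⟩) | ⟨g, -, r, -, rfl⟩) | rfl | rfl) p hp <;> cases hp

/-! ## Substitution in terms and processes -/

theorem Term.bind_bind {S : ConSig} {V N V' N' V'' N'' : Type} (θ : V → Term S V' N')
    (ν : N → Term S V' N') (θ' : V' → Term S V'' N'') (ν' : N' → Term S V'' N'')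
    (M : Term S V N) :
    (M.bind θ ν).bind θ' ν' = M.bind (fun x => (θ x).bind θ' ν') (fun a => (ν a).bind θ' ν') := by
  induction M with
  | var => rfl
  | name => rfl
  | app f args ih => simp only [Term.bind, ih]

theorem Term.bind_id {S : ConSig} {V N : Type} (M : Term S V N) : M.bind .var .name = M := by
  induction M with
  | var => rfl
  | name => rfl
  | app f args ih => simp only [Term.bind, ih]

theorem PTerm.subst_subst {n m n' m' n'' m'' : ℕ} (θ : Fin n → PTerm 𝒞 n' m')
    (ν : Fin m → Name ⊕ Fin m') (θ' : Fin n' → PTerm 𝒞 n'' m'') (ν' : Fin m' → Name ⊕ Fin m'')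
    (M : PTerm 𝒞 n m) :
    (M.subst θ ν).subst θ' ν' =
      M.subst (fun x => (θ x).subst θ' ν') (fun b => Sum.elim .inl ν' (ν b)) := by
  rw [PTerm.subst, PTerm.subst, Term.bind_bind]
  refine congrArg (fun g => Term.bind _ g M) (funext fun a => ?_)
  rcases a with a | b
  · rfl
  · rcases h : ν b with c | c <;> simp [h, Term.bind]

theorem PTerm.subst_id {n m : ℕ} (M : PTerm 𝒞 n m) : M.subst .var .inr = M := by
  conv_rhs => rw [← Term.bind_id M]
  refine congrArg (fun g => Term.bind _ g M) (funext fun a => ?_)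
  rcases a with a | b <;> rfl

theorem CTerm.subst_eq (M : CTerm 𝒞) (θ : Fin 0 → CTerm 𝒞) (ν : Fin 0 → Name ⊕ Fin 0) :
    M.subst θ ν = M := by
  conv_rhs => rw [← PTerm.subst_id M]
  rw [Subsingleton.elim θ .var, Subsingleton.elim ν .inr]

theorem liftVar_subst {n n' m' n'' m'' : ℕ} (θ : Fin n → PTerm 𝒞 n' m')
    (θ' : Fin n' → PTerm 𝒞 n'' m'') (ν' : Fin m' → Name ⊕ Fin m'') :
    (fun x => (liftVar θ x).subst (liftVar θ') ν') = liftVar fun x => (θ x).subst θ' ν' := by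
  funext x
  refine Fin.cases rfl (fun i => ?_) x
  simp only [liftVar, Fin.cons_succ, PTerm.subst_subst]
  refine congrArg (fun g => PTerm.subst _ g (θ i)) (funext fun b => ?_)
  change ν' b = _
  cases ν' b <;> rfl

theorem weakenName_subst {n n' m' n'' m'' : ℕ} (θ : Fin n → PTerm 𝒞 n' m')
    (θ' : Fin n' → PTerm 𝒞 n'' m'') (ν' : Fin m' → Name ⊕ Fin m'') :
    (fun x => (weakenName θ x).subst (weakenName θ') (liftName ν')) =
      weakenName fun x => (θ x).subst θ' ν' := by
  funext x
  simp only [weakenName, PTerm.subst_subst]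
  refine congrArg (fun g => PTerm.subst _ g (θ x)) (funext fun b => ?_)
  simp only [Sum.elim_inr, liftName, Fin.cons_succ]
  cases ν' b <;> rfl

theorem liftName_subst {m m' m'' : ℕ} (ν : Fin m → Name ⊕ Fin m') (ν' : Fin m' → Name ⊕ Fin m'') :
    (fun b => Sum.elim .inl (liftName ν') (liftName ν b)) =
      liftName fun b => Sum.elim .inl ν' (ν b) := by
  funext b
  refine Fin.cases rfl (fun i => ?_) b
  simp only [liftName, Fin.cons_succ]
  cases ν i <;> rfl

theorem Proc.subst_subst {n m n' m' n'' m'' : ℕ} (P : Proc 𝒞 n m) (θ : Fin n → PTerm 𝒞 n' m')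
    (ν : Fin m → Name ⊕ Fin m') (θ' : Fin n' → PTerm 𝒞 n'' m'') (ν' : Fin m' → Name ⊕ Fin m'') :
    (P.subst θ ν).subst θ' ν' =
      P.subst (fun x => (θ x).subst θ' ν') (fun b => Sum.elim .inl ν' (ν b)) := by
  induction P generalizing n' m' n'' m'' with
  | nil => rfl
  | out M N P ih => simp only [Proc.subst, PTerm.subst_subst, ih]
  | inp M P ih => simp only [Proc.subst, PTerm.subst_subst, ih, liftVar_subst]
  | par P Q ihP ihQ => simp only [Proc.subst, ihP, ihQ]
  | repl P ih => simp only [Proc.subst, ih]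
  | res P ih => simp only [Proc.subst, ih, weakenName_subst, liftName_subst]
  | dlet g args P Q ihP ihQ =>
    simp only [Proc.subst, PTerm.subst_subst, ihP, ihQ, liftVar_subst]
  | ite M N P Q ihP ihQ => simp only [Proc.subst, PTerm.subst_subst, ihP, ihQ]
  | event M P ih => simp only [Proc.subst, PTerm.subst_subst, ih]

theorem Proc.subst_id {n m : ℕ} (P : Proc 𝒞 n m) : P.subst .var .inr = P := by
  have hv : ∀ n m : ℕ, liftVar (.var : Fin n → PTerm 𝒞 n m) = .var := by
    intro n m
    funext x
    refine Fin.cases rfl (fun i => rfl) x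
  have hw : ∀ n m : ℕ, weakenName (.var : Fin n → PTerm 𝒞 n m) = .var := fun n m => rfl
  have hn : ∀ m : ℕ, liftName (.inr : Fin m → Name ⊕ Fin m) = .inr := by
    intro m
    funext x
    refine Fin.cases rfl (fun i => rfl) x
  induction P with
  | nil => rfl
  | out M N P ih => simp only [Proc.subst, PTerm.subst_id, ih]
  | inp M P ih => simp only [Proc.subst, PTerm.subst_id, ih, hv]
  | par P Q ihP ihQ => simp only [Proc.subst, ihP, ihQ]
  | repl P ih => simp only [Proc.subst, ih]
  | res P ih => simp only [Proc.subst, hw, hn, ih]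
  | dlet g args P Q ihP ihQ => simp only [Proc.subst, PTerm.subst_id, ihP, ihQ, hv]
  | ite M N P Q ihP ihQ => simp only [Proc.subst, PTerm.subst_id, ihP, ihQ]
  | event M P ih => simp only [Proc.subst, PTerm.subst_id, ih]

theorem CProc.subst_eq (P : CProc 𝒞) (θ : Fin 0 → CTerm 𝒞) (ν : Fin 0 → Name ⊕ Fin 0) :
    P.subst θ ν = P := by
  conv_rhs => rw [← Proc.subst_id P]
  rw [Subsingleton.elim θ .var, Subsingleton.elim ν .inr]

/-- Passing a binder extends the closing substitution instead of changing the body. A running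
process thus keeps the form of a source subprocess closed by `θ` and `ν`. `Proc.instName_subst` does
the same for restrictions. -/
theorem Proc.instVar_subst {n m : ℕ} (P : Proc 𝒞 (n + 1) m) (θ : Fin n → CTerm 𝒞)
    (ν : Fin m → Name ⊕ Fin 0) (M : CTerm 𝒞) :
    (P.subst (liftVar θ) ν).instVar M = P.subst (Fin.cons M θ) ν := by
  rw [Proc.instVar, Proc.subst_subst]
  congr 1
  · funext x
    refine Fin.cases rfl (fun i => ?_) x
    simp only [liftVar, Fin.cons_succ, PTerm.subst_subst]
    exact CTerm.subst_eq _ _ _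
  · funext b
    rcases ν b with a | c
    · rfl
    · exact c.elim0

theorem Proc.instName_subst {n m : ℕ} (P : Proc 𝒞 n (m + 1)) (θ : Fin n → CTerm 𝒞)
    (ν : Fin m → Name ⊕ Fin 0) (a : Name) :
    (P.subst (weakenName θ) (liftName ν)).instName a = P.subst θ (Fin.cons (.inl a) ν) := by
  rw [Proc.instName, Proc.subst_subst]
  congr 1
  · funext x
    simp only [weakenName, PTerm.subst_subst]
    exact CTerm.subst_eq _ _ _
  · funext b
    refine Fin.cases rfl (fun i => ?_) b
    simp only [liftName, Fin.cons_succ]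
    rcases ν i with a | c
    · rfl
    · exact c.elim0

/-! ## Names of terms -/

theorem Term.mem_names_bind {S : ConSig} {V N V' N' : Type} (θ : V → Term S V' N')
    (ν : N → Term S V' N') (M : Term S V N) (a : N') :
    a ∈ (M.bind θ ν).names ↔ (∃ x ∈ M.vars, a ∈ (θ x).names) ∨ ∃ b ∈ M.names, a ∈ (ν b).names := by
  induction M with
  | var => simp [Term.bind, Term.vars, Term.names]
  | name => simp [Term.bind, Term.vars, Term.names]
  | app f args ih =>
    simp only [Term.bind, Term.vars, Term.names, Set.mem_iUnion, ih]
    constructor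
    · rintro ⟨i, ⟨x, hx, h⟩ | ⟨b, hb, h⟩⟩
      exacts [.inl ⟨x, ⟨i, hx⟩, h⟩, .inr ⟨b, ⟨i, hb⟩, h⟩]
    · rintro (⟨x, ⟨i, hx⟩, h⟩ | ⟨b, ⟨i, hb⟩, h⟩)
      exacts [⟨i, .inl ⟨x, hx, h⟩⟩, ⟨i, .inr ⟨b, hb, h⟩⟩]

theorem PTerm.fn_subst_subset {n m n' m' : ℕ} {θ : Fin n → PTerm 𝒞 n' m'}
    {ν : Fin m → Name ⊕ Fin m'} {M : PTerm 𝒞 n m} {E : Set Name} (hM : M.fn ⊆ E)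
    (hθ : ∀ x, (θ x).fn ⊆ E) (hν : ∀ b a, ν b = .inl a → a ∈ E) : (M.subst θ ν).fn ⊆ E := by
  intro a ha
  obtain ⟨x, -, h⟩ | ⟨b | b, hb, h⟩ := (Term.mem_names_bind _ _ _ _).1 ha
  · exact hθ x h
  · obtain rfl : a = b := by simpa [Term.names] using h
    exact hM hb
  · exact hν b a (by simpa [Term.names, eq_comm] using h)

/-! ## Patterns of closed terms -/

/-- The pattern of a name. -/
def encName (lam : Name → Pattern 𝒞.toConSig) : Name ⊕ Fin 0 → Pattern 𝒞.toConSig :=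
  Sum.elim lam Fin.elim0

/-- The pattern of a closed term, given the patterns of names. -/
def encTerm (lam : Name → Pattern 𝒞.toConSig) (M : CTerm 𝒞) : Pattern 𝒞.toConSig :=
  Term.toPattern Fin.elim0 (encName lam) M

theorem Term.toPattern_bind {S : ConSig} {V N V' N' : Type} (θ : V → Term S V' N')
    (ν : N → Term S V' N') (ρ : V' → Pattern S) (μ : N' → Pattern S) (M : Term S V N) :
    (M.bind θ ν).toPattern ρ μ =
      M.toPattern (fun x => (θ x).toPattern ρ μ) (fun a => (ν a).toPattern ρ μ) := by
  induction M with
  | var => rfl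
  | name => rfl
  | app f args ih => simp only [Term.bind, Term.toPattern, ih]

theorem Term.toPattern_subst {S : ConSig} {V N : Type} (ρ : V → Pattern S) (μ : N → Pattern S)
    (δ : Subst S) (M : Term S V N) :
    (M.toPattern ρ μ).subst δ =
      M.toPattern (fun x => (ρ x).subst δ) (fun a => (μ a).subst δ) := by
  induction M with
  | var => rfl
  | name => rfl
  | app f args ih => simp only [Pattern.subst, Term.toPattern, ih]

theorem Term.toPattern_congr {S : ConSig} {V N : Type} {ρ ρ' : V → Pattern S}
    {μ μ' : N → Pattern S} {M : Term S V N} (hρ : ∀ x ∈ M.vars, ρ x = ρ' x)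
    (hμ : ∀ a ∈ M.names, μ a = μ' a) : M.toPattern ρ μ = M.toPattern ρ' μ' := by
  induction M with
  | var x => exact hρ x rfl
  | name a => exact hμ a rfl
  | app f args ih =>
    simp only [Term.toPattern]
    congr 1
    funext i
    exact ih i (fun x hx => hρ x (Set.mem_iUnion.2 ⟨i, hx⟩))
      fun a ha => hμ a (Set.mem_iUnion.2 ⟨i, ha⟩)

theorem freeName_subst {S : ConSig} (a : Name) (δ : Subst S) :
    (freeName a : Pattern S).subst δ = freeName a := by
  simp only [freeName, Pattern.subst, List.map_nil]
  congr 1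
  exact Subsingleton.elim _ _

theorem encTerm_congr {lam lam' : Name → Pattern 𝒞.toConSig} {M : CTerm 𝒞}
    (h : ∀ a ∈ M.fn, lam a = lam' a) : encTerm lam M = encTerm lam' M := by
  refine Term.toPattern_congr (fun x _ => x.elim0) fun a ha => ?_
  rcases a with a | b
  · exact h a ha
  · exact b.elim0

theorem encTerm_subst {n m : ℕ} (lam : Name → Pattern 𝒞.toConSig) (θ : Fin n → CTerm 𝒞)
    (ν : Fin m → Name ⊕ Fin 0) (M : PTerm 𝒞 n m) :
    encTerm lam (M.subst θ ν) =
      M.toPattern (fun x => encTerm lam (θ x)) (Sum.elim lam fun b => encName lam (ν b)) := by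
  rw [encTerm, PTerm.subst, Term.toPattern_bind]
  refine congrArg (fun g => Term.toPattern _ g M) (funext fun a => ?_)
  rcases a with a | b <;> rfl

theorem encTerm_bind {n : ℕ} (lam : Name → Pattern 𝒞.toConSig) (θ : Fin n → CTerm 𝒞)
    (M : Term 𝒞.toConSig (Fin n) Empty) :
    encTerm lam (M.bind θ Empty.elim) =
      M.toPattern (fun x => encTerm lam (θ x)) Empty.elim := by
  rw [encTerm, Term.toPattern_bind]
  exact congrArg (fun g => Term.toPattern _ g M) (funext fun a => a.elim)

end ProVerif

/-! ### Running instances of the protocol and the clauses that describe them -/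

namespace ProVerif

variable {𝒞 : Calculus}

/-! ## Fresh variables -/

theorem SessId.subst_congr {S : ConSig} {σ τ : Subst S} {i : SessId}
    (h : ∀ k, i = .var k → σ.sess k = τ.sess k) : i.subst σ = i.subst τ := by
  cases i with
  | var k => exact h k rfl
  | const c => rfl

theorem Pattern.subst_congr {S : ConSig} {σ τ : Subst S} {p : Pattern S}
    (h : ∀ x ∈ p.vars, σ.ord x = τ.ord x) (h' : ∀ i ∈ p.sessVars, σ.sess i = τ.sess i) :
    p.subst σ = p.subst τ := by
  induction p with
  | var x => exact h x rfl
  | name a k args sess ih =>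
    simp only [Pattern.subst]
    congr 1
    · funext i
      exact ih i (fun x hx => h x (Set.mem_iUnion.2 ⟨i, hx⟩))
        fun j hj => h' j (.inl (Set.mem_iUnion.2 ⟨i, hj⟩))
    · exact List.map_congr_left fun i hi => SessId.subst_congr fun k hk => h' k (.inr (by subst hk; exact hi))
  | app f args ih =>
    simp only [Pattern.subst]
    congr 1
    funext i
    exact ih i (fun x hx => h x (Set.mem_iUnion.2 ⟨i, hx⟩))
      fun j hj => h' j (Set.mem_iUnion.2 ⟨i, hj⟩)

/-- The substitution with another value for an ordinary variable. -/
def Subst.setOrd {S : ConSig} (σ : Subst S) (x : ℕ) (p : Pattern S) : Subst S :=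
  ⟨Function.update σ.ord x p, σ.sess⟩

/-- The substitution with another value for a session variable. -/
def Subst.setSess {S : ConSig} (σ : Subst S) (i : ℕ) (j : SessId) : Subst S :=
  ⟨σ.ord, Function.update σ.sess i j⟩

theorem Pattern.subst_setOrd {S : ConSig} {σ : Subst S} {x : ℕ} {p q : Pattern S}
    (h : x ∉ q.vars) : q.subst (σ.setOrd x p) = q.subst σ :=
  Pattern.subst_congr (fun y hy => Function.update_of_ne (by rintro rfl; exact h hy) _ _) fun _ _ => rfl

theorem Pattern.subst_setSess {S : ConSig} {σ : Subst S} {i : ℕ} {j : SessId} {q : Pattern S}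
    (h : i ∉ q.sessVars) : q.subst (σ.setSess i j) = q.subst σ :=
  Pattern.subst_congr (fun _ _ => rfl) fun k hk =>
    Function.update_of_ne (by rintro rfl; exact h hk) _ _

theorem SessId.subst_setSess {S : ConSig} {σ : Subst S} {i : ℕ} {j k : SessId}
    (h : k ≠ .var i) : k.subst (σ.setSess i j) = k.subst σ :=
  SessId.subst_congr fun _ hl => Function.update_of_ne (by rintro rfl; exact h hl) _ _

theorem HornFact.subst_setOrd {S : ConSig} {σ : Subst S} {x : ℕ} {p : Pattern S} {F : HornFact S}
    (h : x ∉ F.vars) : F.subst (σ.setOrd x p) = F.subst σ := by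
  cases F with
  | message q q' =>
    simp only [HornFact.vars, Set.mem_union, not_or] at h
    simp only [HornFact.subst, Pattern.subst_setOrd h.1, Pattern.subst_setOrd h.2]
  | _ q => simp only [HornFact.subst, Pattern.subst_setOrd (q := q) h]

theorem HornFact.subst_setSess {S : ConSig} {σ : Subst S} {i : ℕ} {j : SessId} {F : HornFact S}
    (h : i ∉ F.sessVars) : F.subst (σ.setSess i j) = F.subst σ := by
  cases F with
  | message q q' =>
    simp only [HornFact.sessVars, Set.mem_union, not_or] at h
    simp only [HornFact.subst, Pattern.subst_setSess h.1, Pattern.subst_setSess h.2]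
  | _ q => simp only [HornFact.subst, Pattern.subst_setSess (q := q) h]

/-! ## Subprocesses of the protocol -/

/-- The instance of `ρ` by `δ` gives the patterns of the terms `θ` and of the names `ν`, whose names
are in `E`. -/
structure Represents (E : Set Name) (lam : Name → Pattern 𝒞.toConSig) {n m s : ℕ} (ρ : Env 𝒞 n m s)
    (δ : Subst 𝒞.toConSig) (θ : Fin n → CTerm 𝒞) (ν : Fin m → Name ⊕ Fin 0) : Prop where
  var : ∀ x, (ρ.var x).subst δ = encTerm lam (θ x)
  nam : ∀ b, (ρ.nam b).subst δ = encName lam (ν b)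
  fn_subset : ∀ x, (θ x).fn ⊆ E
  name_mem : ∀ b a, ν b = .inl a → a ∈ E

/-- The names `E`, their patterns, and the patterns of the events. -/
structure State (𝒞 : Calculus) where
  E : Set Name
  lam : Name → Pattern 𝒞.toConSig
  Me : Set (Pattern 𝒞.toConSig)

/-- A later state. -/
structure State.Le (s s' : State 𝒞) : Prop where
  E : s.E ⊆ s'.E
  lam : ∀ a ∈ s.E, s'.lam a = s.lam a
  Me : s.Me ⊆ s'.Me

theorem encName_congr {s s' : State 𝒞} (h : s.Le s') {c : Name ⊕ Fin 0}
    (hc : ∀ a, c = .inl a → a ∈ s.E) : encName s'.lam c = encName s.lam c := by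
  rcases c with a | b
  · exact h.lam a (hc a rfl)
  · exact b.elim0

theorem encTerm_le {s s' : State 𝒞} (h : s.Le s') {M : CTerm 𝒞} (hM : M.fn ⊆ s.E) :
    encTerm s'.lam M = encTerm s.lam M :=
  encTerm_congr fun a ha => h.lam a (hM ha)

theorem Represents.mono {st st' : State 𝒞} (h : st.Le st') {n m s : ℕ} {ρ : Env 𝒞 n m s}
    {δ : Subst 𝒞.toConSig} {θ : Fin n → CTerm 𝒞} {ν : Fin m → Name ⊕ Fin 0}
    (hr : Represents st.E st.lam ρ δ θ ν) : Represents st'.E st'.lam ρ δ θ ν where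
  var x := by rw [hr.var, encTerm_le h (hr.fn_subset x)]
  nam b := by rw [hr.nam, encName_congr h (hr.name_mem b)]
  fn_subset x := (hr.fn_subset x).trans h.E
  name_mem b a hb := h.E (hr.name_mem b a hb)

theorem Represents.enc {E : Set Name} {lam : Name → Pattern 𝒞.toConSig} {n m s : ℕ}
    {ρ : Env 𝒞 n m s} {δ : Subst 𝒞.toConSig} {θ : Fin n → CTerm 𝒞} {ν : Fin m → Name ⊕ Fin 0}
    (hr : Represents E lam ρ δ θ ν) {M : PTerm 𝒞 n m} (hM : ∀ a ∈ M.fn, lam a = freeName a) :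
    (ρ.enc M).subst δ = encTerm lam (M.subst θ ν) := by
  rw [Env.enc, Term.toPattern_subst, encTerm_subst]
  refine Term.toPattern_congr (fun x _ => hr.var x) fun a ha => ?_
  rcases a with a | b
  · simp only [Sum.elim_inl, freeName_subst, hM a ha]
  · exact hr.nam b

/-- Moves from an environment to its image under a most general unifier, with the factor `δ'` as new
instance. -/
theorem Represents.of_factorsOn {E : Set Name} {lam : Name → Pattern 𝒞.toConSig} {n m s : ℕ}
    {ρ ρ' : Env 𝒞 n m s} {δ δ' : Subst 𝒞.toConSig} {θ : Fin n → CTerm 𝒞}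
    {ν : Fin m → Name ⊕ Fin 0} (hr : Represents E lam ρ δ θ ν) (h : ρ.subst δ = ρ'.subst δ') :
    Represents E lam ρ' δ' θ ν where
  var x := by rw [← hr.var]; exact (congrFun (congrArg Env.var h) x).symm
  nam b := by rw [← hr.nam]; exact (congrFun (congrArg Env.nam h) b).symm
  fn_subset := hr.fn_subset
  name_mem := hr.name_mem

theorem Represents.consVar {E : Set Name} {lam : Name → Pattern 𝒞.toConSig} {n m s : ℕ}
    {ρ : Env 𝒞 n m s} {δ : Subst 𝒞.toConSig} {θ : Fin n → CTerm 𝒞} {ν : Fin m → Name ⊕ Fin 0}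
    (hr : Represents E lam ρ δ θ ν) {p : Pattern 𝒞.toConSig} {M : CTerm 𝒞}
    (hp : p.subst δ = encTerm lam M) (hM : M.fn ⊆ E) :
    Represents E lam (ρ.consVar p) δ (Fin.cons M θ) ν where
  var x := Fin.cases hp hr.var x
  nam := hr.nam
  fn_subset x := Fin.cases hM hr.fn_subset x
  name_mem := hr.name_mem

theorem Represents.consNam {E : Set Name} {lam : Name → Pattern 𝒞.toConSig} {n m s : ℕ}
    {ρ : Env 𝒞 n m s} {δ : Subst 𝒞.toConSig} {θ : Fin n → CTerm 𝒞} {ν : Fin m → Name ⊕ Fin 0}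
    (hr : Represents E lam ρ δ θ ν) {p : Pattern 𝒞.toConSig} {a : Name}
    (hp : p.subst δ = lam a) (ha : a ∈ E) :
    Represents E lam (ρ.consNam p) δ θ (Fin.cons (.inl a) ν) where
  var := hr.var
  nam b := Fin.cases hp hr.nam b
  fn_subset := hr.fn_subset
  name_mem b := by
    refine Fin.cases ?_ hr.name_mem b
    intro c hc
    obtain rfl : a = c := by simpa using hc
    exact ha

/-- A position in the syntax tree with the session identifiers of the replications above it. -/
abbrev Addr : Type := List Bool × List SessId

/-- The process is an instance of the subprocess of the protocol at the address. -/
inductive Desc (R₀ : Set (Clause 𝒞.toConSig)) (E₀ : Set Name) (st : State 𝒞) :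
    Addr → CProc 𝒞 → Prop
  | mk {n m s : ℕ} (t : List (Fin n)) (is : List (Fin s)) (pos : List Bool) (P : Proc 𝒞 n m)
      (θ : Fin n → CTerm 𝒞) (ν : Fin m → Name ⊕ Fin 0) (ρ : Env 𝒞 n m s)
      (H : Multiset (HornFact 𝒞.toConSig)) (S : Set (Clause 𝒞.toConSig)) (δ : Subst 𝒞.toConSig)
      (hT : (P.instrAux s t is pos).Translates ρ H S) (hS : S ⊆ R₀)
      (hr : Represents st.E st.lam ρ δ θ ν) (hH : ∀ F ∈ H, Der R₀ st.Me (F.subst δ))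
      (hP : P.fn ⊆ E₀) :
      Desc R₀ E₀ st (pos, is.map fun k => (ρ.sess k).subst δ) (P.subst θ ν)

theorem Desc.mono {R₀ : Set (Clause 𝒞.toConSig)} {E₀ : Set Name} {st st' : State 𝒞}
    (h : st.Le st') {a : Addr} {X : CProc 𝒞} (hX : Desc R₀ E₀ st a X) : Desc R₀ E₀ st' a X := by
  obtain ⟨t, is, pos, P, θ, ν, ρ, H, S, δ, hT, hS, hr, hH, hP⟩ := hX
  exact .mk t is pos P θ ν ρ H S δ hT hS (hr.mono h) (fun F hF => (hH F hF).mono h.Me) hP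

/-- The names of `E₀` are the free names. -/
structure State.Init (E₀ : Set Name) (st : State 𝒞) : Prop where
  subset : E₀ ⊆ st.E
  lam : ∀ a ∈ E₀, st.lam a = freeName a

section Desc

variable {R₀ : Set (Clause 𝒞.toConSig)} {E₀ : Set Name} {st : State 𝒞} {a : Addr}

theorem Represents.enc_of_init {n m s : ℕ} {ρ : Env 𝒞 n m s} {δ : Subst 𝒞.toConSig}
    {θ : Fin n → CTerm 𝒞} {ν : Fin m → Name ⊕ Fin 0} (hr : Represents st.E st.lam ρ δ θ ν)
    (hst : st.Init E₀) {M : PTerm 𝒞 n m} (hM : M.fn ⊆ E₀) :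
    (ρ.enc M).subst δ = encTerm st.lam (M.subst θ ν) ∧ (M.subst θ ν).fn ⊆ st.E :=
  ⟨hr.enc fun a ha => hst.lam a (hM ha),
    PTerm.fn_subst_subset (hM.trans hst.subset) hr.fn_subset hr.name_mem⟩

theorem Desc.par {P Q : CProc 𝒞} (h : Desc R₀ E₀ st a (.par P Q)) :
    Desc R₀ E₀ st (false :: a.1, a.2) P ∧ Desc R₀ E₀ st (true :: a.1, a.2) Q := by
  generalize hX : Proc.par P Q = X at h
  obtain ⟨t, is, pos, P', θ, ν, ρ, H, S, δ, hT, hS, hr, hH, hP⟩ := h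
  cases P' with
  | par P₁ P₂ =>
    cases hX
    obtain ⟨S₁, S₂, h1, h2, rfl⟩ := hT
    exact ⟨.mk t is _ P₁ θ ν ρ H S₁ δ h1 (Set.subset_union_left.trans hS) hr hH
        (Set.subset_union_left.trans hP),
      .mk t is _ P₂ θ ν ρ H S₂ δ h2 (Set.subset_union_right.trans hS) hr hH
        (Set.subset_union_right.trans hP)⟩
  | _ => cases hX

/-- The session variable is fresh for `ρ` and `H`, so it can be sent to any constant without
disturbing them. The invariant later supplies an unused one. -/
theorem Desc.repl {P : CProc 𝒞} (h : Desc R₀ E₀ st a (.repl P)) (c : ℕ) :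
    Desc R₀ E₀ st (false :: a.1, a.2 ++ [.const c]) P := by
  generalize hX : Proc.repl P = X at h
  obtain ⟨t, is, pos, P', θ, ν, ρ, H, S, δ, hT, hS, hr, hH, hP⟩ := h
  cases P' with
  | repl P₁ =>
    cases hX
    obtain ⟨i, ⟨hi1, hi2, hi3, hi4⟩, h1⟩ := hT
    have := Desc.mk (st := st) (E₀ := E₀) t _ _ P₁ θ ν (ρ.consSess (.var i)) H S
      (δ.setSess i (.const c)) h1 hS
      ⟨fun x => (Pattern.subst_setSess (hi1 x)).trans (hr.var x),
        fun b => (Pattern.subst_setSess (hi2 b)).trans (hr.nam b), hr.fn_subset, hr.name_mem⟩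
      (fun F hF => by rw [HornFact.subst_setSess (hi4 F hF)]; exact hH F hF) hP
    convert this using 2
    simp only [List.map_append, List.map_map, List.map_cons, List.map_nil, Function.comp_def,
      Env.consSess, Fin.cons_succ, Fin.cons_zero]
    congr 1
    · exact List.map_congr_left fun k _ => (SessId.subst_setSess (hi3 k)).symm
    · simp [SessId.subst, Subst.setSess]
  | _ => cases hX

theorem Desc.out {M N : CTerm 𝒞} {P : CProc 𝒞} (hst : st.Init E₀)
    (h : Desc R₀ E₀ st a (.out M N P)) :
    Desc R₀ E₀ st (false :: a.1, a.2) P ∧ M.fn ⊆ st.E ∧ N.fn ⊆ st.E ∧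
      Der R₀ st.Me (.message (encTerm st.lam M) (encTerm st.lam N)) := by
  generalize hX : Proc.out M N P = X at h
  obtain ⟨t, is, pos, P', θ, ν, ρ, H, S, δ, hT, hS, hr, hH, hP⟩ := h
  cases P' with
  | out M' N' P₁ =>
    cases hX
    obtain ⟨S₁, h1, rfl⟩ := hT
    obtain ⟨hM, hMfn⟩ := hr.enc_of_init hst (M := M')
      (fun x hx => hP (.inl (.inl hx)))
    obtain ⟨hN, hNfn⟩ := hr.enc_of_init hst (M := N')
      (fun x hx => hP (.inl (.inr hx)))
    refine ⟨.mk t is _ P₁ θ ν ρ H S₁ δ h1 (Set.subset_union_left.trans hS) hr hH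
        (Set.subset_union_right.trans hP), hMfn, hNfn, Der.clause' (hS (.inr rfl)) δ ?_ hH⟩
    simp only [HornFact.subst, hM, hN]
  | _ => cases hX

/-- The continuation is translated under an additional must-event hypothesis, discharged by
membership in `st.Me`. The may-event fact is derived from the earlier hypotheses alone. -/
theorem Desc.event {M : CTerm 𝒞} {P : CProc 𝒞} (hst : st.Init E₀)
    (h : Desc R₀ E₀ st a (.event M P)) :
    (encTerm st.lam M ∈ st.Me → Desc R₀ E₀ st (false :: a.1, a.2) P) ∧ M.fn ⊆ st.E ∧
      Der R₀ st.Me (.event (encTerm st.lam M)) := by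
  generalize hX : Proc.event M P = X at h
  obtain ⟨t, is, pos, P', θ, ν, ρ, H, S, δ, hT, hS, hr, hH, hP⟩ := h
  cases P' with
  | event M' P₁ =>
    cases hX
    obtain ⟨S₁, h1, rfl⟩ := hT
    obtain ⟨hM, hMfn⟩ := hr.enc_of_init hst (M := M') (fun x hx => hP (.inl hx))
    refine ⟨fun hMe => .mk t is _ P₁ θ ν ρ _ S₁ δ h1 (Set.subset_union_left.trans hS) hr ?_
        (Set.subset_union_right.trans hP), hMfn, Der.clause' (hS (.inr rfl)) δ ?_ hH⟩
    · intro F hF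
      obtain hF | hF := Multiset.mem_add.1 hF
      · exact hH F hF
      · rw [Multiset.mem_singleton.1 hF, HornFact.subst, hM]
        exact .me _ hMe
    · simp only [HornFact.subst, hM]
  | _ => cases hX

/-- The fresh variable of the translation is sent to the pattern of the received term, and the new
message hypothesis becomes the derivable fact `hm`. -/
theorem Desc.inp {M N : CTerm 𝒞} {P : Proc 𝒞 (0 + 1) 0} (hst : st.Init E₀)
    (h : Desc R₀ E₀ st a (.inp M P)) (hN : N.fn ⊆ st.E)
    (hm : Der R₀ st.Me (.message (encTerm st.lam M) (encTerm st.lam N))) :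
    Desc R₀ E₀ st (false :: a.1, a.2) (P.instVar N) := by
  generalize hX : Proc.inp M P = X at h
  obtain ⟨t, is, pos, P', θ, ν, ρ, H, S, δ, hT, hS, hr, hH, hP⟩ := h
  cases P' with
  | inp M' P₁ =>
    cases hX
    obtain ⟨x, ⟨hx1, hx2, hx3⟩, h1⟩ := hT
    have hr' : Represents st.E st.lam ρ (δ.setOrd x (encTerm st.lam N)) θ ν :=
      ⟨fun y => (Pattern.subst_setOrd (hx1 y)).trans (hr.var y),
        fun b => (Pattern.subst_setOrd (hx2 b)).trans (hr.nam b), hr.fn_subset, hr.name_mem⟩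
    obtain ⟨hM, -⟩ := hr'.enc_of_init hst (M := M') (fun x hx => hP (.inl hx))
    have hx : (Pattern.var x).subst (δ.setOrd x (encTerm st.lam N)) = encTerm st.lam N := by
      simp [Pattern.subst, Subst.setOrd]
    rw [Proc.instVar_subst]
    have := Desc.mk (E₀ := E₀) (st := st) _ is _ P₁ (Fin.cons N θ) ν (ρ.consVar (.var x)) _ S _ h1
      hS (hr'.consVar hx hN) (fun F hF => by
        obtain hF | hF := Multiset.mem_add.1 hF
        · rw [HornFact.subst_setOrd (hx3 F hF)]
          exact hH F hF
        · rw [Multiset.mem_singleton.1 hF, HornFact.subst, hM, hx]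
          exact hm) (Set.subset_union_right.trans hP)
    convert this using 2
    exact List.map_congr_left fun k _ => SessId.subst_congr fun _ _ => rfl
  | _ => cases hX

/-- Equal terms have equal patterns, so `δ` is a unifier and factors through the most general one.
The else branch is translated with no condition, so it is always described, whatever the outcome of
the test. -/
theorem Desc.ite {M N : CTerm 𝒞} {P Q : CProc 𝒞} (hst : st.Init E₀)
    (h : Desc R₀ E₀ st a (.ite M N P Q)) :
    (M = N → Desc R₀ E₀ st (false :: a.1, a.2) P) ∧ Desc R₀ E₀ st (true :: a.1, a.2) Q := by
  generalize hX : Proc.ite M N P Q = X at h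
  obtain ⟨t, is, pos, P', θ, ν, ρ, H, S, δ, hT, hS, hr, hH, hP⟩ := h
  cases P' with
  | ite M' N' P₁ P₂ =>
    cases hX
    obtain ⟨S₁, S₂, h1, h2, rfl⟩ := hT
    refine ⟨fun he => ?_, .mk t is _ P₂ θ ν ρ H S₂ δ h2 (Set.subset_union_right.trans hS) hr hH
        (Set.subset_union_right.trans hP)⟩
    obtain ⟨hM, -⟩ := hr.enc_of_init hst (M := M') (fun x hx => hP (.inl (.inl (.inl hx))))
    obtain ⟨hN, -⟩ := hr.enc_of_init hst (M := N') (fun x hx => hP (.inl (.inl (.inr hx))))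
    have hu : (ρ.enc M').subst δ = (ρ.enc N').subst δ := by rw [hM, hN, he]
    obtain ⟨σ, ⟨-, hmgu⟩, h1⟩ | ⟨hne, -⟩ := h1
    · obtain ⟨δ', hδ, hδ'⟩ := hmgu δ hu
      have := Desc.mk (E₀ := E₀) (st := st) t is _ P₁ θ ν _ _ S₁ δ' h1
        (Set.subset_union_left.trans hS) (hr.of_factorsOn hδ) (fun F hF => by
          obtain ⟨G, hG, rfl⟩ := Multiset.mem_map.1 hF
          rw [← hδ' G hG]
          exact hH G hG) (fun x hx => hP (.inl (.inr hx)))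
      convert this using 2
      exact List.map_congr_left fun k _ => congrFun (congrArg Env.sess hδ) k
    · exact absurd ⟨δ, hu⟩ hne
  | _ => cases hX

/-- Rewrite rules contain no names, and each variable of the result occurs in the arguments. -/
theorem Calculus.Reduces.fn_subset {g : 𝒞.Des} {args : Fin (𝒞.darity g) → CTerm 𝒞} {M : CTerm 𝒞}
    (h : 𝒞.Reduces g args M) {E : Set Name} (hE : ∀ i, (args i).fn ⊆ E) : M.fn ⊆ E := by
  obtain ⟨r, -, θ, h1, rfl⟩ := h
  intro b hb
  obtain ⟨x, hx, h⟩ | ⟨c, -⟩ := (Term.mem_names_bind _ _ _ _).1 hb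
  · obtain ⟨i, hi⟩ := Set.mem_iUnion.1 (r.rhs_vars hx)
    refine hE i ?_
    rw [h1 i]
    exact (Term.mem_names_bind _ _ _ _).2 (.inl ⟨x, hi, h⟩)
  · exact c.elim

theorem Desc.dlet {g : 𝒞.Des} {args : Fin (𝒞.darity g) → CTerm 𝒞} {P : Proc 𝒞 (0 + 1) 0}
    {Q : CProc 𝒞} (hst : st.Init E₀) (h : Desc R₀ E₀ st a (.dlet g args P Q)) :
    (∀ M, 𝒞.Reduces g args M → Desc R₀ E₀ st (false :: a.1, a.2) (P.instVar M)) ∧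
      Desc R₀ E₀ st (true :: a.1, a.2) Q := by
  generalize hX : Proc.dlet g args P Q = X at h
  obtain ⟨t, is, pos, P', θ, ν, ρ, H, S, δ, hT, hS, hr, hH, hP⟩ := h
  cases P' with
  | dlet g' args' P₁ P₂ =>
    cases hX
    obtain ⟨S₁, S₂, h1, h2, rfl⟩ := hT
    refine ⟨fun M hM => ?_, .mk t is _ P₂ θ ν ρ H S₂ δ h2 (Set.subset_union_right.trans hS) hr hH
        (Set.subset_union_right.trans hP)⟩
    have hargs := fun i => hr.enc_of_init hst (M := args' i)
      (fun x hx => hP (.inl (.inl (Set.mem_iUnion.2 ⟨i, hx⟩))))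
    have hMfn := hM.fn_subset fun i => (hargs i).2
    obtain ⟨r, hrg, θ', hl, rfl⟩ := hM
    -- Encoding an actual rewriting step solves the equations of the rule, so the translation has a
    -- set of clauses for this rule.
    have hu : IsRuleUnifier ρ args' r δ fun x => encTerm st.lam (θ' x) := by
      intro i
      rw [(hargs i).1, ← encTerm_bind, ← hl i]
    obtain ⟨σ, σ', ⟨-, hmgu⟩, h1⟩ | ⟨hne, -⟩ := h1 r hrg
    · obtain ⟨δ', ⟨hδ, hδ'⟩, hδσ⟩ := hmgu _ _ hu
      rw [Proc.instVar_subst]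
      have := Desc.mk (E₀ := E₀) (st := st) _ is _ P₁ (Fin.cons _ θ) ν _ _ (S₁ r) δ' h1
        (fun C hC => hS (.inl (Set.mem_biUnion hrg hC)))
        ((hr.of_factorsOn hδ).consVar (M := r.rhs.bind θ' Empty.elim) (by
          rw [Term.toPattern_subst, encTerm_bind]
          exact Term.toPattern_congr (fun x _ => (hδσ x).symm) fun c => c.elim) hMfn) (fun F hF => by
          obtain ⟨G, hG, rfl⟩ := Multiset.mem_map.1 hF
          rw [← hδ' G hG]
          exact hH G hG) (fun x hx => hP (.inl (.inr hx)))
      convert this using 2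
      exact List.map_congr_left fun k _ => congrFun (congrArg Env.sess hδ) k
    · exact absurd ⟨_, _, hu⟩ hne
  | _ => cases hX

/-- The pattern of the name created by a restriction of the protocol, and the continuation. -/
theorem Desc.res {P : Proc 𝒞 0 (0 + 1)} (h : Desc R₀ E₀ st a (.res P)) :
    ∃ (k : ℕ) (args : Fin k → Pattern 𝒞.toConSig), ∀ (st' : State 𝒞) (b : Name), st.Le st' →
      b ∈ st'.E → st'.lam b = .name (.bound a.1) k args a.2 →
      Desc R₀ E₀ st' (false :: a.1, a.2) (P.instName b) := by
  generalize hX : Proc.res P = X at h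
  obtain ⟨t, is, pos, P', θ, ν, ρ, H, S, δ, hT, hS, hr, hH, hP⟩ := h
  cases P' with
  | res P₁ =>
    cases hX
    refine ⟨_, fun i => (ρ.enc ((t.map Term.var).get i)).subst δ, fun st' b hle hb hlam => ?_⟩
    rw [Proc.instName_subst]
    refine .mk t is _ P₁ θ (Fin.cons (.inl b) ν)
      (ρ.consNam (ρ.encLabel (.bound pos) (t.map .var) is)) H S δ hT hS
      ((hr.mono hle).consNam ?_ hb) (fun F hF => (hH F hF).mono hle.Me) hP
    rw [hlam, Env.encLabel, Pattern.subst, List.map_map]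
    rfl
  | _ => cases hX

end Desc

end ProVerif

/-! ### The knowledge of the adversary, and the allocation of addresses -/

namespace ProVerif

variable {𝒞 : Calculus}

/-! ## The adversary -/

section Adversary

variable {R₀ : Set (Clause 𝒞.toConSig)} {Init : Finset Name} {E₀ : Set Name} {st st' : State 𝒞}

theorem Der.attacker_con {Me : Set (Pattern 𝒞.toConSig)} (hatt : attackerClauses 𝒞 Init ⊆ R₀)
    {f : 𝒞.Con} (hf : 𝒞.pubCon f) {args : Fin (𝒞.arity f) → Pattern 𝒞.toConSig}
    (h : ∀ i, Der R₀ Me (.attacker (args i))) : Der R₀ Me (.attacker (.app f args)) := by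
  refine Der.clause' (clauseRf_mem hatt hf) (Subst.ofFin args) ?_ fun F hF => ?_
  · simp [clauseRf, HornFact.subst, Pattern.subst]
  · obtain ⟨i, rfl⟩ := (mem_sum_singleton _ _).1 hF
    simpa [HornFact.subst, Pattern.subst] using h i

theorem Der.attacker_init {Me : Set (Pattern 𝒞.toConSig)} (hatt : attackerClauses 𝒞 Init ⊆ R₀)
    {a : Name} (ha : a ∈ Init) : Der R₀ Me (.attacker (freeName a)) := by
  refine Der.clause' (R := clauseInit _ a) (hatt (.inl (.inl (.inl (.inl ⟨a, ha, rfl⟩)))))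
    (Subst.id _) (HornFact.subst_id _) fun F hF => absurd hF (Multiset.notMem_zero _)

theorem Der.attacker_term (hatt : attackerClauses 𝒞 Init ⊆ R₀)
    (hlam : ∀ a ∈ Init, st.lam a = freeName a) {n m : ℕ} {θ : Fin n → CTerm 𝒞}
    {ν : Fin m → Name ⊕ Fin 0} (hθ : ∀ x, Der R₀ st.Me (.attacker (encTerm st.lam (θ x))))
    (hν : ∀ b, Der R₀ st.Me (.attacker (encName st.lam (ν b)))) {M : PTerm 𝒞 n m}
    (hM : M.OnlyCon 𝒞.pubCon) (hfn : M.fn ⊆ (Init : Set Name)) :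
    Der R₀ st.Me (.attacker (encTerm st.lam (M.subst θ ν))) := by
  rw [encTerm_subst]
  induction M with
  | var x => exact hθ x
  | name a =>
    rcases a with a | b
    · have ha : a ∈ Init := hfn (by simp [PTerm.fn, Term.names])
      rw [Term.toPattern, Sum.elim_inl, hlam a ha]
      exact Der.attacker_init hatt ha
    · exact hν b
  | app f args ih =>
    exact Der.attacker_con hatt hM.1 fun i =>
      ih i (hM.2 i) fun a ha => hfn (Set.mem_iUnion.2 ⟨i, ha⟩)

/-- The process is obtained from an adversary by replacing variables and names by terms and names
that the adversary has. -/
inductive Adv (R₀ : Set (Clause 𝒞.toConSig)) (Init : Finset Name) (st : State 𝒞) : CProc 𝒞 → Prop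
  | mk {n m : ℕ} (P : Proc 𝒞 n m) (θ : Fin n → CTerm 𝒞) (ν : Fin m → Name ⊕ Fin 0)
      (hfn : P.fn ⊆ (Init : Set Name)) (hne : P.NoEvent) (hpub : P.OnlyPublic)
      (hθ : ∀ x, Der R₀ st.Me (.attacker (encTerm st.lam (θ x))))
      (hν : ∀ b, Der R₀ st.Me (.attacker (encName st.lam (ν b))))
      (hθE : ∀ x, (θ x).fn ⊆ st.E) (hνE : ∀ b a, ν b = .inl a → a ∈ st.E) :
      Adv R₀ Init st (P.subst θ ν)

theorem Adv.mono (h : st.Le st') {X : CProc 𝒞} (hX : Adv R₀ Init st X) : Adv R₀ Init st' X := by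
  obtain ⟨P, θ, ν, hfn, hne, hpub, hθ, hν, hθE, hνE⟩ := hX
  refine .mk P θ ν hfn hne hpub (fun x => ?_) (fun b => ?_) (fun x => (hθE x).trans h.E)
    fun b a hb => h.E (hνE b a hb)
  · rw [encTerm_le h (hθE x)]
    exact (hθ x).mono h.Me
  · rw [encName_congr h (hνE b)]
    exact (hν b).mono h.Me

/-- The term consists of names of the state and is known by the adversary. -/
def Known (R₀ : Set (Clause 𝒞.toConSig)) (st : State 𝒞) (M : CTerm 𝒞) : Prop :=
  M.fn ⊆ st.E ∧ Der R₀ st.Me (.attacker (encTerm st.lam M))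

/-- The clauses and the names of the initial configuration. -/
structure Setup (R₀ : Set (Clause 𝒞.toConSig)) (Init : Finset Name) (E₀ : Set Name)
    (st : State 𝒞) : Prop where
  clauses : attackerClauses 𝒞 Init ⊆ R₀
  init : st.Init E₀
  subset : (Init : Set Name) ⊆ E₀

theorem Setup.known (hs : Setup R₀ Init E₀ st) {n m : ℕ} {θ : Fin n → CTerm 𝒞}
    {ν : Fin m → Name ⊕ Fin 0} (hθ : ∀ x, Der R₀ st.Me (.attacker (encTerm st.lam (θ x))))
    (hν : ∀ b, Der R₀ st.Me (.attacker (encName st.lam (ν b))))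
    (hθE : ∀ x, (θ x).fn ⊆ st.E) (hνE : ∀ b a, ν b = .inl a → a ∈ st.E) {M : PTerm 𝒞 n m}
    (hM : M.OnlyCon 𝒞.pubCon) (hfn : M.fn ⊆ (Init : Set Name)) : Known R₀ st (M.subst θ ν) :=
  ⟨PTerm.fn_subst_subset (hfn.trans (hs.subset.trans hs.init.subset)) hθE hνE,
    Der.attacker_term hs.clauses (fun a ha => hs.init.lam a (hs.subset ha)) hθ hν hM hfn⟩

theorem Adv.par {P Q : CProc 𝒞} (h : Adv R₀ Init st (.par P Q)) :
    Adv R₀ Init st P ∧ Adv R₀ Init st Q := by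
  generalize hX : Proc.par P Q = X at h
  obtain ⟨P', θ, ν, hfn, hne, hpub, hθ, hν, hθE, hνE⟩ := h
  cases P' with
  | par P₁ P₂ =>
    cases hX
    exact ⟨.mk P₁ θ ν (Set.subset_union_left.trans hfn) hne.1 hpub.1 hθ hν hθE hνE,
      .mk P₂ θ ν (Set.subset_union_right.trans hfn) hne.2 hpub.2 hθ hν hθE hνE⟩
  | _ => cases hX

theorem Adv.repl {P : CProc 𝒞} (h : Adv R₀ Init st (.repl P)) : Adv R₀ Init st P := by
  generalize hX : Proc.repl P = X at h
  obtain ⟨P', θ, ν, hfn, hne, hpub, hθ, hν, hθE, hνE⟩ := h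
  cases P' with
  | repl P₁ =>
    cases hX
    exact .mk P₁ θ ν hfn hne hpub hθ hν hθE hνE
  | _ => cases hX

theorem Adv.out {M N : CTerm 𝒞} {P : CProc 𝒞} (hs : Setup R₀ Init E₀ st)
    (h : Adv R₀ Init st (.out M N P)) : Adv R₀ Init st P ∧ Known R₀ st M ∧ Known R₀ st N := by
  generalize hX : Proc.out M N P = X at h
  obtain ⟨P', θ, ν, hfn, hne, hpub, hθ, hν, hθE, hνE⟩ := h
  cases P' with
  | out M' N' P₁ =>
    cases hX
    exact ⟨.mk P₁ θ ν (Set.subset_union_right.trans hfn) hne hpub.2.2 hθ hν hθE hνE,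
      hs.known hθ hν hθE hνE hpub.1 fun x hx => hfn (.inl (.inl hx)),
      hs.known hθ hν hθE hνE hpub.2.1 fun x hx => hfn (.inl (.inr hx))⟩
  | _ => cases hX

theorem Adv.inp {M : CTerm 𝒞} {P : Proc 𝒞 (0 + 1) 0} (hs : Setup R₀ Init E₀ st)
    (h : Adv R₀ Init st (.inp M P)) :
    Known R₀ st M ∧ ∀ N, Known R₀ st N → Adv R₀ Init st (P.instVar N) := by
  generalize hX : Proc.inp M P = X at h
  obtain ⟨P', θ, ν, hfn, hne, hpub, hθ, hν, hθE, hνE⟩ := h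
  cases P' with
  | inp M' P₁ =>
    cases hX
    refine ⟨hs.known hθ hν hθE hνE hpub.1 fun x hx => hfn (.inl hx), fun N hN => ?_⟩
    rw [Proc.instVar_subst]
    exact .mk P₁ (Fin.cons N θ) ν (Set.subset_union_right.trans hfn) hne hpub.2
      (fun x => Fin.cases hN.2 hθ x) hν (fun x => Fin.cases hN.1 hθE x) hνE
  | _ => cases hX

theorem Adv.ite {M N : CTerm 𝒞} {P Q : CProc 𝒞} (h : Adv R₀ Init st (.ite M N P Q)) :
    Adv R₀ Init st P ∧ Adv R₀ Init st Q := by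
  generalize hX : Proc.ite M N P Q = X at h
  obtain ⟨P', θ, ν, hfn, hne, hpub, hθ, hν, hθE, hνE⟩ := h
  cases P' with
  | ite M' N' P₁ P₂ =>
    cases hX
    exact ⟨.mk P₁ θ ν (fun x hx => hfn (.inl (.inr hx))) hne.1 hpub.2.2.1 hθ hν hθE hνE,
      .mk P₂ θ ν (Set.subset_union_right.trans hfn) hne.2 hpub.2.2.2 hθ hν hθE hνE⟩
  | _ => cases hX

theorem Adv.not_event {M : CTerm 𝒞} {P : CProc 𝒞} : ¬ Adv R₀ Init st (.event M P) := by
  intro h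
  generalize hX : Proc.event M P = X at h
  obtain ⟨P', θ, ν, hfn, hne, -⟩ := h
  cases P' with
  | event M' P₁ => exact hne
  | _ => cases hX

theorem Known.of_reduces (hs : Setup R₀ Init E₀ st) {g : 𝒞.Des} (hg : 𝒞.pubDes g)
    {args : Fin (𝒞.darity g) → CTerm 𝒞} (h : ∀ i, Known R₀ st (args i)) {M : CTerm 𝒞}
    (hM : 𝒞.Reduces g args M) : Known R₀ st M := by
  refine ⟨hM.fn_subset fun i => (h i).1, ?_⟩
  obtain ⟨r, hr, θ, hl, rfl⟩ := hM
  have key : ∀ N : Term 𝒞.toConSig (Fin r.k) Empty,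
      (N.toPattern (fun v : Fin r.k => .var v) Empty.elim).subst
        (Subst.ofFin fun x => encTerm st.lam (θ x)) = encTerm st.lam (N.bind θ Empty.elim) := by
    intro N
    rw [Term.toPattern_subst, encTerm_bind]
    exact Term.toPattern_congr (fun x _ => Subst.ofFin_ord _ x) fun c => c.elim
  refine Der.clause' (R := clauseRg _ r) (hs.clauses (.inl (.inr ⟨g, hg, r, hr, rfl⟩)))
    (Subst.ofFin fun x => encTerm st.lam (θ x)) (congrArg _ (key _)) fun F hF => ?_
  obtain ⟨i, rfl⟩ := (mem_sum_singleton _ _).1 hF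
  rw [HornFact.subst, key, ← hl]
  exact (h i).2

theorem Adv.dlet {g : 𝒞.Des} {args : Fin (𝒞.darity g) → CTerm 𝒞} {P : Proc 𝒞 (0 + 1) 0}
    {Q : CProc 𝒞} (hs : Setup R₀ Init E₀ st) (h : Adv R₀ Init st (.dlet g args P Q)) :
    (∀ M, 𝒞.Reduces g args M → Adv R₀ Init st (P.instVar M)) ∧ Adv R₀ Init st Q := by
  generalize hX : Proc.dlet g args P Q = X at h
  obtain ⟨P', θ, ν, hfn, hne, hpub, hθ, hν, hθE, hνE⟩ := h
  cases P' with
  | dlet g' args' P₁ P₂ =>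
    cases hX
    refine ⟨fun M hM => ?_, .mk P₂ θ ν (Set.subset_union_right.trans hfn) hne.2 hpub.2.2.2 hθ hν
      hθE hνE⟩
    have hN : Known R₀ st M := Known.of_reduces hs hpub.1 (fun i =>
      hs.known hθ hν hθE hνE (hpub.2.1 i)
        fun x hx => hfn (.inl (.inl (Set.mem_iUnion.2 ⟨i, hx⟩)))) hM
    rw [Proc.instVar_subst]
    exact .mk P₁ (Fin.cons M θ) ν (fun x hx => hfn (.inl (.inr hx))) hne.1 hpub.2.2.1
      (fun x => Fin.cases hN.2 hθ x) hν (fun x => Fin.cases hN.1 hθE x) hνE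
  | _ => cases hX

/-- The pattern of a name created by the adversary. -/
def advName {S : ConSig} (a : Name) : Pattern S := .name .b0 1 (fun _ => freeName a) []

theorem Adv.res {P : Proc 𝒞 0 (0 + 1)} (hatt : attackerClauses 𝒞 Init ⊆ R₀)
    (h : Adv R₀ Init st (.res P)) (hle : st.Le st') {b : Name} (hb : b ∈ st'.E)
    (hlam : st'.lam b = advName b) : Adv R₀ Init st' (P.instName b) := by
  have h := h.mono hle
  generalize hX : Proc.res P = X at h
  obtain ⟨P', θ, ν, hfn, hne, hpub, hθ, hν, hθE, hνE⟩ := h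
  cases P' with
  | res P₁ =>
    cases hX
    have hd : Der R₀ st'.Me (.attacker (st'.lam b)) := by
      rw [hlam]
      -- The instance `x := b[]` of `attacker(b₀[x])`: the argument serves only to give distinct
      -- names distinct patterns.
      exact Der.clause' (R := clauseRn _) (hatt (.inl (.inl (.inl (.inr rfl)))))
        ⟨fun _ => freeName b, .var⟩ rfl fun F hF => absurd hF (Multiset.notMem_zero _)
    rw [Proc.instName_subst]
    refine .mk P₁ θ (Fin.cons (.inl b) ν) hfn hne hpub hθ (fun x => Fin.cases hd hν x) hθE
      fun x => Fin.cases ?_ hνE x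
    intro c hc
    obtain rfl : b = c := by simpa using hc
    exact hb
  | _ => cases hX

end Adversary

/-! ## Disjointness of the addresses of the processes -/

/-- The addresses that may be created later by the process with the given address, when the session
identifiers smaller than `K` have been used. The processes of the adversary have no address. -/
def Future (K : ℕ) : Option Addr → Addr → Prop
  | none, _ => False
  | some a, x => a.1 <:+ x.1 ∧ ∃ u, x.2 = a.2 ++ u ∧ ∀ i ∈ u, ∃ c, K ≤ c ∧ i = SessId.const c

open Classical in
-- Counting turns "no address is available to two processes, and none is reused" into a single
-- inequality: a sum bounded by 1.
noncomputable def ind (K : ℕ) (o : Option Addr) (x : Addr) : ℕ := if Future K o x then 1 else 0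

theorem ind_none (K : ℕ) (x : Addr) : ind K none x = 0 := if_neg id

theorem ind_le_ind {K K' : ℕ} {o o' : Option Addr} {x : Addr}
    (h : Future K o x → Future K' o' x) : ind K o x ≤ ind K' o' x := by
  rw [ind, ind]
  split_ifs <;> simp_all

theorem ind_add_ind_le {K K₁ K₂ : ℕ} {o o₁ o₂ : Option Addr} {x : Addr}
    (h₁ : Future K₁ o₁ x → Future K o x) (h₂ : Future K₂ o₂ x → Future K o x)
    (h : Future K₁ o₁ x → ¬ Future K₂ o₂ x) : ind K₁ o₁ x + ind K₂ o₂ x ≤ ind K o x := by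
  rw [ind, ind, ind]
  split_ifs <;> simp_all

theorem Future.mono {K K' : ℕ} (hK : K ≤ K') {o : Option Addr} {x : Addr} (h : Future K' o x) :
    Future K o x := by
  cases o with
  | none => exact h
  | some a =>
    obtain ⟨h1, u, h2, h3⟩ := h
    refine ⟨h1, u, h2, fun i hi => ?_⟩
    obtain ⟨c, hc, h⟩ := h3 i hi
    exact ⟨c, hK.trans hc, h⟩

/-- Positions grow at the head of the list, so descendants of a position are the lists that have it
as a suffix. -/
theorem Future.of_child {K : ℕ} {b : Bool} {a x : Addr} (h : Future K (some (b :: a.1, a.2)) x) :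
    Future K (some a) x :=
  ⟨(List.suffix_cons b a.1).trans h.1, h.2⟩

/-- Two suffixes of the same list with the same length coincide, but these two differ at the head.
-/
theorem Future.not_true {K : ℕ} {a x : Addr} (h : Future K (some (false :: a.1, a.2)) x) :
    ¬ Future K (some (true :: a.1, a.2)) x := by
  intro h'
  have := List.suffix_of_suffix_length_le h.1 h'.1 (by simp)
  have := this.eq_of_length (by simp)
  simp at this

theorem Future.of_session {K : ℕ} {a x : Addr}
    (h : Future (K + 1) (some (false :: a.1, a.2 ++ [.const K])) x) : Future K (some a) x := by
  obtain ⟨h1, u, h2, h3⟩ := h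
  refine ⟨(List.suffix_cons false a.1).trans h1, .const K :: u, by simpa using h2, ?_⟩
  rintro i hi
  obtain rfl | hi := List.mem_cons.1 hi
  · exact ⟨K, le_rfl, rfl⟩
  · obtain ⟨c, hc, h⟩ := h3 i hi
    exact ⟨c, by omega, h⟩

/-- The copy carries the identifier `K`, whereas the remaining replication can from now on only hand
out identifiers at least `K + 1`. -/
theorem Future.not_session {K : ℕ} {a x : Addr}
    (h : Future (K + 1) (some (false :: a.1, a.2 ++ [.const K])) x) :
    ¬ Future (K + 1) (some a) x := by
  rintro ⟨-, u', h2', h3'⟩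
  obtain ⟨h1, u, h2, h3⟩ := h
  have : u' = .const K :: u := by
    rw [h2', List.append_assoc] at h2
    exact List.append_cancel_left h2
  obtain ⟨c, hc, h⟩ := h3' (.const K) (by simp [this])
  cases h
  omega

theorem Future.self (K : ℕ) (a : Addr) : Future K (some a) a :=
  ⟨List.suffix_rfl, [], by simp, by simp⟩

theorem Future.ne_of_child {K : ℕ} {a x : Addr} (h : Future K (some (false :: a.1, a.2)) x) :
    a ≠ x := by
  rintro rfl
  have := h.1.length_le
  simp at this

/-- The processes `Ps` have addresses in the sense of `T`; no address is used twice by the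
processes, and the addresses counted by `φ` are not used. -/
def Good (T : Option Addr → CProc 𝒞 → Prop) (K : ℕ) (φ : Addr → ℕ) (Ps : Multiset (CProc 𝒞)) :
    Prop :=
  ∃ D : Multiset (Option Addr × CProc 𝒞), D.map Prod.snd = Ps ∧ (∀ d ∈ D, T d.1 d.2) ∧
    ∀ x, φ x + (D.map fun d => ind K d.1 x).sum ≤ 1

section Good

variable {T T' : Option Addr → CProc 𝒞 → Prop} {K K' : ℕ} {φ φ' : Addr → ℕ}
  {Ps : Multiset (CProc 𝒞)}

theorem Good.mono (h : Good T K φ Ps) (hT : ∀ o X, T o X → T' o X) (hK : K ≤ K')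
    (hφ : ∀ x, φ' x ≤ φ x) : Good T' K' φ' Ps := by
  obtain ⟨D, h1, h2, h3⟩ := h
  refine ⟨D, h1, fun d hd => hT _ _ (h2 d hd), fun x => le_trans (add_le_add (hφ x) ?_) (h3 x)⟩
  exact Multiset.sum_map_le_sum_map _ _ fun d _ => ind_le_ind fun h => h.mono hK

/-- The addresses of the removed process are charged to `φ`. `Good.put` hands them back, so a
reduction need only check that the successors use no more addresses than the processes they replace.
-/
theorem Good.take {X : CProc 𝒞} (h : Good T K φ (Ps + {X})) :
    ∃ o, T o X ∧ Good T K (fun x => φ x + ind K o x) Ps := by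
  obtain ⟨D, h1, h2, h3⟩ := h
  have hX : X ∈ D.map Prod.snd := by
    rw [h1]
    simp
  obtain ⟨⟨o, Y⟩, hd, rfl⟩ := Multiset.mem_map.1 hX
  obtain ⟨D, rfl⟩ := Multiset.exists_cons_of_mem hd
  refine ⟨o, h2 _ hd, D, ?_, fun d hd => h2 d (Multiset.mem_cons_of_mem hd), fun x => ?_⟩
  · rw [Multiset.map_cons, ← Multiset.singleton_add, add_comm] at h1
    exact add_right_cancel h1
  · have := h3 x
    rw [Multiset.map_cons, Multiset.sum_cons] at this
    simpa only [add_assoc] using this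

theorem Good.put {o : Option Addr} {X : CProc 𝒞} (hX : T o X)
    (h : Good T K (fun x => φ x + ind K o x) Ps) : Good T K φ (Ps + {X}) := by
  obtain ⟨D, h1, h2, h3⟩ := h
  refine ⟨(o, X) ::ₘ D, ?_, ?_, fun x => ?_⟩
  · rw [Multiset.map_cons, h1, ← Multiset.singleton_add, add_comm]
  · intro d hd
    obtain rfl | hd := Multiset.mem_cons.1 hd
    exacts [hX, h2 d hd]
  · have := h3 x
    rw [Multiset.map_cons, Multiset.sum_cons]
    simpa only [add_assoc] using this

theorem add_pair {α : Type*} (s : Multiset α) (a b : α) : s + {a, b} = s + {a} + {b} := by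
  rw [Multiset.insert_eq_cons, ← Multiset.singleton_add, add_assoc]

theorem Good.replace {X Y : CProc 𝒞} (h : Good T K φ (Ps + {X}))
    (hXY : ∀ o, T o X → ∃ o', T o' Y ∧ ∀ x, ind K o' x ≤ ind K o x) : Good T K φ (Ps + {Y}) := by
  obtain ⟨o, hX, h⟩ := h.take
  obtain ⟨o', hY, hle⟩ := hXY o hX
  exact .put hY (h.mono (fun _ _ => id) le_rfl fun x => Nat.add_le_add_left (hle x) _)

theorem Good.replace_pair {X Y Z : CProc 𝒞} (h : Good T K φ (Ps + {X})) (hK : K ≤ K')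
    (hXY : ∀ o, T o X → ∃ o₁ o₂, T o₁ Y ∧ T o₂ Z ∧
      ∀ x, ind K' o₁ x + ind K' o₂ x ≤ ind K o x) : Good T K' φ (Ps + {Y, Z}) := by
  obtain ⟨o, hX, h⟩ := h.take
  obtain ⟨o₁, o₂, hY, hZ, hle⟩ := hXY o hX
  rw [add_pair]
  refine .put hZ (.put hY (h.mono (fun _ _ => id) hK fun x => ?_))
  have := hle x
  omega

end Good

end ProVerif

/-! ### Preservation of the invariant by reductions, and its consequences for patterns -/

namespace ProVerif

variable {𝒞 : Calculus} {R₀ : Set (Clause 𝒞.toConSig)} {Init : Finset Name} {E₀ : Set Name}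

/-! ## The invariant of traces -/

/-- Processes without address are processes of the adversary, the other ones belong to the
protocol. -/
def Tok (R₀ : Set (Clause 𝒞.toConSig)) (Init : Finset Name) (E₀ : Set Name) (st : State 𝒞) :
    Option Addr → CProc 𝒞 → Prop
  | none, X => Adv R₀ Init st X
  | some a, X => Desc R₀ E₀ st a X

theorem Tok.mono {st st' : State 𝒞} (h : st.Le st') {o : Option Addr} {X : CProc 𝒞}
    (hX : Tok R₀ Init E₀ st o X) : Tok R₀ Init E₀ st' o X := by
  cases o with
  | none => exact Adv.mono h hX
  | some a => exact Desc.mono h hX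

/-- The address in the pattern of a name created by the protocol. -/
def Pattern.addr {S : ConSig} : Pattern S → Option Addr
  | .name (.bound pos) _ _ sess => some (pos, sess)
  | _ => none

open Classical in
/-- The number of names created at an address. -/
noncomputable def occ (E : Finset Name) (lam : Name → Pattern 𝒞.toConSig) (x : Addr) : ℕ :=
  (E.filter fun a => (lam a).addr = some x).card

/-- The state of a configuration. -/
def Config.state (C : Config 𝒞) (lam : Name → Pattern 𝒞.toConSig) (Me : Set (Pattern 𝒞.toConSig)) :
    State 𝒞 := ⟨C.env, lam, Me⟩

structure Inv (R₀ : Set (Clause 𝒞.toConSig)) (Init : Finset Name) (E₀ : Set Name) (C : Config 𝒞)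
    (lam : Name → Pattern 𝒞.toConSig) (Me : Set (Pattern 𝒞.toConSig)) (K : ℕ) : Prop where
  setup : Setup R₀ Init E₀ (C.state lam Me)
  kinds : ∀ a ∈ C.env, lam a = freeName a ∨ lam a = advName a ∨ ∃ x, (lam a).addr = some x
  good : Good (Tok R₀ Init E₀ (C.state lam Me)) K (occ C.env lam) C.procs

theorem Inv.occ_le {C : Config 𝒞} {lam : Name → Pattern 𝒞.toConSig} {Me : Set (Pattern 𝒞.toConSig)}
    {K : ℕ} (h : Inv R₀ Init E₀ C lam Me K) (x : Addr) : occ C.env lam x ≤ 1 := by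
  obtain ⟨D, -, -, h3⟩ := h.good
  exact le_trans (Nat.le_add_right _ _) (h3 x)

theorem Inv.mono {C : Config 𝒞} {lam : Name → Pattern 𝒞.toConSig}
    {Me Me' : Set (Pattern 𝒞.toConSig)} {K : ℕ} (h : Inv R₀ Init E₀ C lam Me K) (hMe : Me ⊆ Me') :
    Inv R₀ Init E₀ C lam Me' K where
  setup := ⟨h.setup.clauses, ⟨h.setup.init.subset, h.setup.init.lam⟩, h.setup.subset⟩
  kinds := h.kinds
  good := h.good.mono
    (fun _ _ => Tok.mono (st := C.state lam Me) (st' := C.state lam Me')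
      ⟨subset_rfl, fun _ _ => rfl, hMe⟩) le_rfl fun _ => le_rfl

theorem Tok.out {st : State 𝒞} (hs : Setup R₀ Init E₀ st) {o : Option Addr} {M N : CTerm 𝒞}
    {P : CProc 𝒞} (h : Tok R₀ Init E₀ st o (.out M N P)) (K : ℕ) :
    (∃ o', Tok R₀ Init E₀ st o' P ∧ ∀ x, ind K o' x ≤ ind K o x) ∧ M.fn ⊆ st.E ∧ N.fn ⊆ st.E ∧
      Der R₀ st.Me (.message (encTerm st.lam M) (encTerm st.lam N)) := by
  cases o with
  | none =>
    obtain ⟨hP, hM, hN⟩ := Adv.out hs h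
    refine ⟨⟨none, hP, fun x => le_rfl⟩, hM.1, hN.1, ?_⟩
    refine Der.clause' (R := clauseRs _) (hs.clauses (.inr (.inr rfl)))
      ⟨fun x => if x = 0 then encTerm st.lam M else encTerm st.lam N, .var⟩ ?_ ?_
    · simp [clauseRs, HornFact.subst, Pattern.subst]
    · simpa [clauseRs, HornFact.subst, Pattern.subst] using ⟨hM.2, hN.2⟩
  | some a =>
    obtain ⟨hP, h⟩ := Desc.out hs.init h
    exact ⟨⟨some (false :: a.1, a.2), hP, fun x => ind_le_ind Future.of_child⟩, h⟩

theorem Der.attacker_of_message {Me : Set (Pattern 𝒞.toConSig)}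
    (hatt : attackerClauses 𝒞 Init ⊆ R₀) {p q : Pattern 𝒞.toConSig}
    (hm : Der R₀ Me (.message p q)) (hp : Der R₀ Me (.attacker p)) : Der R₀ Me (.attacker q) := by
  refine Der.clause' (R := clauseRl _) (hatt (.inr (.inl rfl)))
    ⟨fun x => if x = 0 then p else q, .var⟩ ?_ ?_
  · simp [clauseRl, HornFact.subst, Pattern.subst]
  · simpa [clauseRl, HornFact.subst, Pattern.subst] using ⟨hm, hp⟩

theorem Tok.inp {st : State 𝒞} (hs : Setup R₀ Init E₀ st) {o : Option Addr} {M N : CTerm 𝒞}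
    {P : Proc 𝒞 (0 + 1) 0} (h : Tok R₀ Init E₀ st o (.inp M P)) (hN : N.fn ⊆ st.E)
    (hm : Der R₀ st.Me (.message (encTerm st.lam M) (encTerm st.lam N))) (K : ℕ) :
    ∃ o', Tok R₀ Init E₀ st o' (P.instVar N) ∧ ∀ x, ind K o' x ≤ ind K o x := by
  cases o with
  | none =>
    obtain ⟨hM, hP⟩ := Adv.inp hs h
    exact ⟨none, hP N ⟨hN, hm.attacker_of_message hs.clauses hM.2⟩, fun x => le_rfl⟩
  | some a => exact ⟨some (false :: a.1, a.2), Desc.inp hs.init h hN hm, fun x => ind_le_ind Future.of_child⟩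

theorem Inv.comm {C C' : Config 𝒞} {lam : Name → Pattern 𝒞.toConSig}
    {Me : Set (Pattern 𝒞.toConSig)} {K : ℕ} (h : Inv R₀ Init E₀ C lam Me K) {M N : CTerm 𝒞}
    (hc : IsComm M N C C') : M.fn ⊆ (C.env : Set Name) ∧ N.fn ⊆ (C.env : Set Name) ∧
      Der R₀ Me (.message (encTerm lam M) (encTerm lam N)) := by
  obtain ⟨E, Ps, Q, P, rfl, -⟩ := hc
  have hg := h.good
  simp only [add_pair] at hg
  obtain ⟨o, -, hg⟩ := hg.take
  obtain ⟨o', ho, -⟩ := hg.take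
  exact (ho.out h.setup K).2

theorem Inv.event {C C' : Config 𝒞} {lam : Name → Pattern 𝒞.toConSig}
    {Me : Set (Pattern 𝒞.toConSig)} {K : ℕ} (h : Inv R₀ Init E₀ C lam Me K) {M : CTerm 𝒞}
    (hc : IsEvent M C C') : M.fn ⊆ (C.env : Set Name) ∧ Der R₀ Me (.event (encTerm lam M)) := by
  obtain ⟨E, Ps, P, rfl, -⟩ := hc
  obtain ⟨o, ho, -⟩ := h.good.take
  cases o with
  | none => exact (Adv.not_event ho).elim
  | some a => exact (Desc.event h.setup.init ho).2

theorem occ_insert {E : Finset Name} {lam : Name → Pattern 𝒞.toConSig} {b : Name} (hb : b ∉ E)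
    (p : Pattern 𝒞.toConSig) (x : Addr) [Decidable (p.addr = some x)] :
    occ (insert b E) (Function.update lam b p) x =
      occ E lam x + if p.addr = some x then 1 else 0 := by
  classical
  have hE : (E.filter fun a => (Function.update lam b p a).addr = some x) =
      E.filter fun a => (lam a).addr = some x :=
    Finset.filter_congr fun a ha => by rw [Function.update_of_ne (by rintro rfl; exact hb ha)]
  rw [occ, occ, Finset.filter_insert, Function.update_self, hE]
  split_ifs with h
  · rw [Finset.card_insert_of_notMem fun h' => hb (Finset.mem_filter.1 h').1]
  · rfl

theorem Inv.insertName {E : Finset Name} {Ps Ps' : Multiset (CProc 𝒞)}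
    {lam : Name → Pattern 𝒞.toConSig} {Me : Set (Pattern 𝒞.toConSig)} {K : ℕ} {b : Name}
    (h : Inv R₀ Init E₀ ⟨E, Ps⟩ lam Me K) (hb : b ∉ E) (p : Pattern 𝒞.toConSig)
    (hp : p = advName b ∨ ∃ x, p.addr = some x)
    (hg : Good (Tok R₀ Init E₀ ⟨(insert b E : Finset Name), Function.update lam b p, Me⟩) K
      (occ (insert b E) (Function.update lam b p)) Ps') :
    Inv R₀ Init E₀ ⟨insert b E, Ps'⟩ (Function.update lam b p) Me K where
  setup := by
    refine ⟨h.setup.clauses, ⟨h.setup.init.subset.trans ?_, fun a ha => ?_⟩, h.setup.subset⟩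
    · exact Finset.coe_subset.2 (Finset.subset_insert b E)
    · have hne : a ≠ b := by
        rintro rfl
        exact hb (h.setup.init.subset ha)
      exact (Function.update_of_ne hne _ _).trans (h.setup.init.lam a ha)
  kinds a haE := by
    obtain rfl | ha := Finset.mem_insert.1 haE
    · rw [Function.update_self]
      exact .inr hp
    · rw [Function.update_of_ne (by rintro rfl; exact hb ha)]
      exact h.kinds a ha
  good := hg

/-- Only restriction changes `lam`, and only at the new name; only replication uses up a session
identifier. The hypothesis `hev` requires the executed event to be among the must-events beforehand.
-/
theorem Inv.step {C C' : Config 𝒞} {lam : Name → Pattern 𝒞.toConSig}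
    {Me : Set (Pattern 𝒞.toConSig)} {K : ℕ} (h : Inv R₀ Init E₀ C lam Me K) (hs : Step C C')
    (hev : ∀ M, IsEvent M C C' → encTerm lam M ∈ Me) :
    ∃ lam' K', Inv R₀ Init E₀ C' lam' Me K' ∧ C.env ⊆ C'.env ∧ ∀ a ∈ C.env, lam' a = lam a := by
  classical
  have same : ∀ {E : Finset Name} {Ps Ps' : Multiset (CProc 𝒞)} {K' : ℕ},
      Inv R₀ Init E₀ ⟨E, Ps⟩ lam Me K →
      Good (Tok R₀ Init E₀ ⟨E, lam, Me⟩) K' (occ E lam) Ps' →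
      ∃ lam' K', Inv R₀ Init E₀ ⟨E, Ps'⟩ lam' Me K' ∧ E ⊆ E ∧ ∀ a ∈ E, lam' a = lam a :=
    fun h hg => ⟨lam, _, ⟨h.setup, h.kinds, hg⟩, subset_rfl, fun _ _ => rfl⟩
  have hsetup := h.setup
  have hg := h.good
  cases hs with
  | nil E Ps =>
    obtain ⟨o, -, hg⟩ := hg.take
    exact same h (hg.mono (fun _ _ => id) le_rfl fun x => Nat.le_add_right _ _)
  | repl E Ps P =>
    refine same h (hg.replace_pair (Nat.le_succ K) fun o ho => ?_)
    cases o with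
    | none => exact ⟨none, none, Adv.repl ho, ho, fun x => by simp [ind_none]⟩
    | some a =>
      exact ⟨some (false :: a.1, a.2 ++ [SessId.const K]), some a, Desc.repl ho K, ho, fun x => ind_add_ind_le Future.of_session
        (Future.mono (Nat.le_succ K)) Future.not_session⟩
  | par E Ps P Q =>
    refine same h (hg.replace_pair le_rfl fun o ho => ?_)
    cases o with
    | none => exact ⟨none, none, (Adv.par ho).1, (Adv.par ho).2, fun x => by simp [ind_none]⟩
    | some a =>
      exact ⟨some (false :: a.1, a.2), some (true :: a.1, a.2), (Desc.par ho).1, (Desc.par ho).2, fun x =>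
        ind_add_ind_le Future.of_child Future.of_child Future.not_true⟩
  | res E Ps P b hb =>
    have hlam : ∀ p : Pattern 𝒞.toConSig, ∀ a ∈ E, Function.update lam b p a = lam a :=
      fun p a ha => Function.update_of_ne (by rintro rfl; exact hb ha) _ _
    have hle : ∀ p : Pattern 𝒞.toConSig, State.Le ⟨E, lam, Me⟩
        -- Since `b` is new, updating its pattern leaves all recorded patterns and derivations
        -- intact.
        ⟨(insert b E : Finset Name), Function.update lam b p, Me⟩ := fun p =>
      ⟨Finset.coe_subset.2 (Finset.subset_insert b E), hlam p, subset_rfl⟩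
    have hbE : b ∈ ((insert b E : Finset Name) : Set Name) :=
      Finset.mem_coe.2 (Finset.mem_insert_self b E)
    obtain ⟨o, ho, hg⟩ := hg.take
    cases o with
    | none =>
      refine ⟨_, K, h.insertName hb (advName b) (.inl rfl) (.put (o := none) (Adv.res hsetup.clauses ho
        (hle _) hbE (Function.update_self _ _ _)) (hg.mono (fun _ _ => Tok.mono (hle _)) le_rfl ?_)),
        Finset.subset_insert b E, hlam _⟩
      intro x
      rw [occ_insert hb]
      simp [advName, Pattern.addr]
    | some a =>
      obtain ⟨k, args, hP⟩ := Desc.res ho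
      refine ⟨_, K, h.insertName hb (.name (.bound a.1) k args a.2) (.inr ⟨_, rfl⟩)
        (.put (o := some (false :: a.1, a.2)) (hP _ b (hle _) hbE (Function.update_self _ _ _))
          (hg.mono (fun _ _ => Tok.mono (hle _)) le_rfl ?_)),
        Finset.subset_insert b E, hlam _⟩
      intro x
      rw [occ_insert hb, add_assoc]
      refine Nat.add_le_add_left ?_ _
      have haddr : (Pattern.name (.bound a.1) k args a.2 : Pattern 𝒞.toConSig).addr = some a := rfl
      rw [haddr]
      -- The address `a` passes from the process to the created name: the continuation lives
      -- strictly below `a` and can no longer reach it.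
      by_cases hx : a = x
      · have h1 : ind K (some (false :: a.1, a.2)) x = 0 := if_neg fun h => Future.ne_of_child h hx
        rw [h1, if_pos (congrArg some hx), ← hx, ind, if_pos (Future.self K a)]
      · rw [if_neg fun h => hx (Option.some.inj h), zero_add]
        exact ind_le_ind Future.of_child
  | io E Ps N M Q P =>
    refine same (K' := K) h ?_
    rw [add_pair]
    simp only [add_pair] at hg
    obtain ⟨oi, hi, hg⟩ := hg.take
    obtain ⟨oo, ho, hg⟩ := hg.take
    -- The sender, protocol or adversary, provides the derivable message fact that the receiver
    -- consumes.
    obtain ⟨⟨oo', hQ, hle⟩, -, hM, hm⟩ := ho.out hsetup K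
    obtain ⟨oi', hP, hle'⟩ := hi.inp hsetup hM hm K
    refine .put hP (.put hQ (hg.mono (fun _ _ => id) le_rfl fun x => ?_))
    exact add_le_add (Nat.add_le_add_left (hle' x) _) (hle x)
  | destr1 E Ps g args P Q M hM =>
    refine same h (hg.replace fun o ho => ?_)
    cases o with
    | none => exact ⟨none, (Adv.dlet hsetup ho).1 M hM, fun x => le_rfl⟩
    | some a => exact ⟨some (false :: a.1, a.2), (Desc.dlet hsetup.init ho).1 M hM, fun x => ind_le_ind Future.of_child⟩
  | destr2 E Ps g args P Q hM =>
    refine same h (hg.replace fun o ho => ?_)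
    cases o with
    | none => exact ⟨none, (Adv.dlet hsetup ho).2, fun x => le_rfl⟩
    | some a => exact ⟨some (true :: a.1, a.2), (Desc.dlet hsetup.init ho).2, fun x => ind_le_ind Future.of_child⟩
  | cond1 E Ps M P Q =>
    refine same h (hg.replace fun o ho => ?_)
    cases o with
    | none => exact ⟨none, (Adv.ite ho).1, fun x => le_rfl⟩
    | some a => exact ⟨some (false :: a.1, a.2), (Desc.ite hsetup.init ho).1 rfl, fun x => ind_le_ind Future.of_child⟩
  | cond2 E Ps M N P Q hMN =>
    refine same h (hg.replace fun o ho => ?_)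
    cases o with
    | none => exact ⟨none, (Adv.ite ho).2, fun x => le_rfl⟩
    | some a => exact ⟨some (true :: a.1, a.2), (Desc.ite hsetup.init ho).2, fun x => ind_le_ind Future.of_child⟩
  | event E Ps M P =>
    refine same h (hg.replace fun o ho => ?_)
    cases o with
    | none => exact (Adv.not_event ho).elim
    | some a =>
      exact ⟨some (false :: a.1, a.2), (Desc.event hsetup.init ho).1 (hev M ⟨E, Ps, P, rfl, rfl⟩),
        fun x => ind_le_ind Future.of_child⟩

theorem Inv.start {P₀ Q : CProc 𝒞} {E : Finset Name} (hatt : attackerClauses 𝒞 Init ⊆ R₀)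
    {S : Set (Clause 𝒞.toConSig)} (hT : P₀.instr.Translates ⟨Fin.elim0, Fin.elim0, Fin.elim0⟩ 0 S)
    (hS : S ⊆ R₀) (hQ : IsAdversary Init Q) (hP : P₀.fn ⊆ (E : Set Name)) (hI : Init ⊆ E) :
    Inv R₀ Init (E : Set Name) ⟨E, {P₀, Q}⟩ freeName ∅ 0 where
  setup := ⟨hatt, ⟨subset_rfl, fun _ _ => rfl⟩, Finset.coe_subset.2 hI⟩
  kinds a _ := .inl rfl
  good := by
    have h1 : Desc R₀ (E : Set Name) ⟨E, freeName, ∅⟩ ([], []) P₀ := by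
      have := Desc.mk (R₀ := R₀) (E₀ := (E : Set Name)) (st := ⟨E, freeName, ∅⟩) [] [] [] P₀
        Fin.elim0 Fin.elim0 _ 0 S (Subst.id _) hT hS
        ⟨fun x => x.elim0, fun x => x.elim0, fun x => x.elim0, fun x => x.elim0⟩
        (fun F hF => absurd hF (Multiset.notMem_zero F)) hP
      rwa [CProc.subst_eq] at this
    have h2 : Adv R₀ Init ⟨E, freeName, ∅⟩ Q := by
      have := Adv.mk (R₀ := R₀) (Init := Init) (st := ⟨E, freeName, ∅⟩) Q Fin.elim0 Fin.elim0
        hQ.fn_subset hQ.noEvent hQ.onlyPublic (fun x => x.elim0) (fun x => x.elim0)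
        (fun x => x.elim0) (fun x => x.elim0)
      rwa [CProc.subst_eq] at this
    refine ⟨{(some ([], []), P₀), (none, Q)}, by simp, ?_, fun x => ?_⟩
    · intro d hd
      simp only [Multiset.insert_eq_cons, Multiset.mem_cons, Multiset.mem_singleton] at hd
      obtain rfl | rfl := hd
      exacts [h1, h2]
    · have : occ (𝒞 := 𝒞) E freeName x = 0 := by simp [occ, freeName, Pattern.addr]
      simp only [this, Multiset.insert_eq_cons, Multiset.map_cons, Multiset.map_singleton,
        Multiset.sum_cons, Multiset.sum_singleton, ind_none]
      rw [ind]
      split_ifs <;> simp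

/-! ## Injectivity of the patterns of names -/

theorem Inv.exists_name {C : Config 𝒞} {lam : Name → Pattern 𝒞.toConSig}
    {Me : Set (Pattern 𝒞.toConSig)} {K : ℕ} (h : Inv R₀ Init E₀ C lam Me K) {a : Name}
    (ha : a ∈ C.env) : ∃ b k args sess, lam a = .name b k args sess := by
  obtain h | h | ⟨x, hx⟩ := h.kinds a ha
  · exact ⟨_, _, _, _, h⟩
  · exact ⟨_, _, _, _, h⟩
  · generalize lam a = p at hx
    cases p with
    | name b k args sess => exact ⟨_, _, _, _, rfl⟩
    | _ => cases hx

theorem freeName_injective {S : ConSig} {a b : Name}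
    (h : (freeName a : Pattern S) = freeName b) : a = b := by
  simpa [freeName] using h

/-- At most one name is created per address, so names of protocol restrictions with equal patterns
are equal. Free names and adversary names have no address and are told apart by their symbol and by
the name that their pattern records. -/
theorem Inv.injOn {C : Config 𝒞} {lam : Name → Pattern 𝒞.toConSig}
    {Me : Set (Pattern 𝒞.toConSig)} {K : ℕ} (h : Inv R₀ Init E₀ C lam Me K) :
    Set.InjOn lam C.env := by
  classical
  intro a ha b hb hab
  by_cases hx : ∃ x, (lam a).addr = some x
  · obtain ⟨x, hx⟩ := hx
    have := h.occ_le x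
    exact Finset.card_le_one.1 this a (Finset.mem_filter.2 ⟨ha, hx⟩) b
      (Finset.mem_filter.2 ⟨hb, hab ▸ hx⟩)
  · obtain h1 | h1 | h1 := h.kinds a ha <;> [skip; skip; exact absurd h1 hx] <;>
      obtain h2 | h2 | h2 := h.kinds b hb <;> rw [← hab] at h2 <;>
      first
      | exact absurd h2 hx
      | skip
    · exact freeName_injective (h1.symm.trans h2)
    · simp [h1, freeName, advName] at h2
    · simp [h1, freeName, advName] at h2
    · have := h1.symm.trans h2
      simp only [advName, Pattern.name.injEq, heq_eq_eq, true_and, and_true] at this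
      exact freeName_injective (congrFun this 0)

/-- Names are encoded by name patterns, never by constructor applications, so the structure of the
term can be read off; at the leaves `Inv.injOn` applies. -/
theorem Inv.encTerm_injective {C : Config 𝒞} {lam : Name → Pattern 𝒞.toConSig}
    {Me : Set (Pattern 𝒞.toConSig)} {K : ℕ} (h : Inv R₀ Init E₀ C lam Me K) {M N : CTerm 𝒞}
    (hM : M.fn ⊆ (C.env : Set Name)) (hN : N.fn ⊆ (C.env : Set Name))
    (he : encTerm lam M = encTerm lam N) : M = N := by
  induction M generalizing N with
  | var x => exact x.elim0
  | name a =>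
    rcases a with a | b
    · have ha : a ∈ C.env := hM (by simp [PTerm.fn, Term.names])
      obtain ⟨_, _, _, _, hl⟩ := h.exists_name ha
      cases N with
      | var x => exact x.elim0
      | name b =>
        rcases b with b | c
        · rw [h.injOn ha (hN (by simp [PTerm.fn, Term.names])) he]
        · exact c.elim0
      | app f args => cases hl.symm.trans he
    · exact b.elim0
  | app f args ih =>
    cases N with
    | var x => exact x.elim0
    | name b =>
      rcases b with b | c
      · obtain ⟨_, _, _, _, hl⟩ := h.exists_name (hN (by simp [PTerm.fn, Term.names]) : b ∈ C.env)
        cases he.trans hl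
      · exact c.elim0
    | app f' args' =>
      simp only [encTerm, Term.toPattern] at he
      injection he with hf hargs
      subst hf
      congr 1
      funext i
      exact ih i (fun a ha => hM (Set.mem_iUnion.2 ⟨i, ha⟩))
        (fun a ha => hN (Set.mem_iUnion.2 ⟨i, ha⟩)) (congrFun (eq_of_heq hargs) i)

/-- A pattern of a term that has an instance that is the pattern of a closed term. -/
theorem Inv.inst_eq {C : Config 𝒞} {lam : Name → Pattern 𝒞.toConSig}
    {Me : Set (Pattern 𝒞.toConSig)} {K n : ℕ} (h : Inv R₀ Init E₀ C lam Me K)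
    {τ : Subst 𝒞.toConSig} {σ : Fin n → CTerm 𝒞}
    (hσ : ∀ (x : Fin n) (N : CTerm 𝒞), N.fn ⊆ (C.env : Set Name) → τ.ord x = encTerm lam N →
      encTerm lam (σ x) = encTerm lam N ∧ (σ x).fn ⊆ (C.env : Set Name))
    {M : PTerm 𝒞 n 0} (hM : M.fn ⊆ E₀) {N : CTerm 𝒞} (hN : N.fn ⊆ (C.env : Set Name))
    (he : M.pat.subst τ = encTerm lam N) : M.inst σ = N := by
  induction M generalizing N with
  | var x =>
    -- The recursion descends through subterms of a closed term, so a variable is only ever met with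
    -- the encoding of a closed term as value. Nothing is required of the other values of `τ`.
    obtain ⟨h1, h2⟩ := hσ x N hN he
    exact h.encTerm_injective h2 hN h1
  | name a =>
    rcases a with a | b
    · have ha : a ∈ E₀ := hM (by simp [PTerm.fn, Term.names])
      refine h.encTerm_injective (M := .name (.inl a)) (fun b hb => ?_) hN ?_
      · obtain rfl : b = a := by simpa [PTerm.fn, Term.names] using hb
        exact h.setup.init.subset ha
      · rw [← he]
        exact (h.setup.init.lam a ha).trans (freeName_subst a τ).symm
    · exact b.elim0
  | app f args ih =>
    cases N with
    | var x => exact x.elim0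
    | name b =>
      rcases b with b | c
      · obtain ⟨_, _, _, _, hl⟩ := h.exists_name (hN (by simp [PTerm.fn, Term.names]) : b ∈ C.env)
        cases he.trans hl
      · exact c.elim0
    | app f' args' =>
      simp only [PTerm.pat, encTerm, Term.toPattern, Pattern.subst] at he
      injection he with hf hargs
      subst hf
      change Term.app f _ = _
      congr 1
      funext i
      exact ih i (fun a ha => hM (Set.mem_iUnion.2 ⟨i, ha⟩))
        (fun a ha => hN (Set.mem_iUnion.2 ⟨i, ha⟩)) (congrFun (eq_of_heq hargs) i)

end ProVerif

/-! ### From the facts satisfied by a trace to derivations, and back from patterns to atoms -/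

namespace ProVerif

variable {𝒞 : Calculus} {R₀ : Set (Clause 𝒞.toConSig)} {Init : Finset Name} {E₀ : Set Name}

/-! ## Traces -/

/-- The patterns of the events executed by the first `k` reductions. -/
def eventPatterns (T : ℕ → Config 𝒞) (lam : Name → Pattern 𝒞.toConSig) (k : ℕ) :
    Set (Pattern 𝒞.toConSig) :=
  {p | ∃ i < k, ∃ M, IsEvent M (T i) (T (i + 1)) ∧ p = encTerm lam M}

/-- The names `lam` give patterns to the terms of the first `k` reductions, in such a way that the
facts that hold in the trace are derivable. -/
structure TraceInv (R₀ : Set (Clause 𝒞.toConSig)) (Init : Finset Name) (E₀ : Set Name)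
    (T : ℕ → Config 𝒞) (k : ℕ) (lam : Name → Pattern 𝒞.toConSig) : Prop where
  inv : ∃ K, Inv R₀ Init E₀ (T k) lam (eventPatterns T lam k) K
  event : ∀ i < k, ∀ M, IsEvent M (T i) (T (i + 1)) → M.fn ⊆ ((T k).env : Set Name) ∧
    Der R₀ (eventPatterns T lam k) (.event (encTerm lam M))
  comm : ∀ i < k, ∀ M N, IsComm M N (T i) (T (i + 1)) → M.fn ⊆ ((T k).env : Set Name) ∧
    N.fn ⊆ ((T k).env : Set Name) ∧
    Der R₀ (eventPatterns T lam k) (.message (encTerm lam M) (encTerm lam N))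

theorem TraceInv.succ {T : ℕ → Config 𝒞} {k : ℕ} {lam : Name → Pattern 𝒞.toConSig}
    (h : TraceInv R₀ Init E₀ T k lam) (hs : Step (T k) (T (k + 1))) :
    ∃ lam', TraceInv R₀ Init E₀ T (k + 1) lam' := by
  obtain ⟨K, hK⟩ := h.inv
  have hmono : eventPatterns T lam k ⊆ eventPatterns T lam (k + 1) := by
    rintro p ⟨i, hi, M, hM, rfl⟩
    exact ⟨i, by omega, M, hM, rfl⟩
  -- The event of the current reduction is made a must-event before the reduction is taken, as its
  -- continuation relies on it.
  have hK' := hK.mono hmono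
  have hev : ∀ i < k + 1, ∀ M, IsEvent M (T i) (T (i + 1)) → M.fn ⊆ ((T k).env : Set Name) ∧
      Der R₀ (eventPatterns T lam (k + 1)) (.event (encTerm lam M)) := by
    intro i hi M hM
    obtain hi | rfl := Nat.lt_succ_iff_lt_or_eq.1 hi
    · exact ⟨(h.event i hi M hM).1, (h.event i hi M hM).2.mono hmono⟩
    · exact hK'.event hM
  have hcomm : ∀ i < k + 1, ∀ M N, IsComm M N (T i) (T (i + 1)) →
      M.fn ⊆ ((T k).env : Set Name) ∧ N.fn ⊆ ((T k).env : Set Name) ∧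
      Der R₀ (eventPatterns T lam (k + 1)) (.message (encTerm lam M) (encTerm lam N)) := by
    intro i hi M N hM
    obtain hi | rfl := Nat.lt_succ_iff_lt_or_eq.1 hi
    · obtain ⟨h1, h2, h3⟩ := h.comm i hi M N hM
      exact ⟨h1, h2, h3.mono hmono⟩
    · exact hK'.comm hM
  obtain ⟨lam', K', hinv, hE, hlam⟩ := hK'.step hs fun M hM => ⟨k, by omega, M, hM, rfl⟩
  have hE : ((T k).env : Set Name) ⊆ ((T (k + 1)).env : Set Name) := Finset.coe_subset.2 hE
  have henc : ∀ M : CTerm 𝒞, M.fn ⊆ ((T k).env : Set Name) →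
      encTerm lam' M = encTerm lam M := fun M hM => encTerm_congr fun a ha => hlam a (hM ha)
  -- All events up to this reduction use names already present in `T k`, on which `lam'` and `lam`
  -- agree.
  have hMe : eventPatterns T lam' (k + 1) = eventPatterns T lam (k + 1) := by
    ext p
    constructor
    · rintro ⟨i, hi, M, hM, rfl⟩
      exact ⟨i, hi, M, hM, henc M (hev i hi M hM).1⟩
    · rintro ⟨i, hi, M, hM, rfl⟩
      exact ⟨i, hi, M, hM, (henc M (hev i hi M hM).1).symm⟩
  refine ⟨lam', ⟨K', by rwa [hMe]⟩, fun i hi M hM => ?_, fun i hi M N hM => ?_⟩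
  · obtain ⟨h1, h2⟩ := hev i hi M hM
    rw [hMe, henc M h1]
    exact ⟨h1.trans hE, h2⟩
  · obtain ⟨h1, h2, h3⟩ := hcomm i hi M N hM
    rw [hMe, henc M h1, henc N h2]
    exact ⟨h1.trans hE, h2.trans hE, h3⟩

theorem exists_traceInv {P₀ Q : CProc 𝒞} {E : Finset Name} {T : ℕ → Config 𝒞} {len : ℕ}
    (hatt : attackerClauses 𝒞 Init ⊆ R₀) {S : Set (Clause 𝒞.toConSig)}
    (hT : P₀.instr.Translates ⟨Fin.elim0, Fin.elim0, Fin.elim0⟩ 0 S)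
    (hS : S ⊆ R₀) (hQ : IsAdversary Init Q) (hP : P₀.fn ⊆ (E : Set Name)) (hI : Init ⊆ E)
    (h0 : T 0 = ⟨E, {P₀, Q}⟩) (hlen : IsTrace T len) :
    ∃ lam, TraceInv R₀ Init (E : Set Name) T len lam := by
  have : ∀ k ≤ len, ∃ lam, TraceInv R₀ Init (E : Set Name) T k lam := by
    intro k
    induction k with
    | zero =>
      intro _
      refine ⟨freeName, ⟨0, ?_⟩, by simp, by simp⟩
      have hMe : eventPatterns T freeName 0 = ∅ := by simp [eventPatterns]
      rw [hMe, h0]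
      exact Inv.start hatt hT hS hQ hP hI
    | succ k ih =>
      intro hk
      obtain ⟨lam, h⟩ := ih (by omega)
      exact h.succ (hlen k (by omega))
  exact this len le_rfl

/-- The fact of a closed atom, given the patterns of names. -/
def Atom.enc (lam : Name → Pattern 𝒞.toConSig) : Atom 𝒞 0 → HornFact 𝒞.toConSig
  | .attacker M => .attacker (encTerm lam M)
  | .message M N => .message (encTerm lam M) (encTerm lam N)
  | .event M => .event (encTerm lam M)

theorem TraceInv.der {T : ℕ → Config 𝒞} {len : ℕ} {lam : Name → Pattern 𝒞.toConSig}
    (h : TraceInv R₀ Init E₀ T len lam) {A : Atom 𝒞 0} (hA : TraceSat Init T len A) :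
    Der R₀ (eventPatterns T lam len) (A.enc lam) ∧ A.fn ⊆ ((T len).env : Set Name) := by
  cases A with
  | attacker M =>
    obtain ⟨i, hi, c, hc, hM⟩ := hA
    obtain ⟨-, h2, h3⟩ := h.comm i hi _ _ hM
    obtain ⟨K, hK⟩ := h.inv
    -- The channel is in `Init`, hence known to the attacker, who can listen on it.
    refine ⟨h3.attacker_of_message hK.setup.clauses ?_, h2⟩
    have := Der.attacker_init (Me := eventPatterns T lam len) hK.setup.clauses hc
    rwa [← hK.setup.init.lam c (hK.setup.subset hc)] at this
  | message M N =>
    obtain ⟨i, hi, hM⟩ := hA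
    obtain ⟨h1, h2, h3⟩ := h.comm i hi _ _ hM
    exact ⟨h3, Set.union_subset h1 h2⟩
  | event M =>
    obtain ⟨i, hi, hM⟩ := hA
    exact (h.event i hi M hM).symm

theorem PTerm.pat_subst_ofFin {n : ℕ} {lam : Name → Pattern 𝒞.toConSig} (σ : Fin n → CTerm 𝒞)
    {M : PTerm 𝒞 n 0} (hM : ∀ a ∈ M.fn, lam a = freeName a) :
    M.pat.subst (Subst.ofFin fun x => encTerm lam (σ x)) = encTerm lam (M.inst σ) := by
  rw [PTerm.pat, Term.toPattern_subst, PTerm.inst, encTerm_subst]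
  refine Term.toPattern_congr (fun x _ => Subst.ofFin_ord _ x) fun a ha => ?_
  rcases a with a | b
  · simp only [Sum.elim_inl, freeName_subst, hM a ha]
  · exact b.elim0

theorem Atom.fact_subst_ofFin {n : ℕ} {lam : Name → Pattern 𝒞.toConSig} (σ : Fin n → CTerm 𝒞)
    {A : Atom 𝒞 n} (hA : ∀ a ∈ A.fn, lam a = freeName a) :
    A.fact.subst (Subst.ofFin fun x => encTerm lam (σ x)) = (A.inst σ).enc lam := by
  cases A with
  | message M N =>
    simp only [Atom.fact, HornFact.subst, Atom.inst, Atom.enc,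
      PTerm.pat_subst_ofFin σ fun a ha => hA a (.inl ha),
      PTerm.pat_subst_ofFin σ fun a ha => hA a (.inr ha)]
  | _ M =>
    simp only [Atom.fact, HornFact.subst, Atom.inst, Atom.enc, PTerm.pat_subst_ofFin (M := M) σ hA]

theorem Inv.atom_inst_eq {C : Config 𝒞} {lam : Name → Pattern 𝒞.toConSig}
    {Me : Set (Pattern 𝒞.toConSig)} {K n : ℕ} (h : Inv R₀ Init E₀ C lam Me K)
    {τ : Subst 𝒞.toConSig} {σ : Fin n → CTerm 𝒞}
    (hσ : ∀ (x : Fin n) (N : CTerm 𝒞), N.fn ⊆ (C.env : Set Name) → τ.ord x = encTerm lam N →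
      encTerm lam (σ x) = encTerm lam N ∧ (σ x).fn ⊆ (C.env : Set Name))
    {A : Atom 𝒞 n} (hA : A.fn ⊆ E₀) {B : Atom 𝒞 0} (hB : B.fn ⊆ (C.env : Set Name))
    (he : A.fact.subst τ = B.enc lam) : A.inst σ = B := by
  cases A <;> cases B <;> simp only [Atom.fact, Atom.enc, HornFact.subst, reduceCtorEq,
    HornFact.attacker.injEq, HornFact.message.injEq, HornFact.event.injEq] at he <;>
    simp only [Atom.inst, Atom.attacker.injEq, Atom.message.injEq, Atom.event.injEq]
  · exact h.inst_eq hσ hA hB he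
  · exact ⟨h.inst_eq hσ (Set.subset_union_left.trans hA) (Set.subset_union_left.trans hB) he.1,
      h.inst_eq hσ (Set.subset_union_right.trans hA) (Set.subset_union_right.trans hB) he.2⟩
  · exact h.inst_eq hσ hA hB he

end ProVerif

/-! ### The correspondence, from a returned clause to the executed events -/

theorem mainTheorem3 (𝒞 : Calculus) (sel : Selection 𝒞.toConSig) (Fnot : Set (HornFact 𝒞.toConSig))
    (Init : Finset Name) (P₀ : CProc 𝒞) (n : ℕ) (c : Correspondence 𝒞 n)
    (out : Set (Clause 𝒞.toConSig))
    (hsolve : Solve sel Fnot P₀.instr Init c.α.fact out)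
    (hshape : ∀ R ∈ out, ∃ (j : Fin c.m) (σ' : Subst 𝒞.toConSig),
      (∀ k, HornFact.mevent ((c.M j k).pat.subst σ') ∈ R.hyps) ∧
      R.concl = (c.αs j).fact.subst σ') :
    Satisfies P₀ Init c := by
  classical
  obtain ⟨R₀, R₁, ⟨S, hS, rfl⟩, hsat, hnot, hder⟩ := hsolve
  intro Q hQ E hE σ T len h0 hT hα
  have hEP : P₀.fn ⊆ (E : Set Name) := fun a ha => hE (.inl (.inl ha))
  have hEI : Init ⊆ E := fun a ha => hE (.inl (.inr ha))
  have hEα : c.α.fn ⊆ (E : Set Name) := fun a ha => hE (.inr (.inl (.inl ha)))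
  have hEαs : ∀ j, (c.αs j).fn ⊆ (E : Set Name) := fun j a ha =>
    hE (.inr (.inl (.inr (Set.mem_iUnion.2 ⟨j, ha⟩))))
  have hEM : ∀ j k, (c.M j k).fn ⊆ (E : Set Name) := fun j k a ha =>
    hE (.inr (.inr (Set.mem_iUnion.2 ⟨j, Set.mem_iUnion.2 ⟨k, ha⟩⟩)))
  obtain ⟨lam, hlam⟩ := exists_traceInv (R₀ := S ∪ attackerClauses 𝒞 Init) Set.subset_union_right
    hS Set.subset_union_left hQ hEP hEI h0 hT
  obtain ⟨K, hK⟩ := hlam.inv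
  obtain ⟨hd, hfn⟩ := hlam.der hα
  have hαenc := Atom.fact_subst_ofFin (lam := lam) σ
    fun a ha => hK.setup.init.lam a (hEα ha)
  rw [← hαenc] at hd
  have hme : NoMevent (S ∪ attackerClauses 𝒞 Init) := by
    rintro R (hR | hR)
    exacts [hS.noMevent R hR, attackerClauses_noMevent Init R hR]
  -- The must-event set is the set of patterns of the executed events, so `hm` says that the
  -- must-events of `R` were executed.
  obtain ⟨R, hR, δ, hc, hm⟩ := hsat.exists_mem Set.subset_union_right hme hnot hder hd
  obtain ⟨j, σ', hk, hj⟩ := hshape R hR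
  rw [hαenc, hj, HornFact.subst_subst] at hc
  -- The substitution on patterns is decoded into one on terms. Variables whose value encodes no
  -- closed term over the current names do not occur in the atom or events concerned, so the default
  -- name `0` is arbitrary.
  let θ : Fin n → CTerm 𝒞 := fun x =>
    if h : ∃ N : CTerm 𝒞, N.fn ⊆ ((T len).env : Set Name) ∧
      (σ'.comp δ).ord x = encTerm lam N then h.choose else .name (.inl 0)
  have hθ : ∀ (x : Fin n) (N : CTerm 𝒞), N.fn ⊆ ((T len).env : Set Name) →
      (σ'.comp δ).ord x = encTerm lam N →
      encTerm lam (θ x) = encTerm lam N ∧ (θ x).fn ⊆ ((T len).env : Set Name) := by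
    intro x N hN hx
    have h : ∃ N : CTerm 𝒞, N.fn ⊆ ((T len).env : Set Name) ∧
      (σ'.comp δ).ord x = encTerm lam N := ⟨N, hN, hx⟩
    simp only [θ, dif_pos h]
    exact ⟨h.choose_spec.2.symm.trans hx, h.choose_spec.1⟩
  refine ⟨θ, j, hK.atom_inst_eq hθ (hEαs j) hfn hc, fun k => ?_⟩
  -- The `k`-th must-event has the pattern of an event executed at step `i`; decoding identifies its
  -- term with the required instance.
  obtain ⟨i, hi, M, hM, he⟩ := hm _ (hk k)
  rw [Pattern.subst_subst] at he
  rw [hK.inst_eq hθ (hEM j k) (hlam.event i hi M hM).1 he]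
  exact ⟨i, hi, hM⟩
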